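/- **Setting.** Let $\Omega=[0,L_1]\times[0,L_2]\times[0,L_3]$ with $L_j>0$, let $\alpha_1,\alpha_2\in(\tfrac12,1)$, and let $l_{A_j},l_{B_j}>0$ ($j=1,2,3$) be constant length scales. For a function $f$ on $\Omega$ the following operators act along the line through $x$ parallel to the $x_j$-axis; $f$ is restricted to $\Omega$, so every terminal below is cut off at the end of the segment $[0,L_j]$, and prime denotes $\partial_{x_j}$. For $\alpha\in(0,1)$: - Riesz–Caputo derivative: $D^{\alpha}_{x_j}f=\tfrac12\Gamma(2-\alpha)\big[l_{A_j}^{\alpha-1}\,{}^{C}_{x_j-l_{A_j}}D^{\alpha}_{x_j}f-l_{B_j}^{\alpha-1}\,{}^{C}_{x_j}D^{\alpha}_{x_j+l_{B_j}}f\big]$, where ${}^{C}_{a}D^{\alpha}_{x}f=\frac1{\Gamma(1-\alpha)}\int_a^x(x-s)^{-\alpha}f'(s)\,ds$ and ${}^{C}_{x}D^{\alpha}_{b}f=-\frac1{\Gamma(1-\alpha)}\int_x^b(s-x)^{-\alpha}f'(s)\,ds$. - Riesz integral: $I^{1-\alpha}_{x_j}f=\tfrac12\Gamma(2-\alpha)\big[l_{B_j}^{\alpha-1}\,{}_{x_j-l_{B_j}}I^{1-\alpha}_{x_j}f+l_{A_j}^{\alpha-1}\,{}_{x_j}I^{1-\alpha}_{x_j+l_{A_j}}f\big]$,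 where ${}_{a}I^{\beta}_{x}f=\frac1{\Gamma(\beta)}\int_a^x(x-s)^{\beta-1}f(s)\,ds$ and ${}_{x}I^{\beta}_{b}f=\frac1{\Gamma(\beta)}\int_x^b(s-x)^{\beta-1}f(s)\,ds$. - Riesz–Riemann–Liouville derivative: $\mathfrak D^{\alpha}_{x_j}f=\tfrac12\Gamma(2-\alpha)\big[l_{B_j}^{\alpha-1}\,{}^{RL}_{x_j-l_{B_j}}D^{\alpha}_{x_j}f-l_{A_j}^{\alpha-1}\,{}^{RL}_{x_j}D^{\alpha}_{x_j+l_{A_j}}f\big]$, where the left and right Riemann–Liouville derivatives are $\pm\partial_{x_j}$ of the left and right fractional integrals of order $1-\alpha$, the terminals moving with $x_j$. $\nabla^{\alpha}$ and $\widetilde\nabla^{\alpha}$ are the gradients formed with $D^{\alpha}_{x_j}$ and $\mathfrak D^{\alpha}_{x_j}$, and $\mathbf I^{1-\alpha}_{\mathbf n}=(n_jI^{1-\alpha}_{x_j})_{j}$ for a vector $\mathbf n$. For a displacement $\mathbf u$ put (summation convention for repeated indices in tensor contractions) $$\epsilon_{ij}=\tfrac12(D^{\alpha_1}_{x_j}u_i+D^{\alpha_1}_{x_i}u_j),\quad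 \eta_{ijk}=D^{\alpha_2}_{x_k}\epsilon_{ij},\quad \sigma_{ij}=C_{ijkl}\epsilon_{kl},\quad \tau_{ijk}=G_{ijklmn}\eta_{lmn},$$ where $C_{ijkl}=C_{klij}=C_{jikl}$ and $G_{ijklmn}=G_{lmnijk}=G_{jiklmn}$ are constant, and $$\mathcal U(\mathbf u)=\tfrac12\int_\Omega(\epsilon_{ij}C_{ijkl}\epsilon_{kl}+\eta_{ijk}G_{ijklmn}\eta_{lmn})\,dV .$$ With $\mathbf n$ the outward normal on the faces and $R_{jm}=\delta_{jm}-n_jn_m$, define $$p_{ij}=\sigma_{ij}-\mathfrak D^{\alpha_2}_{x_k}\tau_{ijk}\ \ (\text{i.e. } p=\sigma-\widetilde\nabla^{\alpha_2}\!\cdot\tau),\qquad F_i=\mathfrak D^{\alpha_1}_{x_j}p_{ij}\ \ (F=\widetilde\nabla^{\alpha_1}\!\cdot p),$$ $$T_i=n_jI^{1-\alpha_1}_{x_j}p_{ij}-R_{jm}\,\mathfrak D^{\alpha_1}_{x_m}\big(n_kI^{1-\alpha_2}_{x_k}\tau_{ijk}\big),\qquad Q_i=n_jn_k\,I^{1-\alpha_2}_{x_k}\tau_{ijk},$$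 and, on an edge where faces with outward normals $\mathbf n_1,\mathbf n_2$ meet, with unit tangent $\mathbf s=\mathbf n_1\times\mathbf n_2$ and co-normal $\mathbf m=\mathbf s\times\mathbf n$ on either side, let $$J_i=[[\,m_jI^{1-\alpha_1}_{x_j}(n_kI^{1-\alpha_2}_{x_k}\tau_{ijk})\,]]$$ be the value for $\mathbf n=\mathbf n_1$ minus the value for $\mathbf n=\mathbf n_2$. **Regularity.** A field $\mathbf v$ has *finite energy* if it is $C^1$ up to the boundary, each $\epsilon_{ij}(\mathbf v)$ is absolutely continuous on almost every segment of $\Omega$ parallel to an axis with first partial derivatives in $L^1(\Omega)$, and $\eta(\mathbf v)\in L^2(\Omega)$. A finite-energy $\mathbf u$ has *regular stresses* if: $\eta(\mathbf u)\in L^\infty(\Omega)$; the left and right fractional integrals entering $I^{1-\alpha_2}_{x_k}\tau_{ijk}$, respectively $I^{1-\alpha_1}_{x_j}p_{ij}$, are absolutely continuous on almost every segment of $\Omega$ parallel to the $x_k$-axis, respectively the $x_j$-axis, and $\mathfrak D^{\alpha_2}_{x_k}\tau_{ijk},\ \mathfrak D^{\alpha_1}_{x_j}p_{ij}\in L^1(\Omega)$;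 and, on each face orthogonal to the $x_k$-axis and for $j\ne k$, those entering $I^{1-\alpha_1}_{x_j}(I^{1-\alpha_2}_{x_k}\tau_{ijk})$ are absolutely continuous on almost every segment of the face parallel to the $x_j$-axis and $\mathfrak D^{\alpha_1}_{x_j}(I^{1-\alpha_2}_{x_k}\tau_{ijk})$ is integrable on the face. (No summation in this paragraph.) **(1) First variation.** If $\mathbf u$ has finite energy and regular stresses and $\delta\mathbf u$ has finite energy, then $s\mapsto\mathcal U(\mathbf u+s\,\delta\mathbf u)$ is differentiable at $s=0$, with derivative $$\delta\mathcal U=-\int_\Omega\big[\widetilde\nabla^{\alpha_1}\!\cdot(\sigma-\widetilde\nabla^{\alpha_2}\!\cdot\tau)\big]\cdot\delta\mathbf u\,dV+\int_{\partial\Omega}T\cdot\delta\mathbf u\,dA+\int_{\partial\Omega}Q\cdot\big[\mathbf n\cdot(\delta\mathbf u\otimes\nabla^{\alpha_1})\big]dA+\oint_{\overline\Gamma}J\cdot\delta\mathbf u\,dl,$$ where $[\mathbf n\cdot(\mathbf v\otimes\nabla^{\alpha_1})]_i=n_jD^{\alpha_1}_{x_j}v_i$ and $\overline\Gamma$ is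 the union of the twelve edges. **(2) Hamilton's principle.** Let $t_1<t_2$ and let the density $\rho$ be constant. Let body forces $\bar{\mathbf b}$ on $\Omega$, tractions $\bar{\mathbf t}$ and double-stress tractions $\bar{\mathbf q}$ on the faces and line loads $\bar{\mathbf r}$ on the edges be integrable in space and time, with external work $$\mathcal V(\mathbf u)=\int_\Omega\bar{\mathbf b}\cdot\mathbf u\,dV+\int_{\partial\Omega}\big(\bar{\mathbf t}\cdot\mathbf u+\bar{\mathbf q}\cdot[\mathbf n\cdot(\mathbf u\otimes\nabla^{\alpha_1})]\big)dA+\oint_{\overline\Gamma}\bar{\mathbf r}\cdot\mathbf u\,dl,$$ and let $\mathcal T=\tfrac12\int_\Omega\rho\,\dot{\mathbf u}\cdot\dot{\mathbf u}\,dV$. For every component $i$ let there be chosen any set of faces on which $u_i=\bar u_i$ is prescribed, any set of faces on which $[\mathbf n\cdot(\mathbf u\otimes\nabla^{\alpha_1})]_i=[\mathbf n\cdot(\bar{\mathbf u}\otimes\nabla^{\alpha_1})]_i$ is prescribed, and any set of edges on which $u_i=\bar u_i$ is prescribed (edges of a face on which $u_i$ is prescribed are included). Let $\mathbf u(t,x)$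 be a motion that is $C^1$ in $(t,x)$ and $C^2$ in $t$ with $\ddot{\mathbf u}$ continuous in $(t,x)$, that has finite energy and regular stresses at every $t\in[t_1,t_2]$, and for which $F$, $T$, $Q$, $J$ are integrable over $[t_1,t_2]$ times $\Omega$, the faces, the faces and the edges, respectively. Admissible variations are the $C^1$ fields $\delta\mathbf u(t,x)$ of finite energy at every $t\in[t_1,t_2]$ that vanish at $t_1$ and $t_2$ and satisfy the homogeneous form of the prescribed conditions. Then the following are equivalent. (a) $\mathbf u$ satisfies the prescribed (essential) conditions on $[t_1,t_2]$, and $\int_{t_1}^{t_2}(\delta\mathcal U-\delta\mathcal V-\delta\mathcal T)\,dt=0$ for every admissible variation. (b) For almost every $(t,x)\in[t_1,t_2]\times\Omega$, $$\widetilde\nabla^{\alpha_1}\!\cdot(\sigma-\widetilde\nabla^{\alpha_2}\!\cdot\tau)+\bar{\mathbf b}=\rho\,\ddot{\mathbf u};$$ and, for every component $i$, on each face $u_i=\bar u_i$ if this is prescribed there, and otherwise $T_i=\bar t_i$ almost everywhere; on each face $[\mathbf n\cdot(\mathbf u\otimes\nabla^{\alpha_1})]_i=[\mathbf n\cdot(\bar{\mathbf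 u}\otimes\nabla^{\alpha_1})]_i$ if this is prescribed there, and otherwise $Q_i=\bar q_i$ almost everywhere; on each edge $u_i=\bar u_i$ if this is prescribed there, and otherwise $J_i=\bar r_i$ almost everywhere (essential conditions hold for all $t\in[t_1,t_2]$, natural ones for almost every $(t,x)$). -/

import Mathlib

open MeasureTheory Set Matrix

noncomputable section

namespace FracElast

/-! ## One-dimensional fractional operators -/

/-- Left Caputo derivative of order `α ∈ (0,1)` with lower terminal `a`, at `x`. -/
def leftCaputo (α a : ℝ) (f : ℝ → ℝ) (x : ℝ) : ℝ :=
  1 / Real.Gamma (1 - α) * ∫ s in a..x, (x - s) ^ (-α) * deriv f s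

/-- Right Caputo derivative of order `α ∈ (0,1)` with upper terminal `b`, at `x`. -/
def rightCaputo (α b : ℝ) (f : ℝ → ℝ) (x : ℝ) : ℝ :=
  -(1 / Real.Gamma (1 - α)) * ∫ s in x..b, (s - x) ^ (-α) * deriv f s

/-- Left fractional integral of order `β` with lower terminal `a`, at `x`. -/
def leftFracInt (β a : ℝ) (f : ℝ → ℝ) (x : ℝ) : ℝ :=
  1 / Real.Gamma β * ∫ s in a..x, (x - s) ^ (β - 1) * f s

/-- Right fractional integral of order `β` with upper terminal `b`, at `x`. -/
def rightFracInt (β b : ℝ) (f : ℝ → ℝ) (x : ℝ) : ℝ :=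
  1 / Real.Gamma β * ∫ s in x..b, (s - x) ^ (β - 1) * f s

/-- Left Riemann--Liouville derivative of order `α ∈ (0,1)`; the terminal `a x` moves with the
point, and the fractional integral is differentiated as a function of the point. -/
def leftRL (α : ℝ) (a : ℝ → ℝ) (f : ℝ → ℝ) (x : ℝ) : ℝ :=
  deriv (fun y => leftFracInt (1 - α) (a y) f y) x

/-- Right Riemann--Liouville derivative of order `α ∈ (0,1)` with moving terminal `b x`. -/
def rightRL (α : ℝ) (b : ℝ → ℝ) (f : ℝ → ℝ) (x : ℝ) : ℝ :=
  -deriv (fun y => rightFracInt (1 - α) (b y) f y) x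

/-- Left end of a horizon of length `l` at `x`, cut off at the end `0` of the segment. -/
def lowerEnd (l x : ℝ) : ℝ := max 0 (x - l)

/-- Right end of a horizon of length `l` at `x`, cut off at the end `L` of the segment. -/
def upperEnd (L l x : ℝ) : ℝ := min L (x + l)

/-- Riesz--Caputo derivative on the segment `[0, L]`, horizon `(x - lA, x + lB)`. -/
def rieszCaputo (α L lA lB : ℝ) (f : ℝ → ℝ) (x : ℝ) : ℝ :=
  1 / 2 * Real.Gamma (2 - α) *
    (lA ^ (α - 1) * leftCaputo α (lowerEnd lA x) f x
      - lB ^ (α - 1) * rightCaputo α (upperEnd L lB x) f x)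

/-- Riesz fractional integral of order `1 - α` on `[0, L]`, horizon `(x - lB, x + lA)`. -/
def rieszInt (α L lA lB : ℝ) (f : ℝ → ℝ) (x : ℝ) : ℝ :=
  1 / 2 * Real.Gamma (2 - α) *
    (lB ^ (α - 1) * leftFracInt (1 - α) (lowerEnd lB x) f x
      + lA ^ (α - 1) * rightFracInt (1 - α) (upperEnd L lA x) f x)

/-- Riesz--Riemann--Liouville derivative on `[0, L]`, horizon `(x - lB, x + lA)`. -/
def rieszRL (α L lA lB : ℝ) (f : ℝ → ℝ) (x : ℝ) : ℝ :=
  1 / 2 * Real.Gamma (2 - α) *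
    (lB ^ (α - 1) * leftRL α (lowerEnd lB) f x
      - lA ^ (α - 1) * rightRL α (upperEnd L lA) f x)

/-! ## The solid -/

/-- Points of space and vectors, in Cartesian components. -/
abbrev Vec := Fin 3 → ℝ

/-- A homogeneous cuboidal fractional strain-gradient solid: edge lengths, fractional orders,
length scales of the horizon of nonlocality along the axes (to the left, `lA`, and to the right,
`lB`), elasticity tensors of order four and six with their standard symmetries, and density. -/
structure Solid where
  len : Vec
  len_pos : ∀ j, 0 < len j
  α₁ : ℝ
  α₁_mem : α₁ ∈ Ioo (1 / 2 : ℝ) 1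
  α₂ : ℝ
  α₂_mem : α₂ ∈ Ioo (1 / 2 : ℝ) 1
  lA : Vec
  lA_pos : ∀ j, 0 < lA j
  lB : Vec
  lB_pos : ∀ j, 0 < lB j
  C : Fin 3 → Fin 3 → Fin 3 → Fin 3 → ℝ
  C_major : ∀ i j k l, C i j k l = C k l i j
  C_minor : ∀ i j k l, C i j k l = C j i k l
  G : Fin 3 → Fin 3 → Fin 3 → Fin 3 → Fin 3 → Fin 3 → ℝ
  G_major : ∀ i j k l m n, G i j k l m n = G l m n i j k
  G_minor : ∀ i j k l m n, G i j k l m n = G j i k l m n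
  ρ : ℝ

/-- The restriction of a field to the line through `x` parallel to the `j`-th axis. -/
def line (f : Vec → ℝ) (x : Vec) (j : Fin 3) : ℝ → ℝ := fun s => f (Function.update x j s)

/-- Classical partial derivative along the `j`-th axis. -/
def pderiv (j : Fin 3) (f : Vec → ℝ) (x : Vec) : ℝ := deriv (line f x j) (x j)

namespace Solid

variable (S : Solid)

/-- The closed cuboid `[0, L] × [0, B] × [0, H]`. -/
def Ω : Set Vec := Icc 0 S.len

/-- The Riesz--Caputo derivative `D^α_{x_j}`. -/
def D (α : ℝ) (j : Fin 3) (f : Vec → ℝ) (x : Vec) : ℝ :=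
  rieszCaputo α (S.len j) (S.lA j) (S.lB j) (line f x j) (x j)

/-- The Riesz fractional integral `I^{1-α}_{x_j}`. -/
def I (α : ℝ) (j : Fin 3) (f : Vec → ℝ) (x : Vec) : ℝ :=
  rieszInt α (S.len j) (S.lA j) (S.lB j) (line f x j) (x j)

/-- The Riesz--Riemann--Liouville derivative `𝔇^α_{x_j}`. -/
def 𝔇 (α : ℝ) (j : Fin 3) (f : Vec → ℝ) (x : Vec) : ℝ :=
  rieszRL α (S.len j) (S.lA j) (S.lB j) (line f x j) (x j)

/-! ### Kinematics, stresses, potential energy -/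

/-- Fractional strain `ε = (∇^{α₁} u + (∇^{α₁} u)ᵀ) / 2`. -/
def strain (u : Vec → Vec) (i j : Fin 3) (x : Vec) : ℝ :=
  1 / 2 * (S.D S.α₁ j (fun y => u y i) x + S.D S.α₁ i (fun y => u y j) x)

/-- Fractional strain gradient `η = ∇^{α₂} ε`; the last index is that of the derivative. -/
def strainGrad (u : Vec → Vec) (i j k : Fin 3) (x : Vec) : ℝ :=
  S.D S.α₂ k (S.strain u i j) x

/-- Cauchy stress `σ = C : ε`. -/
def stress (u : Vec → Vec) (i j : Fin 3) (x : Vec) : ℝ :=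
  ∑ k, ∑ l, S.C i j k l * S.strain u k l x

/-- Higher-order stress `τ = G : η`. -/
def hyperStress (u : Vec → Vec) (i j k : Fin 3) (x : Vec) : ℝ :=
  ∑ l, ∑ m, ∑ n, S.G i j k l m n * S.strainGrad u l m n x

/-- Potential energy `U = ½ ∫_Ω (ε : C : ε + η : G : η)`. -/
def energy (u : Vec → Vec) : ℝ :=
  1 / 2 * ∫ x in S.Ω,
    ((∑ i, ∑ j, ∑ k, ∑ l, S.strain u i j x * S.C i j k l * S.strain u k l x)
      + ∑ i, ∑ j, ∑ k, ∑ l, ∑ m, ∑ n,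
          S.strainGrad u i j k x * S.G i j k l m n * S.strainGrad u l m n x)

/-! ### Faces and edges of the cuboid -/

end Solid

/-- The face `(k, b)` is orthogonal to the `k`-th axis, at the far end if `b` is true and at the
origin otherwise. -/
abbrev Face := Fin 3 × Bool

/-- The edge `(l, b)` is parallel to the `l`-th axis; `b` says at which end of each of the two
other axes it lies. -/
abbrev Edge := Fin 3 × (Fin 2 → Bool)

/-- Outward unit normal of a face. -/
def normal (f : Face) : Vec := Pi.single f.1 (if f.2 then 1 else -1)

/-- The two faces that meet in an edge. -/
def Edge.face (e : Edge) (m : Fin 2) : Face := (e.1.succAbove m, e.2 m)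

namespace Solid

variable (S : Solid)

/-- The parameter rectangle of a face. -/
def faceBox (f : Face) : Set (Fin 2 → ℝ) := Icc 0 (fun m => S.len (f.1.succAbove m))

/-- Isometric parametrization of a face. -/
def facePoint (f : Face) (y : Fin 2 → ℝ) : Vec :=
  Fin.insertNth (α := fun _ => ℝ) f.1 (if f.2 then S.len f.1 else 0) y

/-- The parameter interval of an edge. -/
def edgeBox (e : Edge) : Set ℝ := Icc 0 (S.len e.1)

/-- Isometric parametrization of an edge. -/
def edgePoint (e : Edge) (z : ℝ) : Vec :=
  Fin.insertNth (α := fun _ => ℝ) e.1 z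
    (fun m => if e.2 m then S.len (e.1.succAbove m) else 0)

/-- Integral over the surface `∂Ω` of a function that may depend on the face. -/
def surfaceIntegral (g : Face → Vec → ℝ) : ℝ :=
  ∑ f : Face, ∫ y in S.faceBox f, g f (S.facePoint f y)

/-- Integral over all edges, of a function that may depend on the edge. -/
def edgeIntegral (g : Edge → Vec → ℝ) : ℝ :=
  ∑ e : Edge, ∫ z in S.edgeBox e, g e (S.edgePoint e z)

/-! ### The tensor expressions of the strong form -/

/-- `σ - ∇̃^{α₂} · τ`. -/
def effStress (u : Vec → Vec) (i j : Fin 3) (x : Vec) : ℝ :=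
  S.stress u i j x - ∑ k, S.𝔇 S.α₂ k (S.hyperStress u i j k) x

/-- `∇̃^{α₁} · (σ - ∇̃^{α₂} · τ)`. -/
def internalForce (u : Vec → Vec) (i : Fin 3) (x : Vec) : ℝ :=
  ∑ j, S.𝔇 S.α₁ j (S.effStress u i j) x

/-- `I^{1-α₂}_n · τ`. -/
def normalHyper (n : Vec) (u : Vec → Vec) (i j : Fin 3) (x : Vec) : ℝ :=
  ∑ k, n k * S.I S.α₂ k (S.hyperStress u i j k) x

/-- The projector `R = 1 - n ⊗ n`. -/
def proj (n : Vec) : Matrix (Fin 3) (Fin 3) ℝ := 1 - Matrix.vecMulVec n n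

/-- `I^{1-α₁}_n · (σ - ∇̃^{α₂} · τ) - R : ((I^{1-α₂}_n · τ) ⊗ ∇̃^{α₁})`. -/
def traction (n : Vec) (u : Vec → Vec) (i : Fin 3) (x : Vec) : ℝ :=
  (∑ j, n j * S.I S.α₁ j (S.effStress u i j) x)
    - ∑ j, ∑ m, proj n j m * S.𝔇 S.α₁ m (S.normalHyper n u i j) x

/-- `[I^{1-α₂}_n ⊗ n] : τ`. -/
def doubleTraction (n : Vec) (u : Vec → Vec) (i : Fin 3) (x : Vec) : ℝ :=
  ∑ j, ∑ k, n k * n j * S.I S.α₂ k (S.hyperStress u i j k) x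

/-- `n · (v ⊗ ∇^{α₁})`. -/
def normalGrad (n : Vec) (v : Vec → Vec) (i : Fin 3) (x : Vec) : ℝ :=
  ∑ j, n j * S.D S.α₁ j (fun y => v y i) x

/-- `I^{1-α₁}_m · (I^{1-α₂}_n · τ)`. -/
def edgeForce (n m : Vec) (u : Vec → Vec) (i : Fin 3) (x : Vec) : ℝ :=
  ∑ j, m j * S.I S.α₁ j (S.normalHyper n u i j) x

/-- The jump `[[ I^{1-α₁}_m · (I^{1-α₂}_n · τ) ]]` across an edge. With `n₁`, `n₂` the outward
normals of the two faces that meet there, the edge carries the unit tangent `s = n₁ × n₂`, and on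
either side the co-normal is `m = s × n`. -/
def jump (e : Edge) (u : Vec → Vec) (i : Fin 3) (x : Vec) : ℝ :=
  let n₁ := normal (e.face 0)
  let n₂ := normal (e.face 1)
  let s := crossProduct n₁ n₂
  S.edgeForce n₁ (crossProduct s n₁) u i x - S.edgeForce n₂ (crossProduct s n₂) u i x

/-! ### Regularity -/

/-- `f` is absolutely continuous on almost every segment of `Ω` parallel to the `j`-th axis. -/
def ACLines (j : Fin 3) (f : Vec → ℝ) : Prop :=
  ∀ᵐ x ∂(volume.restrict S.Ω), AbsolutelyContinuousOnInterval (line f x j) 0 (S.len j)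

/-- The left and right fractional integrals of order `1 - α` of `f`, with the terminals of
`I^{1-α}_{x_j}`, are absolutely continuous on the segment of `Ω` through `x` parallel to the
`j`-th axis. -/
def FracIntAC (α : ℝ) (j : Fin 3) (f : Vec → ℝ) (x : Vec) : Prop :=
  AbsolutelyContinuousOnInterval
      (fun s => leftFracInt (1 - α) (lowerEnd (S.lB j) s) (line f x j) s) 0 (S.len j) ∧
    AbsolutelyContinuousOnInterval
      (fun s => rightFracInt (1 - α) (upperEnd (S.len j) (S.lA j) s) (line f x j) s) 0 (S.len j)

/-- Displacements (and variations) of finite strain-gradient energy: continuously differentiable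
up to the boundary, with a strain regular enough for its Riesz--Caputo gradient to be defined,
and with a square integrable strain gradient. -/
structure FiniteEnergy (v : Vec → Vec) : Prop where
  contDiff : ContDiff ℝ 1 v
  strain_ac : ∀ i j k, S.ACLines k (S.strain v i j)
  strain_deriv : ∀ i j k, IntegrableOn (pderiv k (S.strain v i j)) S.Ω
  strainGrad_memLp : ∀ i j k, MemLp (S.strainGrad v i j k) 2 (volume.restrict S.Ω)

/-- The stresses of `u` are regular enough for the Riesz--Riemann--Liouville derivatives and the
boundary values of the Riesz integrals that enter the strong form to exist. -/
structure RegularStress (u : Vec → Vec) : Prop where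
  bounded : ∀ i j k, MemLp (S.strainGrad u i j k) ⊤ (volume.restrict S.Ω)
  hyper_ac : ∀ i j k, ∀ᵐ x ∂(volume.restrict S.Ω),
    S.FracIntAC S.α₂ k (S.hyperStress u i j k) x
  hyper_int : ∀ i j k, IntegrableOn (S.𝔇 S.α₂ k (S.hyperStress u i j k)) S.Ω
  eff_ac : ∀ i j, ∀ᵐ x ∂(volume.restrict S.Ω), S.FracIntAC S.α₁ j (S.effStress u i j) x
  eff_int : ∀ i j, IntegrableOn (S.𝔇 S.α₁ j (S.effStress u i j)) S.Ω
  face_ac : ∀ (f : Face) (i j : Fin 3), j ≠ f.1 →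
    ∀ᵐ y ∂(volume.restrict (S.faceBox f)),
      S.FracIntAC S.α₁ j (S.I S.α₂ f.1 (S.hyperStress u i j f.1)) (S.facePoint f y)
  face_int : ∀ (f : Face) (i j : Fin 3), j ≠ f.1 →
    IntegrableOn
      (fun y => S.𝔇 S.α₁ j (S.I S.α₂ f.1 (S.hyperStress u i j f.1)) (S.facePoint f y))
      (S.faceBox f)

/-! ### External work, kinetic energy, Hamilton's principle -/

end Solid

/-- Prescribed loads: body force, tractions and double-stress tractions on the faces, line loads
on the edges, all depending on time. -/
structure Loads where
  b : ℝ → Vec → Vec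
  t : ℝ → Face → Vec → Vec
  q : ℝ → Face → Vec → Vec
  r : ℝ → Edge → Vec → Vec

/-- Essential boundary data: which components of the displacement, respectively of the normal
fractional gradient, are prescribed on which faces, which components of the displacement are
prescribed on which edges, and a field `ubar` that carries the prescribed values. -/
structure Essential where
  onFace : Face → Fin 3 → Prop
  gradOnFace : Face → Fin 3 → Prop
  onEdgeOnly : Edge → Fin 3 → Prop
  ubar : ℝ → Vec → Vec

/-- A displacement component is prescribed on an edge if it is so explicitly, or because it is
prescribed on one of the two (closed) faces that meet there. -/
def Essential.onEdge (B : Essential) (e : Edge) (i : Fin 3) : Prop :=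
  B.onEdgeOnly e i ∨ ∃ m, B.onFace (e.face m) i

/-- Velocity of a motion. -/
def velocity (u : ℝ → Vec → Vec) (t : ℝ) (x : Vec) : Vec := deriv (fun s => u s x) t

/-- First variation of a functional `F` at `u` in the direction `v`. -/
def firstVariation (F : (Vec → Vec) → ℝ) (u v : Vec → Vec) : ℝ :=
  deriv (fun s : ℝ => F (u + s • v)) 0

namespace Solid

variable (S : Solid)

/-- Work of the external loads at time `t`. -/
def work (P : Loads) (t : ℝ) (u : Vec → Vec) : ℝ :=
  (∫ x in S.Ω, ∑ i, P.b t x i * u x i)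
    + S.surfaceIntegral (fun f x =>
        ∑ i, (P.t t f x i * u x i + P.q t f x i * S.normalGrad (normal f) u i x))
    + S.edgeIntegral (fun e x => ∑ i, P.r t e x i * u x i)

/-- Kinetic energy as a function of the velocity field. -/
def kinetic (w : Vec → Vec) : ℝ := 1 / 2 * ∫ x in S.Ω, S.ρ * ∑ i, w x i * w x i

/-- Product of the time interval with `Ω`, as a measure. -/
def timeVol (t₁ t₂ : ℝ) : Measure (ℝ × Vec) :=
  (volume.restrict (Icc t₁ t₂)).prod (volume.restrict S.Ω)

/-- Product of the time interval with a face (in its parametrization), as a measure. -/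
def timeFace (t₁ t₂ : ℝ) (f : Face) : Measure (ℝ × (Fin 2 → ℝ)) :=
  (volume.restrict (Icc t₁ t₂)).prod (volume.restrict (S.faceBox f))

/-- Product of the time interval with an edge (in its parametrization), as a measure. -/
def timeEdge (t₁ t₂ : ℝ) (e : Edge) : Measure (ℝ × ℝ) :=
  (volume.restrict (Icc t₁ t₂)).prod (volume.restrict (S.edgeBox e))

/-- The loads are integrable over the time interval and the set that they act on. -/
structure IntegrableLoads (t₁ t₂ : ℝ) (P : Loads) : Prop where
  b : ∀ i, Integrable (fun z => P.b z.1 z.2 i) (S.timeVol t₁ t₂)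
  t : ∀ f i, Integrable (fun z => P.t z.1 f (S.facePoint f z.2) i) (S.timeFace t₁ t₂ f)
  q : ∀ f i, Integrable (fun z => P.q z.1 f (S.facePoint f z.2) i) (S.timeFace t₁ t₂ f)
  r : ∀ e i, Integrable (fun z => P.r z.1 e (S.edgePoint e z.2) i) (S.timeEdge t₁ t₂ e)

/-- Motions for which all terms of the strong form exist and are integrable in space and time. -/
structure RegularMotion (t₁ t₂ : ℝ) (u : ℝ → Vec → Vec) : Prop where
  contDiff : ContDiff ℝ 1 (fun z : ℝ × Vec => u z.1 z.2)
  contDiff_time : ∀ x, ContDiff ℝ 2 (fun t => u t x)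
  accel_cont : Continuous (fun z : ℝ × Vec => velocity (velocity u) z.1 z.2)
  finiteEnergy : ∀ t ∈ Icc t₁ t₂, S.FiniteEnergy (u t)
  regularStress : ∀ t ∈ Icc t₁ t₂, S.RegularStress (u t)
  force_int : ∀ i, Integrable (fun z => S.internalForce (u z.1) i z.2) (S.timeVol t₁ t₂)
  traction_int : ∀ f i, Integrable
    (fun z => S.traction (normal f) (u z.1) i (S.facePoint f z.2)) (S.timeFace t₁ t₂ f)
  doubleTraction_int : ∀ f i, Integrable
    (fun z => S.doubleTraction (normal f) (u z.1) i (S.facePoint f z.2)) (S.timeFace t₁ t₂ f)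
  jump_int : ∀ e i, Integrable
    (fun z => S.jump e (u z.1) i (S.edgePoint e z.2)) (S.timeEdge t₁ t₂ e)

/-- `u` takes the prescribed values on `[t₁, t₂]` wherever essential conditions are imposed. -/
structure MeetsEssential (t₁ t₂ : ℝ) (B : Essential) (u : ℝ → Vec → Vec) : Prop where
  onFace : ∀ f i, B.onFace f i → ∀ t ∈ Icc t₁ t₂, ∀ y ∈ S.faceBox f,
    u t (S.facePoint f y) i = B.ubar t (S.facePoint f y) i
  gradOnFace : ∀ f i, B.gradOnFace f i → ∀ t ∈ Icc t₁ t₂, ∀ y ∈ S.faceBox f,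
    S.normalGrad (normal f) (u t) i (S.facePoint f y)
      = S.normalGrad (normal f) (B.ubar t) i (S.facePoint f y)
  onEdge : ∀ e i, B.onEdge e i → ∀ t ∈ Icc t₁ t₂, ∀ z ∈ S.edgeBox e,
    u t (S.edgePoint e z) i = B.ubar t (S.edgePoint e z) i

/-- Admissible variations: they vanish at the two end times and satisfy the homogeneous essential
conditions. -/
structure Admissible (t₁ t₂ : ℝ) (B : Essential) (v : ℝ → Vec → Vec) : Prop where
  contDiff : ContDiff ℝ 1 (fun z : ℝ × Vec => v z.1 z.2)
  finiteEnergy : ∀ t ∈ Icc t₁ t₂, S.FiniteEnergy (v t)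
  start : ∀ x ∈ S.Ω, v t₁ x = 0
  finish : ∀ x ∈ S.Ω, v t₂ x = 0
  onFace : ∀ f i, B.onFace f i → ∀ t ∈ Icc t₁ t₂, ∀ y ∈ S.faceBox f,
    v t (S.facePoint f y) i = 0
  gradOnFace : ∀ f i, B.gradOnFace f i → ∀ t ∈ Icc t₁ t₂, ∀ y ∈ S.faceBox f,
    S.normalGrad (normal f) (v t) i (S.facePoint f y) = 0
  onEdge : ∀ e i, B.onEdge e i → ∀ t ∈ Icc t₁ t₂, ∀ z ∈ S.edgeBox e,
    v t (S.edgePoint e z) i = 0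

/-- Hamilton's principle `∫ (δU - δV - δT) dt = 0` for all admissible variations, for a motion
that meets the essential conditions. -/
structure Hamilton (t₁ t₂ : ℝ) (P : Loads) (B : Essential) (u : ℝ → Vec → Vec) : Prop where
  essential : S.MeetsEssential t₁ t₂ B u
  stationary : ∀ v, S.Admissible t₁ t₂ B v →
    ∫ t in t₁..t₂, (firstVariation S.energy (u t) (v t)
      - firstVariation (S.work P t) (u t) (v t)
      - firstVariation S.kinetic (velocity u t) (velocity v t)) = 0

/-- The governing equation in the volume, and on every face and edge, component by component, the
essential condition where it is imposed and the natural condition elsewhere. -/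
structure StrongForm (t₁ t₂ : ℝ) (P : Loads) (B : Essential) (u : ℝ → Vec → Vec) : Prop where
  essential : S.MeetsEssential t₁ t₂ B u
  governing : ∀ i, ∀ᵐ z ∂(S.timeVol t₁ t₂),
    S.internalForce (u z.1) i z.2 + P.b z.1 z.2 i
      = S.ρ * velocity (velocity u) z.1 z.2 i
  traction : ∀ f i, ¬ B.onFace f i → ∀ᵐ z ∂(S.timeFace t₁ t₂ f),
    S.traction (normal f) (u z.1) i (S.facePoint f z.2) = P.t z.1 f (S.facePoint f z.2) i
  doubleTraction : ∀ f i, ¬ B.gradOnFace f i → ∀ᵐ z ∂(S.timeFace t₁ t₂ f),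
    S.doubleTraction (normal f) (u z.1) i (S.facePoint f z.2)
      = P.q z.1 f (S.facePoint f z.2) i
  jump : ∀ e i, ¬ B.onEdge e i → ∀ᵐ z ∂(S.timeEdge t₁ t₂ e),
    S.jump e (u z.1) i (S.edgePoint e z.2) = P.r z.1 e (S.edgePoint e z.2) i

end Solid

end FracElast

end

noncomputable section

namespace FracElast

/-! ### The convolution kernel of the Riesz operators -/

/-! All Riesz operators on a segment come from one integrable kernel k with a singularity |r|^(-α)
at 0. The Riesz–Caputo derivative is ∫ k(x-s) f'(s) ds over the segment, and the Riesz integral is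
the same with k reflected and g in place of f'. Fubini therefore moves k from f' to g, and classical
integration by parts for absolutely continuous functions yields ∫ g Dᵅf = [f I^{1-α}g] - ∫ f 𝔇ᵅg
(`integral_mul_rieszCaputo`). Testing this identity with affine f also shows that the end values of
I^{1-α}g are integrable over a family of segments (`integrable_rieszInt_trace`), so the formula
passes to the cuboid and to its faces.

First variation. Along u + s·v the energy is a quadratic polynomial in s, with derivative ∫ σ:ε(v) +
τ⋮η(v) at 0 (`hasDerivAt_energy`). Moving the derivative of order α₂ off ε(v) leaves ∫ p:ε(v) and
face terms. Symmetry of p and τ replaces ε(v) by the plain gradient. The volume term is integrated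
by parts once more. On a face the normal derivative of v stays, as the factor of Q, while the two
tangential ones are integrated by parts within the face and produce edge terms. Every edge collects
one such term from each of its two faces, and the two add up to the jump
(`first_variation_by_parts`).

Hamilton's principle. By the first variation, Fubini and integration by parts in time, the variation
of the action is the work of the residuals of the strong form (`integral_action_variation`), so the
strong form makes it vanish. The converse needs test fields, and the difficulty is that the gradient
condition is nonlocal: a field that vanishes near a face may have a nonzero Riesz–Caputo derivative
on it. The test fields are products of profiles, one-dimensional functions that are constant near
the ends of a segment and have prescribed values and Riesz–Caputo derivatives there. Prescribing
these data is a moment problem for w' against 1 and the two kernels centred at the ends. It is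
solvable because these three functions are linearly independent, the kernels being singular at
different points (`exists_isProfile`).

Profiles with zero end data still detect integrable functions (`ae_eq_zero_of_integral_profiles`).
In one variable, the integral N(s) of R over {g > s} is orthogonal to all admissible w', hence a
combination of the same three functions. It is bounded, so the kernels drop out, and it tends to 0
at the far end, so the constant does too. The end data then act as switches that isolate the volume,
one face or one edge. -/

/-- Kernel of the Riesz operators of order `1 - α`, with horizon `a` for positive and `b` for
negative arguments. -/
def rieszKer (α a b r : ℝ) : ℝ :=
  1 / 2 * Real.Gamma (2 - α) * (1 / Real.Gamma (1 - α)) *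
    ((Ioo 0 a).indicator (fun r => a ^ (α - 1) * r ^ (-α)) r
      + (Ioo (-b) 0).indicator (fun r => b ^ (α - 1) * (-r) ^ (-α)) r)

/-- Taking the adjoint reflects the kernel and so swaps the two horizons. This is why `rieszInt` and
`rieszRL` look `lB` to the left and `lA` to the right, opposite to `rieszCaputo`. -/
lemma rieszKer_neg (α a b r : ℝ) : rieszKer α a b (-r) = rieszKer α b a r := by
  unfold rieszKer
  rw [add_comm]
  congr 2
  · by_cases h : r ∈ Ioo 0 b
    · have h' : -r ∈ Ioo (-b) 0 := by constructor <;> [linarith [h.2]; linarith [h.1]]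
      simp [indicator_of_mem h, indicator_of_mem h']
    · have h' : -r ∉ Ioo (-b) 0 := fun h' => h ⟨by linarith [h'.2], by linarith [h'.1]⟩
      simp only [indicator_of_notMem h, indicator_of_notMem h']
  · by_cases h : r ∈ Ioo (-a) 0
    · have h' : -r ∈ Ioo 0 a := by constructor <;> [linarith [h.2]; linarith [h.1]]
      simp only [indicator_of_mem h, indicator_of_mem h']
    · have h' : -r ∉ Ioo 0 a := fun h' => h ⟨by linarith [h'.2], by linarith [h'.1]⟩
      simp only [indicator_of_notMem h, indicator_of_notMem h']

lemma measurable_rieszKer (α a b : ℝ) : Measurable (rieszKer α a b) := by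
  unfold rieszKer
  refine Measurable.const_mul (Measurable.add ?_ ?_) _
  · exact ((measurable_id.pow_const _).const_mul _).indicator measurableSet_Ioo
  · exact ((measurable_id.neg.pow_const _).const_mul _).indicator measurableSet_Ioo

/-- The singularity r^(-α) is integrable at 0 because α < 1, and the horizons are finite. -/
lemma integrable_rieszKer {α : ℝ} (hα : α < 1) {a b : ℝ} (ha : 0 < a) (hb : 0 < b) :
    Integrable (rieszKer α a b) := by
  have key : ∀ c : ℝ, 0 < c → Integrable ((Ioo 0 c).indicator (fun r : ℝ => c ^ (α - 1) * r ^ (-α))) := by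
    intro c hc
    rw [integrable_indicator_iff measurableSet_Ioo]
    refine Integrable.const_mul ?_ _
    exact (intervalIntegral.integrableOn_Ioo_rpow_iff hc).2 (by linarith)
  unfold rieszKer
  refine Integrable.const_mul ((key a ha).add ?_) _
  have h := (key b hb).comp_neg
  refine h.congr (Filter.Eventually.of_forall fun r => ?_)
  by_cases h : r ∈ Ioo (-b) 0
  · have h' : -r ∈ Ioo 0 b := by constructor <;> [linarith [h.2]; linarith [h.1]]
    simp only [indicator_of_mem h, indicator_of_mem h']
  · have h' : -r ∉ Ioo 0 b := fun h' => h ⟨by linarith [h'.2], by linarith [h'.1]⟩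
    simp only [indicator_of_notMem h, indicator_of_notMem h']

/-- The sign in the right Caputo derivative cancels the minus sign of the Riesz combination. The
lengths trade places because `rieszInt` uses its second length on the left. -/
lemma rieszCaputo_eq_rieszInt_deriv (α L lA lB : ℝ) (f : ℝ → ℝ) (x : ℝ) :
    rieszCaputo α L lA lB f x = rieszInt α L lB lA (deriv f) x := by
  unfold rieszCaputo rieszInt leftCaputo rightCaputo leftFracInt rightFracInt
  rw [show 1 - α - 1 = -α by ring]
  ring

/-- The Riesz integral is convolution with the kernel. -/
lemma rieszInt_eq_integral {α L lA lB : ℝ} (hA : 0 < lA) (hB : 0 < lB)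
    {g : ℝ → ℝ} {x : ℝ} (hx : x ∈ Icc 0 L)
    (hg : IntegrableOn (fun s => rieszKer α lB lA (x - s) * g s) (Icc 0 L)) :
    rieszInt α L lA lB g x = ∫ s in Icc 0 L, rieszKer α lB lA (x - s) * g s := by
  set c := 1 / 2 * Real.Gamma (2 - α) * (1 / Real.Gamma (1 - α)) with hc
  have hlow : lowerEnd lB x ≤ x := max_le hx.1 (by linarith)
  have hupp : x ≤ upperEnd L lA x := le_min hx.2 (by linarith)
  have hlow0 : 0 ≤ lowerEnd lB x := le_max_left _ _
  have huppL : upperEnd L lA x ≤ L := min_le_left _ _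
  have e1 : EqOn (fun s => rieszKer α lB lA (x - s) * g s)
      (fun s => c * lB ^ (α - 1) * ((x - s) ^ (-α) * g s)) (Ioo (lowerEnd lB x) x) := by
    intro s hs
    have h1 : x - s ∈ Ioo 0 lB :=
      ⟨by linarith [hs.2], by linarith [hs.1, le_max_right 0 (x - lB), hs.1, show x - lB ≤ lowerEnd lB x from le_max_right _ _]⟩
    have h2 : x - s ∉ Ioo (-lA) 0 := fun h => by linarith [h.2, hs.2]
    simp only [rieszKer, indicator_of_mem h1, indicator_of_notMem h2, ← hc]
    ring
  have e2 : EqOn (fun s => rieszKer α lB lA (x - s) * g s)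
      (fun s => c * lA ^ (α - 1) * ((s - x) ^ (-α) * g s)) (Ioo x (upperEnd L lA x)) := by
    intro s hs
    have h1 : x - s ∉ Ioo 0 lB := fun h => by linarith [h.1, hs.1]
    have h2 : x - s ∈ Ioo (-lA) 0 :=
      ⟨by linarith [hs.2, show upperEnd L lA x ≤ x + lA from min_le_right _ _], by linarith [hs.1]⟩
    simp only [rieszKer, indicator_of_mem h2, indicator_of_notMem h1, ← hc, neg_sub]
    ring
  have hsub1 : Ioo (lowerEnd lB x) x ⊆ Icc 0 L := fun s hs => ⟨by linarith [hs.1], by linarith [hs.2, hx.2]⟩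
  have hsub2 : Ioo x (upperEnd L lA x) ⊆ Icc 0 L := fun s hs => ⟨by linarith [hs.1, hx.1], by linarith [hs.2]⟩
  -- The kernel vanishes at 0 and outside its open horizons, so only the two half-horizons, cut off
  -- by the segment, contribute. The `max` and `min` in the terminals are exactly this cut-off.
  have hsplit : ∫ s in Icc 0 L, rieszKer α lB lA (x - s) * g s
      = ∫ s in Ioo (lowerEnd lB x) x ∪ Ioo x (upperEnd L lA x), rieszKer α lB lA (x - s) * g s := by
    rw [integral_Icc_eq_integral_Ioo]
    refine setIntegral_eq_of_subset_of_forall_sdiff_eq_zero measurableSet_Ioo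
      (union_subset ?_ ?_) ?_
    · exact fun s hs => ⟨by linarith [hs.1], by linarith [hs.2, hx.2]⟩
    · exact fun s hs => ⟨by linarith [hs.1, hx.1], by linarith [hs.2]⟩
    intro s hs
    have h1 : x - s ∉ Ioo 0 lB := fun h =>
      hs.2 (Or.inl ⟨max_lt_iff.2 ⟨hs.1.1, by linarith [h.2]⟩, by linarith [h.1]⟩)
    have h2 : x - s ∉ Ioo (-lA) 0 := fun h =>
      hs.2 (Or.inr ⟨by linarith [h.2], lt_min_iff.2 ⟨hs.1.2, by linarith [h.1]⟩⟩)
    simp only [rieszKer, indicator_of_notMem h1, indicator_of_notMem h2]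
    ring
  rw [hsplit, setIntegral_union ?_ measurableSet_Ioo (hg.mono_set hsub1) (hg.mono_set hsub2),
    setIntegral_congr_fun measurableSet_Ioo e1, setIntegral_congr_fun measurableSet_Ioo e2,
    integral_const_mul, integral_const_mul]
  · unfold rieszInt leftFracInt rightFracInt
    rw [show 1 - α - 1 = -α by ring, intervalIntegral.integral_of_le hlow,
      intervalIntegral.integral_of_le hupp, integral_Ioc_eq_integral_Ioo,
      integral_Ioc_eq_integral_Ioo, hc]
    ring
  · rw [Set.disjoint_left]
    intro s h1 h2
    exact absurd h1.2 (not_lt.2 h2.1.le)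

/-- The Riesz--Caputo derivative is convolution of the derivative with the kernel. -/
lemma rieszCaputo_eq_integral {α L lA lB : ℝ} (hA : 0 < lA) (hB : 0 < lB)
    {f : ℝ → ℝ} {x : ℝ} (hx : x ∈ Icc 0 L)
    (hf : IntegrableOn (fun s => rieszKer α lA lB (x - s) * deriv f s) (Icc 0 L)) :
    rieszCaputo α L lA lB f x = ∫ s in Icc 0 L, rieszKer α lA lB (x - s) * deriv f s := by
  rw [rieszCaputo_eq_rieszInt_deriv]
  exact rieszInt_eq_integral hB hA hx hf

/-- The kernel convolved with a bounded function is integrable at every point. -/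
lemma integrableOn_rieszKer_mul {α : ℝ} (hα : α < 1) {a b L M : ℝ} (ha : 0 < a) (hb : 0 < b)
    {h : ℝ → ℝ} (hm : AEStronglyMeasurable h (volume.restrict (Icc 0 L)))
    (hM : ∀ᵐ s ∂(volume.restrict (Icc 0 L)), |h s| ≤ M) (x : ℝ) :
    IntegrableOn (fun s => rieszKer α a b (x - s) * h s) (Icc 0 L) :=
  (((integrable_rieszKer hα ha hb).comp_sub_left x).integrableOn).mul_bdd (c := M) hm hM

/-- Young's inequality for an L¹ kernel and a bounded function; the bound is uniform in the
evaluation point. -/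
lemma abs_integral_rieszKer_mul_le {α : ℝ} (hα : α < 1) {a b L M : ℝ} (ha : 0 < a) (hb : 0 < b)
    (hM0 : 0 ≤ M) {h : ℝ → ℝ} (hM : ∀ᵐ s ∂(volume.restrict (Icc 0 L)), |h s| ≤ M) (x : ℝ) :
    |∫ s in Icc 0 L, rieszKer α a b (x - s) * h s| ≤ M * ∫ r, |rieszKer α a b r| := by
  have hk := (integrable_rieszKer hα ha hb).comp_sub_left x
  calc |∫ s in Icc 0 L, rieszKer α a b (x - s) * h s|
      ≤ ∫ s in Icc 0 L, M * |rieszKer α a b (x - s)| := by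
        refine norm_integral_le_of_norm_le (f := fun s => rieszKer α a b (x - s) * h s)
          (hk.abs.const_mul M).integrableOn ?_
        filter_upwards [hM] with s hs
        rw [Real.norm_eq_abs, abs_mul, mul_comm]
        gcongr
    _ ≤ ∫ s, M * |rieszKer α a b (x - s)| :=
        setIntegral_le_integral (hk.abs.const_mul M)
          (Filter.Eventually.of_forall fun s => by positivity)
    _ = M * ∫ r, |rieszKer α a b r| := by
        rw [integral_const_mul, integral_sub_left_eq_self (fun r => |rieszKer α a b r|)]

/-- Integrability of the double integral of a kernel against an integrable and a bounded
function, on the square of a segment. -/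
lemma integrable_rieszKer_mul_prod {α : ℝ} (hα : α < 1) {a b L : ℝ} (ha : 0 < a) (hb : 0 < b)
    {h : ℝ → ℝ} (hh : IntegrableOn h (Icc 0 L)) :
    Integrable (fun p : ℝ × ℝ => rieszKer α a b (p.1 - p.2) * h p.2)
      ((volume.restrict (Icc 0 L)).prod (volume.restrict (Icc 0 L))) := by
  -- Extended by zero, `h` is integrable on the line, so the convolution integrand is integrable on
  -- the whole plane; then restrict to the square.
  have h1 := Integrable.convolution_integrand (L := ContinuousLinearMap.mul ℝ ℝ)
    (μ := volume) (integrable_indicator_iff measurableSet_Icc |>.2 hh) (integrable_rieszKer hα ha hb)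
  have h2 := h1.mono_measure
    (Measure.prod_mono (Measure.restrict_le_self (s := Icc 0 L)) (Measure.restrict_le_self (s := Icc 0 L)))
  refine h2.congr ?_
  have : ∀ᵐ p : ℝ × ℝ ∂((volume.restrict (Icc 0 L)).prod (volume.restrict (Icc 0 L))),
      p ∈ Icc (0:ℝ) L ×ˢ Icc (0:ℝ) L := by
    rw [Measure.prod_restrict]
    exact ae_restrict_mem (measurableSet_Icc.prod measurableSet_Icc)
  filter_upwards [this] with p hp
  simp [indicator_of_mem hp.2, mul_comm]

/-- `leftRL` and `rightRL` are built on `deriv`, which is 0 by default, so each half has to be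
differentiable for their combination to be the derivative of the Riesz integral. -/
lemma hasDerivAt_rieszInt {α L lA lB : ℝ} {g : ℝ → ℝ} {x : ℝ}
    (h1 : DifferentiableAt ℝ (fun s => leftFracInt (1 - α) (lowerEnd lB s) g s) x)
    (h2 : DifferentiableAt ℝ (fun s => rightFracInt (1 - α) (upperEnd L lA s) g s) x) :
    HasDerivAt (rieszInt α L lA lB g) (rieszRL α L lA lB g x) x := by
  have := ((h1.hasDerivAt.const_mul (lB ^ (α - 1))).add
    (h2.hasDerivAt.const_mul (lA ^ (α - 1)))).const_mul (1 / 2 * Real.Gamma (2 - α))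
  convert! this using 1
  unfold rieszRL leftRL rightRL
  ring

/-- Fractional integration by parts on a segment. -/
theorem integral_mul_rieszCaputo {α L lA lB : ℝ} (hα : α < 1) (hL : 0 < L) (hA : 0 < lA)
    (hB : 0 < lB) {f g : ℝ → ℝ} (hf : AbsolutelyContinuousOnInterval f 0 L)
    (hg : IntegrableOn g (Icc 0 L))
    (h1 : AbsolutelyContinuousOnInterval
      (fun s => leftFracInt (1 - α) (lowerEnd lB s) g s) 0 L)
    (h2 : AbsolutelyContinuousOnInterval
      (fun s => rightFracInt (1 - α) (upperEnd L lA s) g s) 0 L)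
    (hbd : (∃ M, ∀ᵐ s ∂(volume.restrict (Icc 0 L)), |g s| ≤ M) ∨
      ∃ M, ∀ᵐ s ∂(volume.restrict (Icc 0 L)), |deriv f s| ≤ M) :
    ∫ x in Icc 0 L, g x * rieszCaputo α L lA lB f x
      = f L * rieszInt α L lA lB g L - f 0 * rieszInt α L lA lB g 0
        - ∫ x in Icc 0 L, f x * rieszRL α L lA lB g x := by
  have hf' : IntegrableOn (deriv f) (Icc 0 L) := by
    rw [integrableOn_Icc_iff_integrableOn_Ioc, ← intervalIntegrable_iff_integrableOn_Ioc_of_le hL.le]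
    exact hf.intervalIntegrable_deriv
  set μ := volume.restrict (Icc (0:ℝ) L) with hμ
  have hmem : ∀ᵐ x ∂μ, x ∈ Icc 0 L := ae_restrict_mem measurableSet_Icc
  have kf := integrable_rieszKer_mul_prod hα hA hB hf'
  have kg := integrable_rieszKer_mul_prod hα hB hA hg
  have kg' : Integrable (fun p : ℝ × ℝ => rieszKer α lA lB (p.1 - p.2) * g p.1) (μ.prod μ) := by
    refine kg.swap.congr (Filter.Eventually.of_forall fun p => ?_)
    simp only [Function.comp, Prod.fst_swap, Prod.snd_swap]
    rw [← rieszKer_neg, neg_sub]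
  -- The condition for Fubini. Integrability of `g` and f' alone does not control the product with a
  -- singular kernel; a bound on one of them does.
  have H : Integrable (fun p : ℝ × ℝ => rieszKer α lA lB (p.1 - p.2) * deriv f p.2 * g p.1)
      (μ.prod μ) := by
    rcases hbd with ⟨M, hM⟩ | ⟨M, hM⟩
    · exact kf.mul_bdd (c := M) hg.1.comp_fst (Measure.quasiMeasurePreserving_fst.ae hM)
    · refine (kg'.mul_bdd (c := M) hf'.1.comp_snd (Measure.quasiMeasurePreserving_snd.ae hM)).congr ?_
      exact Filter.Eventually.of_forall fun p => by ring
  have e1 : ∫ x, g x * rieszCaputo α L lA lB f x ∂μ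
      = ∫ x, ∫ s, rieszKer α lA lB (x - s) * deriv f s * g x ∂μ ∂μ := by
    refine integral_congr_ae ?_
    filter_upwards [kf.prod_right_ae, hmem] with x hx hx'
    rw [rieszCaputo_eq_integral hA hB hx' hx, integral_mul_const, mul_comm]
  -- Read from the other variable, the kernel is reflected, which turns it into the kernel of the
  -- Riesz integral.
  have e2 : ∫ s, deriv f s * rieszInt α L lA lB g s ∂μ
      = ∫ s, ∫ x, rieszKer α lA lB (x - s) * deriv f s * g x ∂μ ∂μ := by
    refine integral_congr_ae ?_
    filter_upwards [kg.prod_right_ae, hmem] with s hs hs'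
    rw [rieszInt_eq_integral hA hB hs' hs, ← integral_const_mul]
    refine integral_congr_ae (Filter.Eventually.of_forall fun x => ?_)
    simp only
    rw [← rieszKer_neg, neg_sub]
    ring
  have hAC : AbsolutelyContinuousOnInterval (rieszInt α L lA lB g) 0 L :=
    ((h1.const_mul _).add (h2.const_mul _)).const_mul _
  -- The remaining integration by parts is the classical one, between `f` and the absolutely
  -- continuous Riesz integral of `g`.
  have e3 := hf.integral_mul_deriv_eq_deriv_mul hAC
  have e4 : ∫ x in (0:ℝ)..L, f x * deriv (rieszInt α L lA lB g) x
      = ∫ x, f x * rieszRL α L lA lB g x ∂μ := by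
    rw [hμ, integral_Icc_eq_integral_Ioc, ← intervalIntegral.integral_of_le hL.le]
    refine intervalIntegral.integral_congr_ae ?_
    filter_upwards [h1.ae_differentiableAt, h2.ae_differentiableAt] with x d1 d2 hx
    rw [(hasDerivAt_rieszInt (d1 (uIoc_subset_uIcc hx)) (d2 (uIoc_subset_uIcc hx))).deriv]
  have e5 : ∫ x in (0:ℝ)..L, deriv f x * rieszInt α L lA lB g x
      = ∫ x, deriv f x * rieszInt α L lA lB g x ∂μ := by
    rw [hμ, integral_Icc_eq_integral_Ioc, ← intervalIntegral.integral_of_le hL.le]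
  rw [e4, e5] at e3
  rw [e1, integral_integral_swap H, ← e2]
  linarith

/-! ### Integration by parts and traces along a family of segments. -/

section Product

variable {Y : Type*} [MeasurableSpace Y] {ν : Measure Y} [SFinite ν] {α L lA lB : ℝ}

/-- Fractional integration by parts on a product of a segment with a measure space. -/
theorem integral_prod_mul_rieszCaputo (hα : α < 1) (hL : 0 < L) (hA : 0 < lA) (hB : 0 < lB)
    {f g : ℝ → Y → ℝ} (hf : ∀ᵐ y ∂ν, AbsolutelyContinuousOnInterval (fun s => f s y) 0 L)
    (hg : Integrable (fun p : ℝ × Y => g p.1 p.2) ((volume.restrict (Icc 0 L)).prod ν))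
    (h1 : ∀ᵐ y ∂ν, AbsolutelyContinuousOnInterval
      (fun s => leftFracInt (1 - α) (lowerEnd lB s) (fun s => g s y) s) 0 L)
    (h2 : ∀ᵐ y ∂ν, AbsolutelyContinuousOnInterval
      (fun s => rightFracInt (1 - α) (upperEnd L lA s) (fun s => g s y) s) 0 L)
    (hbd : ∀ᵐ y ∂ν, (∃ M, ∀ᵐ s ∂(volume.restrict (Icc 0 L)), |g s y| ≤ M) ∨
      ∃ M, ∀ᵐ s ∂(volume.restrict (Icc 0 L)), |deriv (fun s => f s y) s| ≤ M)
    (hI : Integrable (fun p : ℝ × Y => g p.1 p.2 * rieszCaputo α L lA lB (fun s => f s p.2) p.1)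
      ((volume.restrict (Icc 0 L)).prod ν))
    (hR : Integrable (fun p : ℝ × Y => f p.1 p.2 * rieszRL α L lA lB (fun s => g s p.2) p.1)
      ((volume.restrict (Icc 0 L)).prod ν))
    (hL' : Integrable (fun y => f L y * rieszInt α L lA lB (fun s => g s y) L) ν)
    (h0 : Integrable (fun y => f 0 y * rieszInt α L lA lB (fun s => g s y) 0) ν) :
    ∫ p, g p.1 p.2 * rieszCaputo α L lA lB (fun s => f s p.2) p.1
        ∂((volume.restrict (Icc 0 L)).prod ν)
      = ∫ y, f L y * rieszInt α L lA lB (fun s => g s y) L ∂ν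
        - ∫ y, f 0 y * rieszInt α L lA lB (fun s => g s y) 0 ∂ν
        - ∫ p, f p.1 p.2 * rieszRL α L lA lB (fun s => g s p.2) p.1
          ∂((volume.restrict (Icc 0 L)).prod ν) := by
  rw [integral_prod_symm _ hI, integral_prod_symm _ hR, ← integral_sub hL' h0, ← integral_sub]
  · refine integral_congr_ae ?_
    filter_upwards [hf, hg.prod_left_ae, h1, h2, hbd] with y f1 g1 a1 a2 b
    exact integral_mul_rieszCaputo hα hL hA hB f1 g1 a1 a2 b
  · exact hL'.sub h0
  · exact hR.integral_prod_right

/-- A Riesz integral which is absolutely continuous on almost all segments, with integrable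
derivative, has an integrable trace at either end of the segments. -/
theorem integrable_rieszInt_trace (hα : α < 1) (hL : 0 < L) (hA : 0 < lA) (hB : 0 < lB)
    {g : ℝ → Y → ℝ}
    (hg : Integrable (fun p : ℝ × Y => g p.1 p.2) ((volume.restrict (Icc 0 L)).prod ν))
    (h1 : ∀ᵐ y ∂ν, AbsolutelyContinuousOnInterval
      (fun s => leftFracInt (1 - α) (lowerEnd lB s) (fun s => g s y) s) 0 L)
    (h2 : ∀ᵐ y ∂ν, AbsolutelyContinuousOnInterval
      (fun s => rightFracInt (1 - α) (upperEnd L lA s) (fun s => g s y) s) 0 L)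
    (hR : Integrable (fun p : ℝ × Y => rieszRL α L lA lB (fun s => g s p.2) p.1)
      ((volume.restrict (Icc 0 L)).prod ν)) :
    Integrable (fun y => rieszInt α L lA lB (fun s => g s y) L) ν ∧
      Integrable (fun y => rieszInt α L lA lB (fun s => g s y) 0) ν := by
  -- Integration by parts against the affine function a·s + b writes this combination of end values
  -- as a sum of two integrals along the segment, each integrable in y. The Riesz–Caputo derivative
  -- `m` of the affine function is bounded, being the convolution of a constant with an integrable
  -- kernel.
  have key : ∀ a b : ℝ, Integrable (fun y => (a * L + b) * rieszInt α L lA lB (fun s => g s y) L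
      - b * rieszInt α L lA lB (fun s => g s y) 0) ν := by
    intro a b
    set m : ℝ → ℝ := fun x => ∫ s in Icc 0 L, rieszKer α lA lB (x - s) * a with hm
    have hd : deriv (fun s : ℝ => a * s + b) = fun _ => a := by
      funext s
      simp
    have hmc : ∀ x ∈ Icc 0 L, rieszCaputo α L lA lB (fun s => a * s + b) x = m x := by
      intro x hx
      rw [rieszCaputo_eq_integral hA hB hx, hd]
      rw [hd]
      exact (((integrable_rieszKer hα hA hB).comp_sub_left x).integrableOn).mul_const a
    have hmm : StronglyMeasurable m := by
      refine StronglyMeasurable.integral_prod_right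
        (f := fun x s => rieszKer α lA lB (x - s) * a) ?_
      exact (((measurable_rieszKer α lA lB).comp
        (measurable_fst.sub measurable_snd)).mul_const a).stronglyMeasurable
    have hmb : ∀ x, ‖m x‖ ≤ |a| * ∫ r, |rieszKer α lA lB r| := fun x =>
      abs_integral_rieszKer_mul_le hα hA hB (abs_nonneg a)
        (Filter.Eventually.of_forall fun _ => le_rfl) x
    have i1 : Integrable (fun p : ℝ × Y => g p.1 p.2 * m p.1)
        ((volume.restrict (Icc 0 L)).prod ν) :=
      hg.mul_bdd (c := |a| * ∫ r, |rieszKer α lA lB r|)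
        (hmm.comp_measurable measurable_fst).aestronglyMeasurable
        (Filter.Eventually.of_forall fun p => hmb p.1)
    have i2 : Integrable (fun p : ℝ × Y =>
        (a * p.1 + b) * rieszRL α L lA lB (fun s => g s p.2) p.1)
        ((volume.restrict (Icc 0 L)).prod ν) := by
      refine hR.bdd_mul (c := |a| * L + |b|)
        (by fun_prop) ?_
      refine (Measure.quasiMeasurePreserving_fst (μ := volume.restrict (Icc 0 L)) (ν := ν)).ae
        (p := fun x => ‖a * x + b‖ ≤ |a| * L + |b|) ?_
      filter_upwards [ae_restrict_mem measurableSet_Icc] with x hx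
      calc ‖a * x + b‖ ≤ |a * x| + |b| := abs_add_le _ _
        _ = |a| * x + |b| := by rw [abs_mul, abs_of_nonneg hx.1]
        _ ≤ |a| * L + |b| := by gcongr; exact hx.2
    refine (i1.integral_prod_right.add i2.integral_prod_right).congr ?_
    filter_upwards [hg.prod_left_ae, h1, h2] with y g1 a1 a2
    have hac : AbsolutelyContinuousOnInterval (fun s : ℝ => a * s + b) 0 L :=
      ContDiffOn.absolutelyContinuousOnInterval (by fun_prop)
    have := integral_mul_rieszCaputo hα hL hA hB hac g1 a1 a2
      (Or.inr ⟨|a|, Filter.Eventually.of_forall fun s => by rw [hd]⟩)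
    rw [setIntegral_congr_fun measurableSet_Icc
      (g := fun x => g x y * m x) (fun x hx => by simp only [hmc x hx])] at this
    simp only [Pi.add_apply]
    rw [this]
    ring
  -- With (a, b) = (1, 0) only L times the far end value remains, with (a, b) = (-1, L) only -L
  -- times the near one.
  constructor
  · refine ((key 1 0).const_mul (1 / L)).congr (Filter.Eventually.of_forall fun y => ?_)
    field_simp
    ring
  · refine ((key (-1) L).const_mul (-1 / L)).congr (Filter.Eventually.of_forall fun y => ?_)
    field_simp
    ring

end Product

/-! ### Coordinates along an axis -/

lemma measurableEmbedding_insertNth {n : ℕ} (m : Fin (n + 1)) :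
    MeasurableEmbedding
      (fun p : ℝ × (Fin n → ℝ) => (m.insertNth p.1 p.2 : Fin (n + 1) → ℝ)) :=
  (MeasurableEquiv.piFinSuccAbove (fun _ => ℝ) m).symm.measurableEmbedding

lemma insertNth_mem_Icc {n : ℕ} (m : Fin (n + 1)) (len : Fin (n + 1) → ℝ) (s : ℝ)
    (y : Fin n → ℝ) : (m.insertNth s y : Fin (n + 1) → ℝ) ∈ Icc 0 len ↔
      s ∈ Icc 0 (len m) ∧ y ∈ Icc 0 (fun i => len (m.succAbove i)) := by
  simp only [mem_Icc, Fin.insertNth_le_iff, Fin.le_insertNth_iff]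
  exact ⟨fun ⟨⟨a, b⟩, c, d⟩ => ⟨⟨a, c⟩, b, d⟩, fun ⟨⟨a, c⟩, b, d⟩ => ⟨⟨a, b⟩, c, d⟩⟩

lemma measurePreserving_insertNth {n : ℕ} (m : Fin (n + 1)) (len : Fin (n + 1) → ℝ) :
    MeasurePreserving
      (fun p : ℝ × (Fin n → ℝ) => (m.insertNth p.1 p.2 : Fin (n + 1) → ℝ))
      ((volume.restrict (Icc 0 (len m))).prod
        (volume.restrict (Icc 0 (fun i => len (m.succAbove i)))))
      (volume.restrict (Icc 0 len)) := by
  have h := ((volume_preserving_piFinSuccAbove (fun _ : Fin (n + 1) => ℝ) m).symm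
    _).restrict_preimage (s := Icc 0 len) measurableSet_Icc
  rw [Measure.prod_restrict]
  convert! h using 2
  ext ⟨s, y⟩
  exact (insertNth_mem_Icc m len s y).symm

/-- Almost every slice has the property, and some slice exists because the segment has positive
length. -/
lemma ae_of_ae_prod_const {Y : Type*} [MeasurableSpace Y] {ν : Measure Y} [SFinite ν] {L : ℝ}
    (hL : 0 < L) {P : Y → Prop} (h : ∀ᵐ p ∂((volume.restrict (Icc 0 L)).prod ν), P p.2) :
    ∀ᵐ y ∂ν, P y := by
  have h1 := Measure.ae_ae_of_ae_prod h
  have : (ae (volume.restrict (Icc (0:ℝ) L))).NeBot := by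
    rw [ae_neBot, Ne, Measure.restrict_eq_zero, Real.volume_Icc]
    simpa using hL
  exact h1.exists.choose_spec

/-- A property of points of a box which does not depend on one coordinate. -/
lemma ae_face_of_ae_box {n : ℕ} (m : Fin (n + 1)) (len : Fin (n + 1) → ℝ) (hlen : 0 < len m)
    {P : (Fin (n + 1) → ℝ) → Prop} {Q : (Fin n → ℝ) → Prop}
    (hPQ : ∀ s y, P (m.insertNth s y) → Q y)
    (h : ∀ᵐ x ∂(volume.restrict (Icc 0 len)), P x) :
    ∀ᵐ y ∂(volume.restrict (Icc 0 (fun i => len (m.succAbove i)))), Q y := by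
  refine ae_of_ae_prod_const hlen ?_
  filter_upwards [(measurePreserving_insertNth m len).quasiMeasurePreserving.ae h] with p hp
  exact hPQ _ _ hp

lemma line_insertNth (f : Vec → ℝ) (k : Fin 3) (s : ℝ) (y : Fin 2 → ℝ) :
    line f (k.insertNth (α := fun _ => ℝ) s y) k = fun s => f (k.insertNth s y) := by
  funext s'
  simp [line]

namespace Solid

variable (S : Solid)

lemma D_insertNth (α : ℝ) (k : Fin 3) (f : Vec → ℝ) (s : ℝ) (y : Fin 2 → ℝ) :
    S.D α k f (k.insertNth s y)
      = rieszCaputo α (S.len k) (S.lA k) (S.lB k) (fun s => f (k.insertNth s y)) s := by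
  rw [D, line_insertNth, Fin.insertNth_apply_same]

lemma I_insertNth (α : ℝ) (k : Fin 3) (f : Vec → ℝ) (s : ℝ) (y : Fin 2 → ℝ) :
    S.I α k f (k.insertNth s y)
      = rieszInt α (S.len k) (S.lA k) (S.lB k) (fun s => f (k.insertNth s y)) s := by
  rw [I, line_insertNth, Fin.insertNth_apply_same]

lemma 𝔇_insertNth (α : ℝ) (k : Fin 3) (f : Vec → ℝ) (s : ℝ) (y : Fin 2 → ℝ) :
    S.𝔇 α k f (k.insertNth s y)
      = rieszRL α (S.len k) (S.lA k) (S.lB k) (fun s => f (k.insertNth s y)) s := by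
  rw [𝔇, line_insertNth, Fin.insertNth_apply_same]

lemma facePoint_mem (f : Face) {y : Fin 2 → ℝ} (hy : y ∈ S.faceBox f) :
    S.facePoint f y ∈ S.Ω := by
  refine (insertNth_mem_Icc _ _ _ _).2 ⟨?_, hy⟩
  have := (S.len_pos f.1).le
  split_ifs <;> simp [this]

lemma continuous_facePoint (f : Face) : Continuous (S.facePoint f) := by
  unfold facePoint
  fun_prop

lemma update_mem {x : Vec} (hx : x ∈ S.Ω) {k : Fin 3} {s : ℝ} (hs : s ∈ Icc 0 (S.len k)) :
    Function.update x k s ∈ S.Ω := by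
  refine ⟨le_update_iff.2 ⟨hs.1, fun j _ => hx.1 j⟩, update_le_iff.2 ⟨hs.2, fun j _ => hx.2 j⟩⟩

/-! ### Bounded measurable fields on the solid and their traces. -/

/-- `f` agrees on the solid with a bounded measurable function. -/
def BddMeas (f : Vec → ℝ) : Prop :=
  ∃ h : Vec → ℝ, Measurable h ∧ (∃ M, ∀ x, |h x| ≤ M) ∧ EqOn f h S.Ω

variable {S}

/-- Faces are null sets of the solid. The trace is controlled because `BddMeas` demands agreement at
every point of the solid and not only almost everywhere. -/
lemma BddMeas.comp_facePoint {f : Vec → ℝ} (hf : S.BddMeas f) (F : Face) :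
    AEStronglyMeasurable (fun y => f (S.facePoint F y)) (volume.restrict (S.faceBox F)) ∧
      ∃ M, ∀ᵐ y ∂(volume.restrict (S.faceBox F)), ‖f (S.facePoint F y)‖ ≤ M := by
  obtain ⟨h, hm, ⟨M, hM⟩, he⟩ := hf
  have : ∀ᵐ y ∂(volume.restrict (S.faceBox F)), f (S.facePoint F y) = h (S.facePoint F y) := by
    filter_upwards [ae_restrict_mem (measurableSet_Icc)] with y hy
    exact he (S.facePoint_mem F hy)
  refine ⟨⟨_, (hm.comp (S.continuous_facePoint F).measurable).stronglyMeasurable, this⟩, M, ?_⟩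
  filter_upwards [this] with y hy
  rw [hy]
  exact hM _

lemma BddMeas.ae {f : Vec → ℝ} (hf : S.BddMeas f) :
    AEStronglyMeasurable f (volume.restrict S.Ω) ∧
      ∃ M, ∀ᵐ x ∂(volume.restrict S.Ω), ‖f x‖ ≤ M := by
  obtain ⟨h, hm, ⟨M, hM⟩, he⟩ := hf
  have : ∀ᵐ x ∂(volume.restrict S.Ω), f x = h x := by
    filter_upwards [ae_restrict_mem (measurableSet_Icc)] with y hy
    exact he hy
  refine ⟨⟨_, hm.stronglyMeasurable, this⟩, M, ?_⟩
  filter_upwards [this] with y hy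
  rw [hy]
  exact hM _

lemma BddMeas.mul_integrable {f g : Vec → ℝ} (hf : S.BddMeas f) (hg : IntegrableOn g S.Ω) :
    IntegrableOn (fun x => f x * g x) S.Ω := by
  obtain ⟨h1, M, hM⟩ := hf.ae
  exact Integrable.bdd_mul hg h1 hM

lemma BddMeas.mul_integrable_face {f : Vec → ℝ} (hf : S.BddMeas f) {F : Face}
    {g : (Fin 2 → ℝ) → ℝ} (hg : IntegrableOn g (S.faceBox F)) :
    IntegrableOn (fun y => f (S.facePoint F y) * g y) (S.faceBox F) := by
  obtain ⟨h1, M, hM⟩ := hf.comp_facePoint F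
  exact Integrable.bdd_mul hg h1 hM

lemma BddMeas.const_mul {f : Vec → ℝ} (hf : S.BddMeas f) (c : ℝ) :
    S.BddMeas (fun x => c * f x) := by
  obtain ⟨h, hm, ⟨M, hM⟩, he⟩ := hf
  refine ⟨fun x => c * h x, hm.const_mul c, ⟨|c| * M, fun x => ?_⟩, fun x hx => by simp only [he hx]⟩
  rw [abs_mul]
  exact mul_le_mul_of_nonneg_left (hM x) (abs_nonneg c)

lemma BddMeas.add {f g : Vec → ℝ} (hf : S.BddMeas f) (hg : S.BddMeas g) :
    S.BddMeas (fun x => f x + g x) := by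
  obtain ⟨h, hm, ⟨M, hM⟩, he⟩ := hf
  obtain ⟨h', hm', ⟨M', hM'⟩, he'⟩ := hg
  exact ⟨fun x => h x + h' x, hm.add hm', ⟨M + M', fun x =>
    (abs_add_le _ _).trans (add_le_add (hM x) (hM' x))⟩, fun x hx => by simp only [he hx, he' hx]⟩

lemma BddMeas.sum {ι : Type*} (s : Finset ι) {f : ι → Vec → ℝ} (hf : ∀ i, S.BddMeas (f i)) :
    S.BddMeas (fun x => ∑ i ∈ s, f i x) := by
  classical
  induction s using Finset.induction_on with
  | empty => exact ⟨fun _ => 0, measurable_const, ⟨0, by simp⟩, fun x _ => by simp⟩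
  | insert a s ha ih =>
    simp only [Finset.sum_insert ha]
    exact (hf a).add ih

lemma bddMeas_of_continuous {f : Vec → ℝ} (hf : Continuous f) : S.BddMeas f := by
  obtain ⟨M, hM⟩ := (isCompact_Icc (a := (0 : Vec)) (b := S.len)).exists_bound_of_continuousOn
    hf.continuousOn
  refine ⟨S.Ω.indicator f, hf.measurable.indicator measurableSet_Icc, ⟨|M|, fun x => ?_⟩,
    fun x hx => (indicator_of_mem hx f).symm⟩
  by_cases hx : x ∈ S.Ω
  · rw [indicator_of_mem hx]
    exact (hM x hx).trans (le_abs_self M)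
  · simp [indicator_of_notMem hx]

lemma BddMeas.integrableOn {f : Vec → ℝ} (hf : S.BddMeas f) : IntegrableOn f S.Ω := by
  have h1 : IntegrableOn (fun _ : Vec => (1 : ℝ)) S.Ω :=
    integrableOn_const (isCompact_Icc.measure_lt_top.ne)
  simpa using hf.mul_integrable h1

end Solid

/-! ### Riesz–Caputo derivatives of continuously differentiable fields. -/

/-- Partial derivatives of a continuously differentiable field that depends on time. -/
lemma exists_continuous_hasDerivAt_line {F : ℝ → Vec → ℝ}
    (hF : ContDiff ℝ 1 (fun z : ℝ × Vec => F z.1 z.2)) (j : Fin 3) :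
    ∃ G : ℝ × Vec → ℝ, Continuous G ∧
      ∀ t x s, HasDerivAt (line (F t) x j) (G (t, Function.update x j s)) s := by
  refine ⟨fun z => fderiv ℝ (fun z : ℝ × Vec => F z.1 z.2) z (0, Pi.single j 1), ?_, ?_⟩
  · exact (hF.continuous_fderiv one_ne_zero).clm_apply continuous_const
  · intro t x s
    have h1 := (hF.differentiable one_ne_zero (t, Function.update x j s)).hasFDerivAt
    have h2 : HasDerivAt (fun s => (t, Function.update x j s)) ((0 : ℝ), (Pi.single j 1 : Vec)) s :=
      (hasDerivAt_const s t).prodMk (hasDerivAt_update x j s)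
    exact h1.comp_hasDerivAt s h2

/-- The representative is the kernel integral of the continuous partial derivative, jointly
measurable as an integral with parameters and bounded by Young's inequality. Measurability jointly
in time and space is what pairing with space-time integrable double tractions requires. The
agreement is limited to the solid because the terminals are cut off there. -/
lemma Solid.exists_measurable_D (S : Solid) {α : ℝ} (hα : α < 1) {F : ℝ → Vec → ℝ}
    (hF : ContDiff ℝ 1 (fun z : ℝ × Vec => F z.1 z.2)) (j : Fin 3) :
    ∃ h : ℝ × Vec → ℝ, Measurable h ∧ (∀ t, ∀ x ∈ S.Ω, S.D α j (F t) x = h (t, x)) ∧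
      ∀ t₁ t₂, ∃ M, ∀ t ∈ Icc t₁ t₂, ∀ x ∈ S.Ω, |h (t, x)| ≤ M := by
  obtain ⟨G, hG, hd⟩ := exists_continuous_hasDerivAt_line hF j
  have hupd : Continuous (fun q : (ℝ × Vec) × ℝ => G (q.1.1, Function.update q.1.2 j q.2)) :=
    hG.comp (by fun_prop)
  refine ⟨fun z => ∫ s in Icc 0 (S.len j),
    rieszKer α (S.lA j) (S.lB j) (z.2 j - s) * G (z.1, Function.update z.2 j s), ?_, ?_, ?_⟩
  · refine (StronglyMeasurable.integral_prod_right (f := fun (z : ℝ × Vec) s =>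
      rieszKer α (S.lA j) (S.lB j) (z.2 j - s) * G (z.1, Function.update z.2 j s))
      (Measurable.stronglyMeasurable ?_)).measurable
    refine Measurable.mul ((measurable_rieszKer _ _ _).comp ?_) hupd.measurable
    fun_prop
  · intro t x hx
    have e : deriv (line (F t) x j) = fun s => G (t, Function.update x j s) :=
      funext fun s => (hd t x s).deriv
    have hc : Continuous (fun s => G (t, Function.update x j s)) :=
      hupd.comp (f := fun s => ((t, x), s)) (by fun_prop)
    obtain ⟨M, hM⟩ := (isCompact_Icc (a := 0) (b := S.len j)).exists_bound_of_continuousOn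
      hc.continuousOn
    rw [D, rieszCaputo_eq_integral (S.lA_pos j) (S.lB_pos j) ⟨hx.1 j, hx.2 j⟩, e]
    rw [e]
    refine integrableOn_rieszKer_mul (M := M) hα (S.lA_pos j) (S.lB_pos j)
      hc.aestronglyMeasurable ?_ _
    filter_upwards [ae_restrict_mem measurableSet_Icc] with s hs using hM s hs
  · intro t₁ t₂
    obtain ⟨M, hM⟩ := ((isCompact_Icc (a := t₁) (b := t₂)).prod
      (isCompact_Icc (a := (0 : Vec)) (b := S.len))).exists_bound_of_continuousOn hG.continuousOn
    refine ⟨|M| * ∫ r, |rieszKer α (S.lA j) (S.lB j) r|, fun t ht x hx => ?_⟩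
    refine abs_integral_rieszKer_mul_le hα (S.lA_pos j) (S.lB_pos j) (abs_nonneg M) ?_ _
    filter_upwards [ae_restrict_mem measurableSet_Icc] with s hs
    exact (hM (t, Function.update x j s) ⟨ht, S.update_mem hx hs⟩).trans (le_abs_self M)

namespace Solid

variable {S : Solid}

lemma bddMeas_D {α : ℝ} (hα : α < 1) {F : Vec → ℝ} (hF : ContDiff ℝ 1 F) (j : Fin 3) :
    S.BddMeas (S.D α j F) := by
  obtain ⟨h, hm, he, hb⟩ := S.exists_measurable_D hα (F := fun _ => F)
    (hF.comp contDiff_snd) j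
  obtain ⟨M, hM⟩ := hb 0 0
  refine ⟨S.Ω.indicator (fun x => h (0, x)),
    (hm.comp (measurable_const.prodMk measurable_id)).indicator measurableSet_Icc,
    ⟨|M|, fun x => ?_⟩, fun x hx => by rw [indicator_of_mem hx]; exact he 0 x hx⟩
  by_cases hx : x ∈ S.Ω
  · rw [indicator_of_mem hx]
    exact (hM 0 (by simp) x hx).trans (le_abs_self M)
  · simp [indicator_of_notMem hx]

lemma contDiff_line {f : Vec → ℝ} (hf : ContDiff ℝ 1 f) (x : Vec) (j : Fin 3) :
    ContDiff ℝ 1 (line f x j) :=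
  hf.comp (contDiff_update 1 x j)

lemma ac_line {f : Vec → ℝ} (hf : ContDiff ℝ 1 f) (x : Vec) (j : Fin 3) (a b : ℝ) :
    AbsolutelyContinuousOnInterval (line f x j) a b :=
  (contDiff_line hf x j).contDiffOn.absolutelyContinuousOnInterval

lemma continuous_pderiv {f : Vec → ℝ} (hf : ContDiff ℝ 1 f) (j : Fin 3) :
    Continuous (pderiv j f) := by
  obtain ⟨G, hG, hd⟩ := exists_continuous_hasDerivAt_line (F := fun _ => f)
    (hf.comp contDiff_snd) j
  have : pderiv j f = fun x => G (0, x) := by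
    funext x
    rw [pderiv, (hd 0 x (x j)).deriv, Function.update_eq_self]
  rw [this]
  fun_prop

/-- For continuously differentiable functions the kernel integrals converge at every point of the
solid, so linearity holds everywhere, in particular on the faces. -/
lemma D_linear {α : ℝ} (hα : α < 1) {f g : Vec → ℝ} (hf : ContDiff ℝ 1 f) (hg : ContDiff ℝ 1 g)
    (c : ℝ) (j : Fin 3) {x : Vec} (hx : x ∈ S.Ω) :
    S.D α j (fun y => f y + c * g y) x = S.D α j f x + c * S.D α j g x := by
  have key : ∀ {f : Vec → ℝ}, ContDiff ℝ 1 f → IntegrableOn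
      (fun s => rieszKer α (S.lA j) (S.lB j) (x j - s) * deriv (line f x j) s)
      (Icc 0 (S.len j)) := by
    intro f hf
    have hc := (contDiff_line hf x j).continuous_deriv le_rfl
    obtain ⟨M, hM⟩ := (isCompact_Icc (a := 0) (b := S.len j)).exists_bound_of_continuousOn
      hc.continuousOn
    refine integrableOn_rieszKer_mul (M := M) hα (S.lA_pos j) (S.lB_pos j)
      hc.aestronglyMeasurable ?_ _
    filter_upwards [ae_restrict_mem measurableSet_Icc] with s hs using hM s hs
  have hx' : x j ∈ Icc 0 (S.len j) := ⟨hx.1 j, hx.2 j⟩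
  rw [D, rieszCaputo_eq_integral (S.lA_pos j) (S.lB_pos j) hx'
      (key (f := fun y => f y + c * g y) (hf.add (contDiff_const.mul hg))),
    D, rieszCaputo_eq_integral (S.lA_pos j) (S.lB_pos j) hx' (key hf),
    D, rieszCaputo_eq_integral (S.lA_pos j) (S.lB_pos j) hx' (key hg),
    ← integral_const_mul, ← integral_add (key hf) ((key hg).const_mul c)]
  congr 1
  funext s
  have d1 := ((contDiff_line hf x j).differentiable one_ne_zero s).hasDerivAt
  have d2 := ((contDiff_line hg x j).differentiable one_ne_zero s).hasDerivAt
  have d3 : deriv (line (fun y => f y + c * g y) x j) s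
      = deriv (line f x j) s + c * deriv (line g x j) s := (d1.add (d2.const_mul c)).deriv
  rw [d3]
  ring

end Solid

/-! ### Integration by parts on the solid. -/

namespace Solid

variable {S : Solid}

lemma integrable_comp_insertNth {n : ℕ} (m : Fin (n + 1)) {len : Fin (n + 1) → ℝ}
    {f : (Fin (n + 1) → ℝ) → ℝ} (hf : IntegrableOn f (Icc 0 len)) :
    Integrable (fun p : ℝ × (Fin n → ℝ) => f (m.insertNth p.1 p.2))
      ((volume.restrict (Icc 0 (len m))).prod
        (volume.restrict (Icc 0 (fun i => len (m.succAbove i))))) :=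
  ((measurePreserving_insertNth m len).integrable_comp_emb
    (measurableEmbedding_insertNth m)).2 hf

lemma integral_comp_insertNth {n : ℕ} (m : Fin (n + 1)) (len : Fin (n + 1) → ℝ)
    (f : (Fin (n + 1) → ℝ) → ℝ) :
    ∫ p : ℝ × (Fin n → ℝ), f (m.insertNth p.1 p.2)
      ∂((volume.restrict (Icc 0 (len m))).prod
        (volume.restrict (Icc 0 (fun i => len (m.succAbove i))))) = ∫ x in Icc 0 len, f x :=
  (measurePreserving_insertNth m len).integral_comp (measurableEmbedding_insertNth m) f

lemma ae_face_line {k : Fin 3} {P : Vec → Prop} (hP : ∀ᵐ x ∂(volume.restrict S.Ω), P x) (b : Bool) :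
    ∀ᵐ y ∂(volume.restrict (S.faceBox (k, b))),
      ∀ᵐ s ∂(volume.restrict (Icc 0 (S.len k))), P (k.insertNth s y) := by
  have h := (measurePreserving_insertNth k S.len).quasiMeasurePreserving.ae hP
  have h' := (Measure.measurePreserving_swap (μ := volume.restrict (S.faceBox (k, b)))
    (ν := volume.restrict (Icc 0 (S.len k)))).quasiMeasurePreserving.ae h
  exact Measure.ae_ae_of_ae_prod h'

/-- Traces of Riesz integrals on the faces, and fractional integration by parts on the solid. -/
theorem integral_mul_D {α : ℝ} (hα : α < 1) {k : Fin 3} {f g : Vec → ℝ} (hf : S.ACLines k f)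
    (hfb : S.BddMeas f) (hg : IntegrableOn g S.Ω)
    (hAC : ∀ᵐ x ∂(volume.restrict S.Ω), S.FracIntAC α k g x)
    (hR : IntegrableOn (S.𝔇 α k g) S.Ω)
    (hI : IntegrableOn (fun x => g x * S.D α k f x) S.Ω)
    (hbd : (∃ M, ∀ᵐ x ∂(volume.restrict S.Ω), |g x| ≤ M) ∨
      ∃ M, ∀ᵐ x ∂(volume.restrict S.Ω), |pderiv k f x| ≤ M) :
    (∀ b, IntegrableOn (fun y => S.I α k g (S.facePoint (k, b) y)) (S.faceBox (k, b))) ∧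
    ∫ x in S.Ω, g x * S.D α k f x
      = (∫ y in S.faceBox (k, true),
          f (S.facePoint (k, true) y) * S.I α k g (S.facePoint (k, true) y))
        - (∫ y in S.faceBox (k, false),
          f (S.facePoint (k, false) y) * S.I α k g (S.facePoint (k, false) y))
        - ∫ x in S.Ω, f x * S.𝔇 α k g x := by
  -- The lines along the `k`-th axis are labelled by the parameter rectangle of the faces orthogonal
  -- to it, which is the same for both faces; the far one is used throughout.
  have hac : ∀ᵐ y ∂(volume.restrict (S.faceBox (k, true))),
      AbsolutelyContinuousOnInterval (fun s => f (k.insertNth s y)) 0 (S.len k) :=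
    ae_face_of_ae_box k S.len (S.len_pos k) (fun s y h => by rwa [line_insertNth] at h) hf
  have hfi : ∀ᵐ y ∂(volume.restrict (S.faceBox (k, true))),
      AbsolutelyContinuousOnInterval (fun s => leftFracInt (1 - α) (lowerEnd (S.lB k) s)
        (fun s => g (k.insertNth s y)) s) 0 (S.len k) ∧
      AbsolutelyContinuousOnInterval (fun s => rightFracInt (1 - α) (upperEnd (S.len k) (S.lA k) s)
        (fun s => g (k.insertNth s y)) s) 0 (S.len k) :=
    ae_face_of_ae_box k S.len (S.len_pos k)
      (fun s y h => by rwa [FracIntAC, line_insertNth] at h) hAC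
  have hg' := integrable_comp_insertNth k hg
  have hR' := integrable_comp_insertNth k hR
  have hI' := integrable_comp_insertNth k hI
  have hfR' := integrable_comp_insertNth k (hfb.mul_integrable hR)
  simp only [D_insertNth, 𝔇_insertNth] at hR' hI' hfR'
  have htr := integrable_rieszInt_trace hα (S.len_pos k) (S.lA_pos k) (S.lB_pos k)
    (g := fun s y => g (k.insertNth s y)) hg' (hfi.mono fun _ h => h.1)
    (hfi.mono fun _ h => h.2) hR'
  have htr' : ∀ b, IntegrableOn (fun y => S.I α k g (S.facePoint (k, b) y)) (S.faceBox (k, b)) := by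
    intro b
    simp only [facePoint, I_insertNth]
    cases b
    · exact htr.2
    · exact htr.1
  refine ⟨htr', ?_⟩
  have hbd' : ∀ᵐ y ∂(volume.restrict (S.faceBox (k, true))),
      (∃ M, ∀ᵐ s ∂(volume.restrict (Icc 0 (S.len k))), |g (k.insertNth s y)| ≤ M) ∨
      ∃ M, ∀ᵐ s ∂(volume.restrict (Icc 0 (S.len k))),
        |deriv (fun s => f (k.insertNth s y)) s| ≤ M := by
    rcases hbd with ⟨M, hM⟩ | ⟨M, hM⟩
    · filter_upwards [ae_face_line hM true] with y hy using Or.inl ⟨M, hy⟩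
    · filter_upwards [ae_face_line hM true] with y hy
      refine Or.inr ⟨M, ?_⟩
      filter_upwards [hy] with s hs
      rwa [pderiv, line_insertNth, Fin.insertNth_apply_same] at hs
  have e1 := hfb.mul_integrable_face (htr' true)
  have e0 := hfb.mul_integrable_face (htr' false)
  simp only [facePoint, I_insertNth] at e1 e0
  have := integral_prod_mul_rieszCaputo hα (S.len_pos k) (S.lA_pos k) (S.lB_pos k)
    (f := fun s y => f (k.insertNth s y)) (g := fun s y => g (k.insertNth s y)) hac hg'
    (hfi.mono fun _ h => h.1) (hfi.mono fun _ h => h.2) hbd' hI' hfR' e1 e0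
  rw [Ω, ← integral_comp_insertNth k, ← integral_comp_insertNth k]
  simp only [D_insertNth, 𝔇_insertNth, facePoint, I_insertNth, if_true, Bool.false_eq_true, if_false]
  exact this

/-! ### Integration by parts on the faces -/

/-- The parameter interval of the edges of the face `F` orthogonal to its `m`-th axis. -/
def edgeOfFaceBox (S : Solid) (F : Face) (m : Fin 2) : Set (Fin 1 → ℝ) :=
  Icc 0 (fun i => S.len (F.1.succAbove (m.succAbove i)))

lemma facePoint_insertNth_apply (F : Face) (m : Fin 2) (s : ℝ) (z : Fin 1 → ℝ) :
    S.facePoint F (m.insertNth s z) (F.1.succAbove m) = s := by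
  simp [facePoint]

lemma line_facePoint (f : Vec → ℝ) (F : Face) (m : Fin 2) (s : ℝ) (z : Fin 1 → ℝ) :
    line f (S.facePoint F (m.insertNth s z)) (F.1.succAbove m)
      = fun s => f (S.facePoint F (m.insertNth s z)) := by
  funext s'
  simp only [line, facePoint]
  rw [← Fin.insertNth_update, Fin.update_insertNth]

/-- In its own coordinates a face is again a box, so the product formula applies along its `m`-th
axis, the opposite edges being the ends. The trace `g` is merely integrable; the bounded factor in
Fubini is the derivative of the continuously differentiable `f`. -/
theorem integral_face_mul_D {α : ℝ} (hα : α < 1) {F : Face} {m : Fin 2} {f g : Vec → ℝ}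
    (hf : ContDiff ℝ 1 f)
    (hg : IntegrableOn (fun y => g (S.facePoint F y)) (S.faceBox F))
    (hAC : ∀ᵐ y ∂(volume.restrict (S.faceBox F)),
      S.FracIntAC α (F.1.succAbove m) g (S.facePoint F y))
    (hR : IntegrableOn (fun y => S.𝔇 α (F.1.succAbove m) g (S.facePoint F y)) (S.faceBox F)) :
    (∀ b : Bool, IntegrableOn (fun z => S.I α (F.1.succAbove m) g (S.facePoint F
        (m.insertNth (if b then S.len (F.1.succAbove m) else 0) z))) (S.edgeOfFaceBox F m)) ∧
    (∀ b : Bool, IntegrableOn (fun z => f (S.facePoint F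
        (m.insertNth (if b then S.len (F.1.succAbove m) else 0) z)) *
        S.I α (F.1.succAbove m) g (S.facePoint F
        (m.insertNth (if b then S.len (F.1.succAbove m) else 0) z))) (S.edgeOfFaceBox F m)) ∧
    ∫ y in S.faceBox F, g (S.facePoint F y) * S.D α (F.1.succAbove m) f (S.facePoint F y)
      = (∫ z in S.edgeOfFaceBox F m,
          f (S.facePoint F (m.insertNth (S.len (F.1.succAbove m)) z)) *
            S.I α (F.1.succAbove m) g (S.facePoint F (m.insertNth (S.len (F.1.succAbove m)) z)))
        - (∫ z in S.edgeOfFaceBox F m,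
          f (S.facePoint F (m.insertNth 0 z)) *
            S.I α (F.1.succAbove m) g (S.facePoint F (m.insertNth 0 z)))
        - ∫ y in S.faceBox F, f (S.facePoint F y) *
            S.𝔇 α (F.1.succAbove m) g (S.facePoint F y) := by
  set j := F.1.succAbove m with hj
  have eD : ∀ (h : Vec → ℝ) s z, S.D α j h (S.facePoint F (m.insertNth s z)) = rieszCaputo α
      (S.len j) (S.lA j) (S.lB j) (fun s => h (S.facePoint F (m.insertNth s z))) s := by
    intro h s z
    rw [D, line_facePoint, facePoint_insertNth_apply]
  have eI : ∀ (h : Vec → ℝ) s z, S.I α j h (S.facePoint F (m.insertNth s z)) = rieszInt α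
      (S.len j) (S.lA j) (S.lB j) (fun s => h (S.facePoint F (m.insertNth s z))) s := by
    intro h s z
    rw [I, line_facePoint, facePoint_insertNth_apply]
  have eR : ∀ (h : Vec → ℝ) s z, S.𝔇 α j h (S.facePoint F (m.insertNth s z)) = rieszRL α
      (S.len j) (S.lA j) (S.lB j) (fun s => h (S.facePoint F (m.insertNth s z))) s := by
    intro h s z
    rw [𝔇, line_facePoint, facePoint_insertNth_apply]
  have hfi : ∀ᵐ z ∂(volume.restrict (S.edgeOfFaceBox F m)),
      AbsolutelyContinuousOnInterval (fun s => leftFracInt (1 - α) (lowerEnd (S.lB j) s)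
        (fun s => g (S.facePoint F (m.insertNth s z))) s) 0 (S.len j) ∧
      AbsolutelyContinuousOnInterval (fun s => rightFracInt (1 - α) (upperEnd (S.len j) (S.lA j) s)
        (fun s => g (S.facePoint F (m.insertNth s z))) s) 0 (S.len j) :=
    ae_face_of_ae_box m (fun i => S.len (F.1.succAbove i)) (S.len_pos j)
      (fun s y h => by rwa [FracIntAC, line_facePoint] at h) hAC
  have hDf := bddMeas_D (S := S) hα hf j
  have hfb := bddMeas_of_continuous (S := S) hf.continuous
  have hI : IntegrableOn (fun y => g (S.facePoint F y) * S.D α j f (S.facePoint F y))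
      (S.faceBox F) := by
    simpa only [mul_comm] using hDf.mul_integrable_face hg
  have hg' := integrable_comp_insertNth m hg
  have hR' := integrable_comp_insertNth m hR
  have hI' := integrable_comp_insertNth m hI
  have hfR' := integrable_comp_insertNth m (hfb.mul_integrable_face hR)
  simp only [eD, eR] at hR' hI' hfR'
  have htr := integrable_rieszInt_trace hα (S.len_pos j) (S.lA_pos j) (S.lB_pos j)
    (g := fun s y => g (S.facePoint F (m.insertNth s y))) hg' (hfi.mono fun _ h => h.1)
    (hfi.mono fun _ h => h.2) hR'
  have htr' : ∀ b : Bool, IntegrableOn (fun z => S.I α j g (S.facePoint F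
        (m.insertNth (if b then S.len j else 0) z))) (S.edgeOfFaceBox F m) := by
    intro b
    simp only [eI]
    cases b
    · exact htr.2
    · exact htr.1
  have hmem : ∀ b : Bool, ∀ z ∈ S.edgeOfFaceBox F m,
      S.facePoint F (m.insertNth (if b then S.len j else 0) z) ∈ S.Ω := by
    intro b z hz
    refine S.facePoint_mem F ((insertNth_mem_Icc m (fun i => S.len (F.1.succAbove i)) _ _).2 ⟨?_, hz⟩)
    have := (S.len_pos j).le
    cases b
    · exact ⟨le_rfl, this⟩
    · exact ⟨this, le_rfl⟩
  have htr2 : ∀ b : Bool, IntegrableOn (fun z => f (S.facePoint F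
        (m.insertNth (if b then S.len j else 0) z)) * S.I α j g (S.facePoint F
        (m.insertNth (if b then S.len j else 0) z))) (S.edgeOfFaceBox F m) := by
    intro b
    obtain ⟨M, hM⟩ := (isCompact_Icc (a := (0 : Vec)) (b := S.len)).exists_bound_of_continuousOn
      hf.continuous.continuousOn
    refine Integrable.bdd_mul (c := M) (htr' b) ?_ ?_
    · refine (hf.continuous.comp ((S.continuous_facePoint F).comp ?_)).aestronglyMeasurable
      fun_prop
    · filter_upwards [ae_restrict_mem measurableSet_Icc] with z hz
      exact hM _ (hmem b z hz)
  refine ⟨htr', htr2, ?_⟩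
  have e1 := htr2 true
  have e0 := htr2 false
  simp only [if_true, Bool.false_eq_true, if_false, eI] at e1 e0
  have hder : ∀ z, deriv (fun s => f (S.facePoint F (m.insertNth s z)))
      = fun s => pderiv j f (S.facePoint F (m.insertNth s z)) := by
    intro z
    funext s
    rw [pderiv, facePoint_insertNth_apply, line_facePoint]
  obtain ⟨M, hM⟩ := (isCompact_Icc (a := (0 : Vec)) (b := S.len)).exists_bound_of_continuousOn
      (continuous_pderiv hf j).continuousOn
  have := integral_prod_mul_rieszCaputo hα (S.len_pos j) (S.lA_pos j) (S.lB_pos j)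
    (f := fun s y => f (S.facePoint F (m.insertNth s y)))
    (g := fun s y => g (S.facePoint F (m.insertNth s y)))
    (ν := volume.restrict (S.edgeOfFaceBox F m)) ?_ hg'
    (hfi.mono fun _ h => h.1) (hfi.mono fun _ h => h.2) ?_ hI' hfR' e1 e0
  · simp only [eI]
    rw [faceBox, ← integral_comp_insertNth m, ← integral_comp_insertNth m]
    simp only [eD, eR]
    exact this
  · refine Filter.Eventually.of_forall fun z => ?_
    rw [← line_facePoint f F m 0 z]
    exact ac_line hf _ _ _ _
  · filter_upwards [ae_restrict_mem measurableSet_Icc] with z hz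
    refine Or.inr ⟨M, ?_⟩
    filter_upwards [ae_restrict_mem measurableSet_Icc] with s hs
    rw [hder]
    exact hM _ (S.facePoint_mem F
      ((insertNth_mem_Icc m (fun i => S.len (F.1.succAbove i)) _ _).2 ⟨hs, hz⟩))

end Solid

/-! ### First variation of quadratic energies -/

section Quadratic

variable {X ι : Type*} [MeasurableSpace X] {μ : Measure X} [Fintype ι]

lemma integrable_bilinear {a b : ι → X → ℝ} (A : ι → ι → ℝ) (ha : ∀ p, MemLp (a p) 2 μ)
    (hb : ∀ p, MemLp (b p) 2 μ) : Integrable (fun x => ∑ p, ∑ q, a p x * A p q * b q x) μ := by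
  refine integrable_finsetSum _ fun p _ => integrable_finsetSum _ fun q _ => ?_
  refine (((ha p).integrable_mul (hb q)).const_mul (A p q)).congr ?_
  exact Filter.Eventually.of_forall fun x => by simp only [Pi.mul_apply]; ring

/-- Along a + s·b the form is q(a) + 2s·B(a, b) + s²·q(b), the two mixed terms agreeing by symmetry
of `A`. The path `e` is affine only almost everywhere because strain gradients depend linearly on
the displacement only almost everywhere. The integrability clause allows two such energies to be put
under one integral. -/
lemma hasDerivAt_quadratic {a b : ι → X → ℝ} {A : ι → ι → ℝ} (hA : ∀ p q, A p q = A q p)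
    (ha : ∀ p, MemLp (a p) 2 μ) (hb : ∀ p, MemLp (b p) 2 μ) {e : ℝ → ι → X → ℝ}
    (he : ∀ s p, ∀ᵐ x ∂μ, e s p x = a p x + s * b p x) :
    (∀ s, Integrable (fun x => ∑ p, ∑ q, e s p x * A p q * e s q x) μ) ∧
    HasDerivAt (fun s => 1 / 2 * ∫ x, ∑ p, ∑ q, e s p x * A p q * e s q x ∂μ)
      (∫ x, ∑ p, (∑ q, A p q * a q x) * b p x ∂μ) 0 := by
  have iaa := integrable_bilinear A ha ha
  have iba := integrable_bilinear A hb ha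
  have ibb := integrable_bilinear A hb hb
  have exp : ∀ s, ∀ᵐ x ∂μ, (∑ p, ∑ q, a p x * A p q * a q x)
      + 2 * s * (∑ p, ∑ q, b p x * A p q * a q x) + s ^ 2 * (∑ p, ∑ q, b p x * A p q * b q x)
      = ∑ p, ∑ q, e s p x * A p q * e s q x := by
    intro s
    have : ∀ᵐ x ∂μ, ∀ p, e s p x = a p x + s * b p x := ae_all_iff.2 (he s)
    filter_upwards [this] with x hx
    have hsym : ∑ p, ∑ q, a p x * A p q * b q x = ∑ p, ∑ q, b p x * A p q * a q x := by
      rw [Finset.sum_comm]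
      refine Finset.sum_congr rfl fun p _ => Finset.sum_congr rfl fun q _ => ?_
      rw [hA q p]
      ring
    have : ∑ p, ∑ q, e s p x * A p q * e s q x = (∑ p, ∑ q, a p x * A p q * a q x)
      + s * (∑ p, ∑ q, a p x * A p q * b q x) + s * (∑ p, ∑ q, b p x * A p q * a q x)
      + s ^ 2 * (∑ p, ∑ q, b p x * A p q * b q x) := by
      simp only [Finset.mul_sum, ← Finset.sum_add_distrib]
      refine Finset.sum_congr rfl fun p _ => Finset.sum_congr rfl fun q _ => ?_
      rw [hx p, hx q]
      ring
    rw [this, hsym]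
    ring
  refine ⟨fun s => ((iaa.add (iba.const_mul (2 * s))).add (ibb.const_mul (s ^ 2))).congr (exp s), ?_⟩
  have e1 : (fun s => 1 / 2 * ∫ x, ∑ p, ∑ q, e s p x * A p q * e s q x ∂μ)
      = fun s => 1 / 2 * ((∫ x, ∑ p, ∑ q, a p x * A p q * a q x ∂μ)
        + 2 * s * (∫ x, ∑ p, ∑ q, b p x * A p q * a q x ∂μ)
        + s ^ 2 * ∫ x, ∑ p, ∑ q, b p x * A p q * b q x ∂μ) := by
    funext s
    rw [← integral_congr_ae (exp s), integral_add (iaa.fun_add (iba.const_mul (2 * s)))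
      (ibb.const_mul (s ^ 2)), integral_add iaa (iba.const_mul (2 * s)), integral_const_mul,
      integral_const_mul]
  have e2 : ∫ x, ∑ p, (∑ q, A p q * a q x) * b p x ∂μ
      = ∫ x, ∑ p, ∑ q, b p x * A p q * a q x ∂μ := by
    refine integral_congr_ae (Filter.Eventually.of_forall fun x => ?_)
    simp only [Finset.sum_mul]
    refine Finset.sum_congr rfl fun p _ => Finset.sum_congr rfl fun q _ => by ring
  rw [e1, e2]
  set c1 := ∫ x, ∑ p, ∑ q, b p x * A p q * a q x ∂μ
  set c2 := ∫ x, ∑ p, ∑ q, b p x * A p q * b q x ∂μ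
  set c0 := ∫ x, ∑ p, ∑ q, a p x * A p q * a q x ∂μ
  have h := (((hasDerivAt_const (0:ℝ) c0).add
    (((hasDerivAt_id (0:ℝ)).const_mul 2).mul_const c1)).add
    (((hasDerivAt_id (0:ℝ)).pow 2).mul_const c2)).const_mul (1 / 2)
  convert! h using 1
  simp

end Quadratic

/-! ### Linearity of Riesz–Caputo derivatives on almost every line, and the derivative of the
energy. -/

section Kernel

variable {Y : Type*} [MeasurableSpace Y] {ν : Measure Y} [SFinite ν] {α L a b : ℝ}

/-- The kernel convolved along segments with an integrable function is finite almost everywhere. -/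
lemma ae_integrableOn_rieszKer_mul (hα : α < 1) (ha : 0 < a) (hb : 0 < b)
    {p : ℝ × Y → ℝ} (hp : Integrable p ((volume.restrict (Icc 0 L)).prod ν)) :
    ∀ᵐ q ∂((volume.restrict (Icc 0 L)).prod ν),
      IntegrableOn (fun s => rieszKer α a b (q.1 - s) * p (s, q.2)) (Icc 0 L) := by
  set μ := volume.restrict (Icc (0:ℝ) L)
  have hk := integrable_rieszKer hα ha hb
  have hm : AEStronglyMeasurable (fun q : ℝ × (ℝ × Y) => rieszKer α a b (q.1 - q.2.1) * p q.2)
      (μ.prod (μ.prod ν)) := by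
    refine AEStronglyMeasurable.mul ?_ hp.1.comp_snd
    exact ((measurable_rieszKer α a b).comp
      (measurable_fst.sub (measurable_fst.comp measurable_snd))).aestronglyMeasurable
  -- Tonelli with the evaluation point integrated first: what remains is at most the L¹ norm of the
  -- kernel times |p|.
  have hi : Integrable (fun q : ℝ × (ℝ × Y) => rieszKer α a b (q.1 - q.2.1) * p q.2)
      (μ.prod (μ.prod ν)) := by
    rw [integrable_prod_iff' hm]
    refine ⟨Filter.Eventually.of_forall fun q =>
      ((hk.comp_sub_right q.1).mono_measure Measure.restrict_le_self).mul_const (p q), ?_⟩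
    refine (hp.norm.const_mul (∫ r, ‖rieszKer α a b r‖)).mono'
      hm.prod_swap.norm.integral_prod_right' (Filter.Eventually.of_forall fun q => ?_)
    have h0 : 0 ≤ ∫ x, ‖rieszKer α a b (x - q.1) * p q‖ ∂μ :=
      integral_nonneg fun x => norm_nonneg _
    rw [Real.norm_of_nonneg h0]
    simp only [norm_mul]
    rw [integral_mul_const]
    refine mul_le_mul_of_nonneg_right ?_ (norm_nonneg _)
    refine (setIntegral_le_integral (hk.comp_sub_right q.1).norm
      (Filter.Eventually.of_forall fun x => norm_nonneg _)).trans (le_of_eq ?_)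
    exact integral_sub_right_eq_self (fun r => ‖rieszKer α a b r‖) q.1
  -- The regrouping ((x, y), s) ↦ (x, (s, y)), so that slices at fixed (x, y) become integrals over
  -- s.
  have hmp : MeasurePreserving (fun q : (ℝ × Y) × ℝ => (q.1.1, (q.2, q.1.2)))
      ((μ.prod ν).prod μ) (μ.prod (μ.prod ν)) := by
    have h1 := measurePreserving_prodAssoc μ ν μ
    have h2 := (MeasurePreserving.id μ).prod (Measure.measurePreserving_swap (μ := ν) (ν := μ))
    exact h2.comp h1
  exact (hmp.integrable_comp_of_integrable hi).prod_right_ae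

end Kernel

namespace Solid

variable {S : Solid}

/-- For a partial derivative that is only integrable, the kernel integral may diverge at some
points; it converges absolutely at almost all of them. -/
lemma ae_integrableOn_pderiv {α : ℝ} (hα : α < 1) {k : Fin 3} {f : Vec → ℝ}
    (hf : IntegrableOn (pderiv k f) S.Ω) :
    ∀ᵐ x ∂(volume.restrict S.Ω), IntegrableOn (fun s =>
      rieszKer α (S.lA k) (S.lB k) (x k - s) * deriv (line f x k) s) (Icc 0 (S.len k)) := by
  have h := ae_integrableOn_rieszKer_mul hα (S.lA_pos k) (S.lB_pos k)
    (integrable_comp_insertNth k hf)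
  have hmp := (measurePreserving_insertNth k S.len)
  have hmap : volume.restrict S.Ω = Measure.map
      (fun p : ℝ × (Fin 2 → ℝ) => (k.insertNth p.1 p.2 : Vec)) _ := hmp.map_eq.symm
  rw [hmap, (measurableEmbedding_insertNth k).ae_map_iff]
  filter_upwards [h] with p hp
  convert! hp using 2 with s
  · rw [line_insertNth, Fin.insertNth_apply_same, pderiv, line_insertNth, Fin.insertNth_apply_same]

/-- Linearity of Riesz--Caputo derivatives of functions that are absolutely continuous on almost
every segment. -/
lemma D_linear_ae {α : ℝ} (hα : α < 1) {k : Fin 3} {f g h : Vec → ℝ} (c : ℝ)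
    (hf : S.ACLines k f) (hg : S.ACLines k g) (hf' : IntegrableOn (pderiv k f) S.Ω)
    (hg' : IntegrableOn (pderiv k g) S.Ω) (hh : ∀ x ∈ S.Ω, h x = f x + c * g x) :
    ∀ᵐ x ∂(volume.restrict S.Ω), S.D α k h x = S.D α k f x + c * S.D α k g x := by
  filter_upwards [hf, hg, ae_integrableOn_pderiv hα hf', ae_integrableOn_pderiv hα hg',
    ae_restrict_mem measurableSet_Icc] with x f1 g1 f2 g2 hx
  have hx' : x k ∈ Icc 0 (S.len k) := ⟨hx.1 k, hx.2 k⟩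
  -- `h` is given by the linear combination only on the solid, so the derivatives are compared at
  -- interior points of the segment, where absolute continuity makes both functions differentiable
  -- almost everywhere.
  have hd : ∀ᵐ s ∂(volume.restrict (Icc 0 (S.len k))),
      rieszKer α (S.lA k) (S.lB k) (x k - s) * deriv (line f x k) s
        + c * (rieszKer α (S.lA k) (S.lB k) (x k - s) * deriv (line g x k) s)
      = rieszKer α (S.lA k) (S.lB k) (x k - s) * deriv (line h x k) s := by
    rw [← Measure.restrict_congr_set Ioo_ae_eq_Icc, ae_restrict_iff' measurableSet_Ioo]
    filter_upwards [f1.ae_differentiableAt, g1.ae_differentiableAt] with s ds1 ds2 hs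
    have hs' : s ∈ uIcc 0 (S.len k) := by
      rw [uIcc_of_le (S.len_pos k).le]; exact Ioo_subset_Icc_self hs
    have e : line h x k =ᶠ[nhds s] fun s => line f x k s + c * line g x k s := by
      filter_upwards [isOpen_Ioo.mem_nhds hs] with r hr
      exact hh _ (S.update_mem hx (Ioo_subset_Icc_self hr))
    rw [e.deriv_eq, ((ds1 hs').hasDerivAt.fun_add ((ds2 hs').hasDerivAt.const_mul c)).deriv]
    ring
  rw [D, rieszCaputo_eq_integral (S.lA_pos k) (S.lB_pos k) hx'
      ((f2.add (g2.const_mul c)).congr hd),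
    D, rieszCaputo_eq_integral (S.lA_pos k) (S.lB_pos k) hx' f2,
    D, rieszCaputo_eq_integral (S.lA_pos k) (S.lB_pos k) hx' g2,
    ← integral_const_mul, ← integral_add f2 (g2.const_mul c)]
  exact (integral_congr_ae hd).symm

lemma FiniteEnergy.contDiff_apply {v : Vec → Vec} (hv : S.FiniteEnergy v) (i : Fin 3) :
    ContDiff ℝ 1 (fun y => v y i) := contDiff_pi.1 hv.contDiff i

lemma bddMeas_strain {v : Vec → Vec} (hv : ∀ i, ContDiff ℝ 1 (fun y => v y i)) (i j : Fin 3) :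
    S.BddMeas (S.strain v i j) :=
  ((bddMeas_D S.α₁_mem.2 (hv i) j).add (bddMeas_D S.α₁_mem.2 (hv j) i)).const_mul (1 / 2)

lemma strain_add_smul {u v : Vec → Vec} (hu : S.FiniteEnergy u) (hv : S.FiniteEnergy v) (c : ℝ)
    (i j : Fin 3) {x : Vec} (hx : x ∈ S.Ω) :
    S.strain (u + c • v) i j x = S.strain u i j x + c * S.strain v i j x := by
  have h1 := D_linear S.α₁_mem.2 (hu.contDiff_apply i) (hv.contDiff_apply i) c j hx
  have h2 := D_linear S.α₁_mem.2 (hu.contDiff_apply j) (hv.contDiff_apply j) c i hx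
  unfold strain
  simp only [Pi.add_apply, Pi.smul_apply, smul_eq_mul]
  rw [h1, h2]
  ring

lemma strainGrad_add_smul {u v : Vec → Vec} (hu : S.FiniteEnergy u) (hv : S.FiniteEnergy v)
    (c : ℝ) (i j k : Fin 3) :
    ∀ᵐ x ∂(volume.restrict S.Ω),
      S.strainGrad (u + c • v) i j k x = S.strainGrad u i j k x + c * S.strainGrad v i j k x :=
  D_linear_ae S.α₂_mem.2 c (hu.strain_ac i j k) (hv.strain_ac i j k) (hu.strain_deriv i j k)
    (hv.strain_deriv i j k) fun _ hx => strain_add_smul hu hv c i j hx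

instance : IsFiniteMeasure (volume.restrict S.Ω) :=
  ⟨by rw [Measure.restrict_apply_univ]; exact isCompact_Icc.measure_lt_top⟩

lemma BddMeas.memLp {f : Vec → ℝ} (hf : S.BddMeas f) (p : ENNReal) :
    MemLp f p (volume.restrict S.Ω) := by
  obtain ⟨h, M, hM⟩ := hf.ae
  exact MemLp.of_bound h M hM

/-- The first variation of the energy, in terms of the stresses. -/
theorem hasDerivAt_energy {u v : Vec → Vec} (hu : S.FiniteEnergy u) (hv : S.FiniteEnergy v) :
    HasDerivAt (fun s : ℝ => S.energy (u + s • v))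
      ((∫ x in S.Ω, ∑ i, ∑ j, S.stress u i j x * S.strain v i j x)
        + ∫ x in S.Ω, ∑ i, ∑ j, ∑ k, S.hyperStress u i j k x * S.strainGrad v i j k x) 0 := by
  -- With index pairs, and below index triples, as single indices the elasticity tensors become
  -- matrices, symmetric by the major symmetry.
  have h1 := hasDerivAt_quadratic (μ := volume.restrict S.Ω) (ι := Fin 3 × Fin 3)
    (a := fun p => S.strain u p.1 p.2) (b := fun p => S.strain v p.1 p.2)
    (A := fun p q => S.C p.1 p.2 q.1 q.2) (fun p q => S.C_major _ _ _ _)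
    (fun p => (bddMeas_strain hu.contDiff_apply p.1 p.2).memLp 2)
    (fun p => (bddMeas_strain hv.contDiff_apply p.1 p.2).memLp 2)
    (e := fun s p => S.strain (u + s • v) p.1 p.2) (by
      intro s p
      filter_upwards [ae_restrict_mem measurableSet_Icc] with x hx
      exact strain_add_smul hu hv s p.1 p.2 hx)
  have h2 := hasDerivAt_quadratic (μ := volume.restrict S.Ω) (ι := Fin 3 × Fin 3 × Fin 3)
    (a := fun p => S.strainGrad u p.1 p.2.1 p.2.2) (b := fun p => S.strainGrad v p.1 p.2.1 p.2.2)
    (A := fun p q => S.G p.1 p.2.1 p.2.2 q.1 q.2.1 q.2.2) (fun p q => S.G_major _ _ _ _ _ _)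
    (fun p => hu.strainGrad_memLp _ _ _) (fun p => hv.strainGrad_memLp _ _ _)
    (e := fun s p => S.strainGrad (u + s • v) p.1 p.2.1 p.2.2)
    (fun s p => strainGrad_add_smul hu hv s _ _ _)
  simp only [Fintype.sum_prod_type] at h1 h2
  have h := h1.2.add h2.2
  convert! h using 1
  funext s
  simp only [energy, Pi.add_apply]
  rw [← mul_add, ← integral_add (h1.1 s) (h2.1 s)]

end Solid

/-! ### Tractions, double tractions and jumps in coordinates. -/

/-- Sign of the outward normal at either end of an axis. -/
def sgn (b : Bool) : ℝ := if b then 1 else -1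

lemma sgn_mul_self (b : Bool) : sgn b * sgn b = 1 := by cases b <;> simp [sgn]

lemma normal_eq (f : Face) : normal f = Pi.single f.1 (sgn f.2) := rfl

/-- The co-normal of either face at a right-angled edge is, up to sign, the normal of the other
face, since (n₁ × n₂) × n₁ = n₂ and (n₁ × n₂) × n₂ = -n₁ for orthonormal vectors. -/
lemma crossProduct_normals (e : Edge) :
    crossProduct (crossProduct (normal (e.face 0)) (normal (e.face 1))) (normal (e.face 0))
        = normal (e.face 1) ∧
      crossProduct (crossProduct (normal (e.face 0)) (normal (e.face 1))) (normal (e.face 1))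
        = -normal (e.face 0) := by
  obtain ⟨l, c⟩ := e
  have h0 := sgn_mul_self (c 0)
  have h1 := sgn_mul_self (c 1)
  simp only [normal_eq, Edge.face]
  generalize sgn (c 0) = s at *
  generalize sgn (c 1) = t at *
  -- What the evaluation of the cross products leaves open are identities in the two signs, closed
  -- by the fact that a sign squares to one.
  fin_cases l <;> constructor <;> ext i <;> fin_cases i <;>
    simp [cross_apply, Fin.succAbove] <;>
    first | linear_combination h0 * t | linear_combination h1 * s

namespace Solid

variable {S : Solid}

lemma leftFracInt_const_mul (β a c : ℝ) (g : ℝ → ℝ) (x : ℝ) :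
    leftFracInt β a (fun s => c * g s) x = c * leftFracInt β a g x := by
  unfold leftFracInt
  simp_rw [mul_left_comm _ c, intervalIntegral.integral_const_mul]
  ring

lemma rightFracInt_const_mul (β a c : ℝ) (g : ℝ → ℝ) (x : ℝ) :
    rightFracInt β a (fun s => c * g s) x = c * rightFracInt β a g x := by
  unfold rightFracInt
  simp_rw [mul_left_comm _ c, intervalIntegral.integral_const_mul]
  ring

lemma I_const_mul (α c : ℝ) (j : Fin 3) (g : Vec → ℝ) (x : Vec) :
    S.I α j (fun y => c * g y) x = c * S.I α j g x := by
  unfold I rieszInt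
  have : line (fun y => c * g y) x j = fun s => c * line g x j s := rfl
  rw [this, leftFracInt_const_mul, rightFracInt_const_mul]
  ring

lemma 𝔇_const_mul (α c : ℝ) (j : Fin 3) (g : Vec → ℝ) (x : Vec) :
    S.𝔇 α j (fun y => c * g y) x = c * S.𝔇 α j g x := by
  unfold 𝔇 rieszRL leftRL rightRL
  have : line (fun y => c * g y) x j = fun s => c * line g x j s := rfl
  simp only [this, leftFracInt_const_mul, rightFracInt_const_mul, deriv_const_mul_field]
  ring

lemma normalHyper_normal (f : Face) (u : Vec → Vec) (i j : Fin 3) :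
    S.normalHyper (normal f) u i j
      = fun x => sgn f.2 * S.I S.α₂ f.1 (S.hyperStress u i j f.1) x := by
  funext x
  simp [normalHyper, normal_eq, Pi.single_apply]

lemma normalGrad_normal (f : Face) (v : Vec → Vec) (i : Fin 3) (x : Vec) :
    S.normalGrad (normal f) v i x = sgn f.2 * S.D S.α₁ f.1 (fun y => v y i) x := by
  simp [normalGrad, normal_eq, Pi.single_apply]

/-- The normal enters twice, so the orientation of the face cancels; in the normal gradient it
enters once. -/
lemma doubleTraction_normal (f : Face) (u : Vec → Vec) (i : Fin 3) (x : Vec) :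
    S.doubleTraction (normal f) u i x = S.I S.α₂ f.1 (S.hyperStress u i f.1 f.1) x := by
  have := sgn_mul_self f.2
  simp [doubleTraction, normal_eq, Pi.single_apply, this]

/-- The projector is diagonal and removes the axis of the normal, so only the two tangential axes
contribute to the surface divergence. -/
lemma traction_normal (f : Face) (u : Vec → Vec) (i : Fin 3) (x : Vec) :
    S.traction (normal f) u i x = sgn f.2 * (S.I S.α₁ f.1 (S.effStress u i f.1) x
      - ∑ m : Fin 2, S.𝔇 S.α₁ (f.1.succAbove m)
          (S.I S.α₂ f.1 (S.hyperStress u i (f.1.succAbove m) f.1)) x) := by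
  have h := sgn_mul_self f.2
  have hp : ∀ j m, proj (normal f) j m = if j = m ∧ j ≠ f.1 then 1 else 0 := by
    intro j m
    simp only [proj, normal_eq, Matrix.sub_apply, Matrix.one_apply, vecMulVec_apply,
      Pi.single_apply]
    by_cases h1 : j = m
    · subst h1
      by_cases h2 : j = f.1
      · simp [h2, h]
      · simp [h2]
    · by_cases h2 : j = f.1
      · by_cases h3 : m = f.1
        · exact absurd (h2.trans h3.symm) h1
        · simp [h1, h3]
      · simp [h1, h2]
  have h2 : ∑ j, ∑ m, proj (normal f) j m * S.𝔇 S.α₁ m (S.normalHyper (normal f) u i j) x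
      = ∑ j, if j ≠ f.1 then
          sgn f.2 * S.𝔇 S.α₁ j (S.I S.α₂ f.1 (S.hyperStress u i j f.1)) x else 0 := by
    refine Finset.sum_congr rfl fun j _ => ?_
    simp only [hp, normalHyper_normal]
    rw [Finset.sum_eq_single j]
    · by_cases hj : j = f.1
      · simp [hj]
      · simp only [hj, ne_eq, not_false_eq_true, and_self, if_true, one_mul]
        exact 𝔇_const_mul _ _ _ _ _
    · intro m _ hm
      simp [Ne.symm hm]
    · simp
  have h1 : ∑ j, normal f j * S.I S.α₁ j (S.effStress u i j) x
      = sgn f.2 * S.I S.α₁ f.1 (S.effStress u i f.1) x := by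
    simp [normal_eq, Pi.single_apply]
  rw [traction, h1, h2, Fin.sum_univ_succAbove _ f.1]
  simp only [ne_eq, not_true_eq_false, if_false, zero_add, Fin.succAbove_ne, not_false_eq_true,
    if_true, ← Finset.mul_sum]
  ring

lemma edgeForce_single (k j : Fin 3) (b : Bool) (c : ℝ) (u : Vec → Vec) (i : Fin 3) (x : Vec) :
    S.edgeForce (normal (k, b)) (Pi.single j c) u i x
      = c * (sgn b * S.I S.α₁ j (S.I S.α₂ k (S.hyperStress u i j k)) x) := by
  simp only [edgeForce, normalHyper_normal]
  rw [Finset.sum_eq_single j]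
  · rw [Pi.single_eq_same]
    congr 1
    exact I_const_mul _ _ _ _ _
  · intro m _ hm
    rw [Pi.single_eq_of_ne hm, zero_mul]
  · simp

/-- The minus sign of the second co-normal cancels that of the jump. The contributions of the two
faces thus add, with the product of the two signs as common factor. -/
lemma jump_eq (e : Edge) (u : Vec → Vec) (i : Fin 3) (x : Vec) :
    S.jump e u i x = sgn (e.2 0) * sgn (e.2 1) *
      (S.I S.α₁ (e.1.succAbove 1) (S.I S.α₂ (e.1.succAbove 0)
          (S.hyperStress u i (e.1.succAbove 1) (e.1.succAbove 0))) x
        + S.I S.α₁ (e.1.succAbove 0) (S.I S.α₂ (e.1.succAbove 1)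
          (S.hyperStress u i (e.1.succAbove 0) (e.1.succAbove 1))) x) := by
  unfold jump
  simp only [(crossProduct_normals e).1, (crossProduct_normals e).2]
  change S.edgeForce (normal (e.1.succAbove 0, e.2 0))
      (Pi.single (e.1.succAbove 1) (sgn (e.2 1))) u i x
    - S.edgeForce (normal (e.1.succAbove 1, e.2 1))
      (-Pi.single (e.1.succAbove 0) (sgn (e.2 0))) u i x = _
  rw [← Pi.single_neg, edgeForce_single, edgeForce_single]
  ring

lemma hyperStress_symm (u : Vec → Vec) (i j k : Fin 3) :
    S.hyperStress u i j k = S.hyperStress u j i k := by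
  funext x
  simp only [hyperStress, S.G_minor i j k]

lemma effStress_symm (u : Vec → Vec) (i j : Fin 3) : S.effStress u i j = S.effStress u j i := by
  funext x
  simp only [effStress, stress, S.C_minor i j, hyperStress_symm u i j]

/-- Contraction of a symmetric tensor with the fractional strain. -/
lemma sum_mul_strain {p : Fin 3 → Fin 3 → ℝ} (hp : ∀ i j, p i j = p j i) (v : Vec → Vec) (x : Vec) :
    ∑ i, ∑ j, p i j * S.strain v i j x
      = ∑ i, ∑ j, p i j * S.D S.α₁ j (fun y => v y i) x := by
  have : ∑ i, ∑ j, p i j * S.D S.α₁ i (fun y => v y j) x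
      = ∑ i, ∑ j, p i j * S.D S.α₁ j (fun y => v y i) x := by
    rw [Finset.sum_comm]
    simp only [hp]
  calc ∑ i, ∑ j, p i j * S.strain v i j x
      = 1 / 2 * (∑ i, ∑ j, p i j * S.D S.α₁ j (fun y => v y i) x)
        + 1 / 2 * ∑ i, ∑ j, p i j * S.D S.α₁ i (fun y => v y j) x := by
        simp only [Finset.mul_sum, ← Finset.sum_add_distrib, strain]
        refine Finset.sum_congr rfl fun i _ => Finset.sum_congr rfl fun j _ => by ring
    _ = _ := by rw [this]; ring

end Solid

/-! ### Edges of faces -/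

/-- The edge of the face `(k, b)` at the end `b'` of its `m`-th axis. -/
def edgeOf (k : Fin 3) (b : Bool) (m : Fin 2) (b' : Bool) : Edge :=
  (k.succAbove (m.succAbove 0),
    fun n => if (k.succAbove (m.succAbove 0)).succAbove n = k then b else b')

/-- Every edge is reached from each of its two faces. This carries integrability, obtained face by
face, over to the edges. -/
lemma exists_edgeOf_eq (e : Edge) :
    (∃ m, (e.1.succAbove 0).succAbove m = e.1.succAbove 1 ∧
      edgeOf (e.1.succAbove 0) (e.2 0) m (e.2 1) = e) ∧
    ∃ m, (e.1.succAbove 1).succAbove m = e.1.succAbove 0 ∧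
      edgeOf (e.1.succAbove 1) (e.2 1) m (e.2 0) = e := by
  revert e
  decide

/-- Every edge lies on two faces. -/
lemma sum_edges (E : Fin 3 → Fin 3 → Edge → ℝ) :
    ∑ e : Edge, sgn (e.2 0) * sgn (e.2 1) *
        (E (e.1.succAbove 0) (e.1.succAbove 1) e + E (e.1.succAbove 1) (e.1.succAbove 0) e)
      = ∑ k, ∑ b, ∑ m, ∑ b', sgn b * sgn b' * E k (k.succAbove m) (edgeOf k b m b') := by
  -- The two ends stored in an edge follow the increasing order of the transverse axes, hence the
  -- transposition when the face axis is the larger one.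
  have h00 : ∀ b b', edgeOf 0 b 0 b' = (2, ![b, b']) := by decide
  have h01 : ∀ b b', edgeOf 0 b 1 b' = (1, ![b, b']) := by decide
  have h10 : ∀ b b', edgeOf 1 b 0 b' = (2, ![b', b]) := by decide
  have h11 : ∀ b b', edgeOf 1 b 1 b' = (0, ![b, b']) := by decide
  have h20 : ∀ b b', edgeOf 2 b 0 b' = (1, ![b', b]) := by decide
  have h21 : ∀ b b', edgeOf 2 b 1 b' = (0, ![b', b]) := by decide
  have hc : ∀ G : (Fin 2 → Bool) → ℝ, ∑ c, G c = ∑ b, ∑ b', G ![b, b'] := by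
    intro G
    rw [← (finTwoArrowEquiv Bool).symm.sum_comp, Fintype.sum_prod_type]
    rfl
  rw [Fintype.sum_prod_type]
  simp only [hc, Fin.sum_univ_three, Fin.sum_univ_two, Fintype.sum_bool, h00, h01, h10, h11, h20, h21]
  have s00 : (0 : Fin 3).succAbove 0 = 1 := rfl
  have s01 : (0 : Fin 3).succAbove 1 = 2 := rfl
  have s10 : (1 : Fin 3).succAbove 0 = 0 := rfl
  have s11 : (1 : Fin 3).succAbove 1 = 2 := rfl
  have s20 : (2 : Fin 3).succAbove 0 = 0 := rfl
  have s21 : (2 : Fin 3).succAbove 1 = 1 := rfl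
  simp only [s00, s01, s10, s11, s20, s21, Matrix.cons_val_zero, Matrix.cons_val_one, sgn, if_true,
    Bool.false_eq_true, if_false]
  ring

namespace Solid

variable {S : Solid}

lemma facePoint_edge (k : Fin 3) (b : Bool) (m : Fin 2) (b' : Bool) (z : Fin 1 → ℝ) :
    S.facePoint (k, b) (m.insertNth (if b' then S.len (k.succAbove m) else 0) z)
      = S.edgePoint (edgeOf k b m b') (z 0) := by
  ext i
  fin_cases k <;> fin_cases m <;> fin_cases i <;> rfl

lemma measurePreserving_edge (k : Fin 3) (b : Bool) (m : Fin 2) (b' : Bool) :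
    MeasurePreserving (fun z : Fin 1 → ℝ => z 0) (volume.restrict (S.edgeOfFaceBox (k, b) m))
      (volume.restrict (S.edgeBox (edgeOf k b m b'))) := by
  have h := (volume_preserving_funUnique (Fin 1) ℝ).restrict_preimage
    (s := S.edgeBox (edgeOf k b m b')) measurableSet_Icc
  convert! h using 2
  ext z
  simp only [edgeOfFaceBox, edgeBox, edgeOf, mem_Icc, Pi.le_def, mem_preimage, Fin.forall_fin_one]
  rfl

lemma integral_edge (k : Fin 3) (b : Bool) (m : Fin 2) (b' : Bool) (h : Vec → ℝ) :
    ∫ z in S.edgeOfFaceBox (k, b) m,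
        h (S.facePoint (k, b) (m.insertNth (if b' then S.len (k.succAbove m) else 0) z))
      = ∫ z in S.edgeBox (edgeOf k b m b'), h (S.edgePoint (edgeOf k b m b') z) := by
  simp only [facePoint_edge]
  exact (measurePreserving_edge k b m b').integral_comp
    (MeasurableEquiv.funUnique (Fin 1) ℝ).measurableEmbedding
    (fun z => h (S.edgePoint (edgeOf k b m b') z))

lemma integrable_edge (k : Fin 3) (b : Bool) (m : Fin 2) (b' : Bool) (h : Vec → ℝ)
    (hi : IntegrableOn (fun z =>
        h (S.facePoint (k, b) (m.insertNth (if b' then S.len (k.succAbove m) else 0) z)))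
        (S.edgeOfFaceBox (k, b) m)) :
    IntegrableOn (fun z => h (S.edgePoint (edgeOf k b m b') z)) (S.edgeBox (edgeOf k b m b')) := by
  simp only [facePoint_edge] at hi
  exact ((measurePreserving_edge k b m b').integrable_comp_emb
    (MeasurableEquiv.funUnique (Fin 1) ℝ).measurableEmbedding).1 hi

/-! ### Integration by parts in the first variation. -/

section FirstVariation

variable {u v : Vec → Vec}

lemma RegularStress.hyperStress_memLp (hu : S.RegularStress u) (i j k : Fin 3) :
    MemLp (S.hyperStress u i j k) ⊤ (volume.restrict S.Ω) := by
  unfold hyperStress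
  exact memLp_finsetSum _ fun l _ => memLp_finsetSum _ fun m _ => memLp_finsetSum _ fun n _ =>
    (hu.bounded l m n).const_mul _

lemma RegularStress.hyperStress_bdd (hu : S.RegularStress u) (i j k : Fin 3) :
    ∃ M, ∀ᵐ x ∂(volume.restrict S.Ω), |S.hyperStress u i j k x| ≤ M := by
  have h := (hu.hyperStress_memLp i j k).2
  rw [eLpNorm_exponent_top] at h
  refine ⟨(eLpNormEssSup (S.hyperStress u i j k) (volume.restrict S.Ω)).toReal, ?_⟩
  filter_upwards [ae_le_eLpNormEssSup (f := S.hyperStress u i j k)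
    (μ := volume.restrict S.Ω)] with x hx
  rw [← Real.norm_eq_abs, ← toReal_enorm]
  exact ENNReal.toReal_mono h.ne hx

end FirstVariation

end Solid

namespace Solid

variable {S : Solid} {u v : Vec → Vec}

lemma RegularStress.hyperStress_integrable (hu : S.RegularStress u) (i j k : Fin 3) :
    IntegrableOn (S.hyperStress u i j k) S.Ω :=
  (hu.hyperStress_memLp i j k).integrable le_top

lemma bddMeas_stress (hu : S.FiniteEnergy u) (i j : Fin 3) : S.BddMeas (S.stress u i j) :=
  BddMeas.sum _ fun k => BddMeas.sum _ fun l =>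
    (bddMeas_strain hu.contDiff_apply k l).const_mul _

lemma RegularStress.effStress_integrable (hr : S.RegularStress u) (hu : S.FiniteEnergy u)
    (i j : Fin 3) : IntegrableOn (S.effStress u i j) S.Ω :=
  (bddMeas_stress hu i j).integrableOn.sub
    (integrable_finsetSum _ fun k _ => hr.hyper_int i j k)

lemma integrable_hyperStress_mul_strainGrad (hr : S.RegularStress u) (hv : S.FiniteEnergy v)
    (i j k : Fin 3) :
    IntegrableOn (fun x => S.hyperStress u i j k x * S.strainGrad v i j k x) S.Ω := by
  obtain ⟨M, hM⟩ := hr.hyperStress_bdd i j k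
  exact ((hv.strainGrad_memLp i j k).integrable one_le_two).bdd_mul
    (hr.hyperStress_memLp i j k).1 hM

/-- Here the bounded factor in Fubini is τ: the partial derivatives of the strain are merely
integrable. -/
lemma hyperStress_by_parts (hr : S.RegularStress u) (hv : S.FiniteEnergy v) (i j k : Fin 3) :
    (∀ b, IntegrableOn (fun y => S.I S.α₂ k (S.hyperStress u i j k) (S.facePoint (k, b) y))
      (S.faceBox (k, b))) ∧
    ∫ x in S.Ω, S.hyperStress u i j k x * S.strainGrad v i j k x
      = (∑ b, sgn b * ∫ y in S.faceBox (k, b), S.I S.α₂ k (S.hyperStress u i j k)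
          (S.facePoint (k, b) y) * S.strain v i j (S.facePoint (k, b) y))
        - ∫ x in S.Ω, S.strain v i j x * S.𝔇 S.α₂ k (S.hyperStress u i j k) x := by
  have h := integral_mul_D S.α₂_mem.2 (hv.strain_ac i j k) (bddMeas_strain hv.contDiff_apply i j)
    (hr.hyperStress_integrable i j k) (hr.hyper_ac i j k) (hr.hyper_int i j k)
    (integrable_hyperStress_mul_strainGrad hr hv i j k) (Or.inl (hr.hyperStress_bdd i j k))
  refine ⟨h.1, h.2.trans ?_⟩
  simp only [Fintype.sum_bool, sgn, if_true, Bool.false_eq_true, if_false,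
    mul_comm (S.strain v i j _) (S.I _ _ _ _)]
  ring

lemma aclines_of_contDiff {f : Vec → ℝ} (hf : ContDiff ℝ 1 f) (j : Fin 3) : S.ACLines j f :=
  Filter.Eventually.of_forall fun x => ac_line hf x j _ _

/-- The roles are reversed: p = σ - 𝔇τ is merely integrable, and the bound comes from the derivative
of the continuously differentiable `f`. -/
lemma effStress_by_parts (hr : S.RegularStress u) (hu : S.FiniteEnergy u) (i j : Fin 3)
    {f : Vec → ℝ} (hf : ContDiff ℝ 1 f) :
    (∀ b, IntegrableOn (fun y => S.I S.α₁ j (S.effStress u i j) (S.facePoint (j, b) y))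
      (S.faceBox (j, b))) ∧
    ∫ x in S.Ω, S.effStress u i j x * S.D S.α₁ j f x
      = (∑ b, sgn b * ∫ y in S.faceBox (j, b), S.I S.α₁ j (S.effStress u i j)
          (S.facePoint (j, b) y) * f (S.facePoint (j, b) y))
        - ∫ x in S.Ω, f x * S.𝔇 S.α₁ j (S.effStress u i j) x := by
  have hb := bddMeas_of_continuous (S := S) hf.continuous
  have h := integral_mul_D S.α₁_mem.2 (aclines_of_contDiff hf j) hb
    (hr.effStress_integrable hu i j) (hr.eff_ac i j) (hr.eff_int i j) (by
      simpa only [mul_comm] using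
        (bddMeas_D S.α₁_mem.2 hf j).mul_integrable (hr.effStress_integrable hu i j))
    (Or.inr (bddMeas_of_continuous (S := S) (continuous_pderiv hf j)).ae.2)
  refine ⟨h.1, h.2.trans ?_⟩
  simp only [Fintype.sum_bool, sgn, if_true, Bool.false_eq_true, if_false,
    mul_comm (f _) (S.I _ _ _ _)]
  ring

/-- Integrability of the trace of the Riesz integral of τ, needed to integrate by parts
tangentially, is supplied by the preceding integration by parts in the volume. -/
lemma face_by_parts (hr : S.RegularStress u) (hv : S.FiniteEnergy v) (i : Fin 3) (k : Fin 3)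
    (b : Bool) (m : Fin 2) {f : Vec → ℝ} (hf : ContDiff ℝ 1 f) :
    (∀ b', IntegrableOn (fun z => S.I S.α₁ (k.succAbove m)
        (S.I S.α₂ k (S.hyperStress u i (k.succAbove m) k)) (S.edgePoint (edgeOf k b m b') z) *
          f (S.edgePoint (edgeOf k b m b') z)) (S.edgeBox (edgeOf k b m b'))) ∧
    ∫ y in S.faceBox (k, b), S.I S.α₂ k (S.hyperStress u i (k.succAbove m) k)
        (S.facePoint (k, b) y) * S.D S.α₁ (k.succAbove m) f (S.facePoint (k, b) y)
      = (∑ b', sgn b' * ∫ z in S.edgeBox (edgeOf k b m b'), S.I S.α₁ (k.succAbove m)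
        (S.I S.α₂ k (S.hyperStress u i (k.succAbove m) k)) (S.edgePoint (edgeOf k b m b') z) *
          f (S.edgePoint (edgeOf k b m b') z))
        - ∫ y in S.faceBox (k, b), S.𝔇 S.α₁ (k.succAbove m)
          (S.I S.α₂ k (S.hyperStress u i (k.succAbove m) k)) (S.facePoint (k, b) y) *
            f (S.facePoint (k, b) y) := by
  have h := integral_face_mul_D S.α₁_mem.2 (F := (k, b)) (m := m) hf
    ((hyperStress_by_parts hr hv i (k.succAbove m) k).1 b)
    (hr.face_ac (k, b) i _ (Fin.succAbove_ne k m)) (hr.face_int (k, b) i _ (Fin.succAbove_ne k m))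
  set H := S.I S.α₂ k (S.hyperStress u i (k.succAbove m) k)
  refine ⟨fun b' => integrable_edge k b m b' (fun x => S.I S.α₁ (k.succAbove m) H x * f x) ?_, ?_⟩
  · simpa only [mul_comm] using h.2.1 b'
  · refine h.2.2.trans ?_
    have e1 := integral_edge (S := S) k b m true (fun x => S.I S.α₁ (k.succAbove m) H x * f x)
    have e0 := integral_edge (S := S) k b m false (fun x => S.I S.α₁ (k.succAbove m) H x * f x)
    simp only [if_true, Bool.false_eq_true, if_false] at e1 e0
    simp only [Fintype.sum_bool, ← e1, ← e0, sgn, if_true, Bool.false_eq_true, if_false,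
      mul_comm (f _) _]
    ring

/-- The surface and edge terms of the first variation, and the volume term. -/
theorem first_variation_by_parts (hr : S.RegularStress u) (hu : S.FiniteEnergy u)
    (hv : S.FiniteEnergy v) :
    (∫ x in S.Ω, ∑ i, ∑ j, S.stress u i j x * S.strain v i j x)
        + ∫ x in S.Ω, ∑ i, ∑ j, ∑ k, S.hyperStress u i j k x * S.strainGrad v i j k x
      = -(∫ x in S.Ω, ∑ i, S.internalForce u i x * v x i)
          + S.surfaceIntegral (fun f x => ∑ i, S.traction (normal f) u i x * v x i)
          + S.surfaceIntegral (fun f x =>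
              ∑ i, S.doubleTraction (normal f) u i x * S.normalGrad (normal f) v i x)
          + S.edgeIntegral (fun e x => ∑ i, S.jump e u i x * v x i) := by
  have hvi := hv.contDiff_apply
  have hpi := fun i j => hr.effStress_integrable hu i j
  have hτ := fun i j k b => (hyperStress_by_parts hr hv i j k).1 b
  have hpt := fun i j b => (effStress_by_parts hr hu i j (hvi i)).1 b
  have hbv := fun i => bddMeas_of_continuous (S := S) (hvi i).continuous
  have hbD := fun i j => bddMeas_D (S := S) S.α₁_mem.2 (hvi i) j
  have hbs := fun i j => bddMeas_strain (S := S) hvi i j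
  -- The elementary integrals: `B` pairs the face traces of τ with gradients of v, `V` and `P` are
  -- the volume and face terms of p, `W` and `E` the face and edge terms of a tangential integration
  -- by parts.
  set B : Fin 3 → Fin 3 → Fin 3 → Bool → ℝ := fun i j k b => ∫ y in S.faceBox (k, b),
    S.I S.α₂ k (S.hyperStress u i j k) (S.facePoint (k, b) y)
      * S.D S.α₁ j (fun y => v y i) (S.facePoint (k, b) y) with hB
  set V : Fin 3 → Fin 3 → ℝ := fun i j =>
    ∫ x in S.Ω, v x i * S.𝔇 S.α₁ j (S.effStress u i j) x with hV
  set P : Fin 3 → Fin 3 → Bool → ℝ := fun i j b => ∫ y in S.faceBox (j, b),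
    S.I S.α₁ j (S.effStress u i j) (S.facePoint (j, b) y) * v (S.facePoint (j, b) y) i with hP
  set W : Fin 3 → Fin 3 → Bool → Fin 2 → ℝ := fun i k b m => ∫ y in S.faceBox (k, b),
    S.𝔇 S.α₁ (k.succAbove m) (S.I S.α₂ k (S.hyperStress u i (k.succAbove m) k))
      (S.facePoint (k, b) y) * v (S.facePoint (k, b) y) i with hW
  set E : Fin 3 → Fin 3 → Fin 3 → Edge → ℝ := fun i k j e => ∫ z in S.edgeBox e,
    S.I S.α₁ j (S.I S.α₂ k (S.hyperStress u i j k)) (S.edgePoint e z)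
      * v (S.edgePoint e z) i with hE
  have face : ∀ i k b m, B i (k.succAbove m) k b
      = (∑ b', sgn b' * E i k (k.succAbove m) (edgeOf k b m b')) - W i k b m := fun i k b m =>
    (face_by_parts hr hv i k b m (hvi i)).2
  -- The derivative of order α₂ has been moved off the strain, and in both remaining terms the
  -- strain is replaced by the plain gradient, because p and τ are symmetric in their first two
  -- indices.
  have vol : (∫ x in S.Ω, ∑ i, ∑ j, S.stress u i j x * S.strain v i j x)
        + ∫ x in S.Ω, ∑ i, ∑ j, ∑ k, S.hyperStress u i j k x * S.strainGrad v i j k x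
      = (∑ k, ∑ b, sgn b * ∑ i, ∑ j, B i j k b)
        + ∑ i, ∑ j, ∫ x in S.Ω, S.effStress u i j x * S.D S.α₁ j (fun y => v y i) x := by
    have i1 : ∀ i j, IntegrableOn (fun x => S.stress u i j x * S.strain v i j x) S.Ω :=
      fun i j => (bddMeas_stress hu i j).mul_integrable (hbs i j).integrableOn
    have i2 : ∀ i j k, IntegrableOn
        (fun x => S.strain v i j x * S.𝔇 S.α₂ k (S.hyperStress u i j k) x) S.Ω :=
      fun i j k => (hbs i j).mul_integrable (hr.hyper_int i j k)
    have i3 : ∀ i j, IntegrableOn (fun x => S.effStress u i j x * S.strain v i j x) S.Ω :=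
      fun i j => by simpa only [mul_comm] using (hbs i j).mul_integrable (hpi i j)
    have i4 : ∀ i j, IntegrableOn
        (fun x => S.effStress u i j x * S.D S.α₁ j (fun y => v y i) x) S.Ω :=
      fun i j => by simpa only [mul_comm] using (hbD i j).mul_integrable (hpi i j)
    have e1 : ∑ k, ∑ b, sgn b * ∑ i, ∑ j, B i j k b
        = ∑ k, ∑ b, sgn b * ∑ i, ∑ j, ∫ y in S.faceBox (k, b),
          S.I S.α₂ k (S.hyperStress u i j k) (S.facePoint (k, b) y)
            * S.strain v i j (S.facePoint (k, b) y) := by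
      refine Finset.sum_congr rfl fun k _ => Finset.sum_congr rfl fun b _ => ?_
      congr 1
      have j1 : ∀ i j, IntegrableOn (fun y => S.I S.α₂ k (S.hyperStress u i j k)
          (S.facePoint (k, b) y) * S.D S.α₁ j (fun y => v y i) (S.facePoint (k, b) y))
          (S.faceBox (k, b)) := fun i j => by
        simpa only [mul_comm] using (hbD i j).mul_integrable_face (hτ i j k b)
      have j2 : ∀ i j, IntegrableOn (fun y => S.I S.α₂ k (S.hyperStress u i j k)
          (S.facePoint (k, b) y) * S.strain v i j (S.facePoint (k, b) y))
          (S.faceBox (k, b)) := fun i j => by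
        simpa only [mul_comm] using (hbs i j).mul_integrable_face (hτ i j k b)
      simp only [hB]
      simp_rw [← integral_finsetSum _ fun j _ => j1 _ j, ← integral_finsetSum _ fun j _ => j2 _ j]
      rw [← integral_finsetSum _ fun i _ => integrable_finsetSum _ fun j _ => j1 i j,
        ← integral_finsetSum _ fun i _ => integrable_finsetSum _ fun j _ => j2 i j]
      congr 1
      funext y
      exact (sum_mul_strain (fun i j => by rw [hyperStress_symm u i j]) v _).symm
    have e2 : ∑ i, ∑ j, ∫ x in S.Ω, S.effStress u i j x * S.D S.α₁ j (fun y => v y i) x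
        = ∑ i, ∑ j, ∫ x in S.Ω, S.effStress u i j x * S.strain v i j x := by
      simp_rw [← integral_finsetSum _ fun j _ => i4 _ j, ← integral_finsetSum _ fun j _ => i3 _ j]
      rw [← integral_finsetSum _ fun i _ => integrable_finsetSum _ fun j _ => i4 i j,
        ← integral_finsetSum _ fun i _ => integrable_finsetSum _ fun j _ => i3 i j]
      congr 1
      funext y
      exact (sum_mul_strain (fun i j => by rw [effStress_symm u i j]) v _).symm
    have e3 : ∀ i j, ∫ x in S.Ω, S.effStress u i j x * S.strain v i j x
        = (∫ x in S.Ω, S.stress u i j x * S.strain v i j x)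
          - ∑ k, ∫ x in S.Ω, S.strain v i j x * S.𝔇 S.α₂ k (S.hyperStress u i j k) x := by
      intro i j
      rw [← integral_finsetSum _ fun k _ => i2 i j k,
        ← integral_sub (i1 i j) (integrable_finsetSum _ fun k _ => i2 i j k)]
      congr 1
      funext x
      rw [effStress, sub_mul, Finset.sum_mul]
      simp only [mul_comm]
    rw [e1, e2, integral_finsetSum _ fun i _ => integrable_finsetSum _ fun j _ => i1 i j,
      integral_finsetSum _ fun i _ => integrable_finsetSum _ fun j _ =>
        integrable_finsetSum _ fun k _ => integrable_hyperStress_mul_strainGrad hr hv i j k]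
    simp_rw [integral_finsetSum _ fun j _ => i1 _ j, integral_finsetSum _ fun j _ =>
        integrable_finsetSum _ fun k _ => integrable_hyperStress_mul_strainGrad hr hv _ j k,
      integral_finsetSum _ fun k _ => integrable_hyperStress_mul_strainGrad hr hv _ _ k,
      (hyperStress_by_parts hr hv _ _ _).2, e3]
    simp only [Finset.sum_sub_distrib, Finset.mul_sum]
    have sw : ∀ X : Fin 3 → Fin 3 → Fin 3 → Bool → ℝ, ∑ i, ∑ j, ∑ k, ∑ b, X i j k b
        = ∑ k, ∑ b, ∑ i, ∑ j, X i j k b := by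
      intro X
      simp only [Fin.sum_univ_three, Fintype.sum_bool]
      ring
    rw [sw]
    ring
  have surfT : S.surfaceIntegral (fun f x => ∑ i, S.traction (normal f) u i x * v x i)
      = ∑ k, ∑ b, sgn b * ∑ i, (P i k b - ∑ m, W i k b m) := by
    have j1 : ∀ i k b, IntegrableOn (fun y => S.I S.α₁ k (S.effStress u i k)
        (S.facePoint (k, b) y) * v (S.facePoint (k, b) y) i) (S.faceBox (k, b)) := fun i k b => by
      simpa only [mul_comm] using (hbv i).mul_integrable_face (hpt i k b)
    have j2 : ∀ i k b m, IntegrableOn (fun y => S.𝔇 S.α₁ (k.succAbove m)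
        (S.I S.α₂ k (S.hyperStress u i (k.succAbove m) k)) (S.facePoint (k, b) y)
          * v (S.facePoint (k, b) y) i) (S.faceBox (k, b)) := fun i k b m => by
      simpa only [mul_comm] using (hbv i).mul_integrable_face
        (hr.face_int (k, b) i _ (Fin.succAbove_ne k m))
    rw [surfaceIntegral, Fintype.sum_prod_type]
    refine Finset.sum_congr rfl fun k _ => Finset.sum_congr rfl fun b _ => ?_
    simp only [hP, hW]
    simp_rw [← integral_finsetSum _ fun m _ => j2 _ k b m]
    simp_rw [← integral_sub (j1 _ k b) (integrable_finsetSum _ fun m _ => j2 _ k b m)]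
    rw [← integral_finsetSum _ fun i _ => (j1 i k b).fun_sub
      (integrable_finsetSum _ fun m _ => j2 i k b m), ← integral_const_mul]
    congr 1
    funext y
    rw [Finset.mul_sum]
    refine Finset.sum_congr rfl fun i _ => ?_
    rw [traction_normal, mul_assoc, sub_mul, Finset.sum_mul]
  have surfQ : S.surfaceIntegral (fun f x =>
        ∑ i, S.doubleTraction (normal f) u i x * S.normalGrad (normal f) v i x)
      = ∑ k, ∑ b, sgn b * ∑ i, B i k k b := by
    have j1 : ∀ i k b, IntegrableOn (fun y => S.I S.α₂ k (S.hyperStress u i k k)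
          (S.facePoint (k, b) y) * S.D S.α₁ k (fun y => v y i) (S.facePoint (k, b) y))
          (S.faceBox (k, b)) := fun i k b => by
        simpa only [mul_comm] using (hbD i k).mul_integrable_face (hτ i k k b)
    rw [surfaceIntegral, Fintype.sum_prod_type]
    refine Finset.sum_congr rfl fun k _ => Finset.sum_congr rfl fun b _ => ?_
    simp only [hB]
    rw [← integral_finsetSum _ fun i _ => j1 i k b, ← integral_const_mul]
    congr 1
    funext y
    rw [Finset.mul_sum]
    refine Finset.sum_congr rfl fun i _ => ?_
    rw [doubleTraction_normal, normalGrad_normal]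
    ring
  have edg : S.edgeIntegral (fun e x => ∑ i, S.jump e u i x * v x i)
      = ∑ k, ∑ b, ∑ m, ∑ b', sgn b * sgn b' * ∑ i, E i k (k.succAbove m) (edgeOf k b m b') := by
    have j0 : ∀ i k b m b', IntegrableOn (fun z => S.I S.α₁ (k.succAbove m)
        (S.I S.α₂ k (S.hyperStress u i (k.succAbove m) k)) (S.edgePoint (edgeOf k b m b') z) *
          v (S.edgePoint (edgeOf k b m b') z) i) (S.edgeBox (edgeOf k b m b')) :=
      fun i k b m b' => (face_by_parts hr hv i k b m (hvi i)).1 b'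
    -- Integrability on an edge is read off from the first of its faces, in `j2` from the second.
    have j1 : ∀ i (e : Edge), IntegrableOn (fun z => S.I S.α₁ (e.1.succAbove 1)
        (S.I S.α₂ (e.1.succAbove 0) (S.hyperStress u i (e.1.succAbove 1) (e.1.succAbove 0)))
          (S.edgePoint e z) * v (S.edgePoint e z) i) (S.edgeBox e) := by
      intro i e
      obtain ⟨⟨m, hm, he⟩, -⟩ := exists_edgeOf_eq e
      have := j0 i (e.1.succAbove 0) (e.2 0) m (e.2 1)
      rwa [hm, he] at this
    have j2 : ∀ i (e : Edge), IntegrableOn (fun z => S.I S.α₁ (e.1.succAbove 0)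
        (S.I S.α₂ (e.1.succAbove 1) (S.hyperStress u i (e.1.succAbove 0) (e.1.succAbove 1)))
          (S.edgePoint e z) * v (S.edgePoint e z) i) (S.edgeBox e) := by
      intro i e
      obtain ⟨-, m, hm, he⟩ := exists_edgeOf_eq e
      have := j0 i (e.1.succAbove 1) (e.2 1) m (e.2 0)
      rwa [hm, he] at this
    rw [← sum_edges (fun k j e => ∑ i, E i k j e), edgeIntegral]
    refine Finset.sum_congr rfl fun e _ => ?_
    simp only [hE]
    rw [← Finset.sum_add_distrib]
    simp_rw [← integral_add (j1 _ e) (j2 _ e)]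
    rw [← integral_finsetSum _ fun i _ => (j1 i e).fun_add (j2 i e), ← integral_const_mul]
    congr 1
    funext z
    rw [Finset.mul_sum]
    refine Finset.sum_congr rfl fun i _ => ?_
    rw [jump_eq]
    ring
  have volV : ∫ x in S.Ω, ∑ i, S.internalForce u i x * v x i = ∑ i, ∑ j, V i j := by
    have j1 : ∀ i j, IntegrableOn (fun x => v x i * S.𝔇 S.α₁ j (S.effStress u i j) x) S.Ω :=
      fun i j => (hbv i).mul_integrable (hr.eff_int i j)
    simp only [hV]
    simp_rw [← integral_finsetSum _ fun j _ => j1 _ j]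
    rw [← integral_finsetSum _ fun i _ => integrable_finsetSum _ fun j _ => j1 i j]
    congr 1
    funext x
    refine Finset.sum_congr rfl fun i _ => ?_
    rw [internalForce, Finset.sum_mul]
    simp only [mul_comm]
  have hpart : ∀ i j, ∫ x in S.Ω, S.effStress u i j x * S.D S.α₁ j (fun y => v y i) x
      = (∑ b, sgn b * P i j b) - V i j := fun i j => (effStress_by_parts hr hu i j (hvi i)).2
  rw [vol, surfT, surfQ, edg, volV]
  simp_rw [hpart]
  -- The index j = k is the normal derivative and is kept as work of the double traction; the two
  -- tangential indices are integrated by parts on the face.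
  have hsplit : ∀ k b, ∑ i, ∑ j, B i j k b = (∑ i, B i k k b)
      + ∑ i, ∑ m, ((∑ b', sgn b' * E i k (k.succAbove m) (edgeOf k b m b')) - W i k b m) := by
    intro k b
    rw [← Finset.sum_add_distrib]
    refine Finset.sum_congr rfl fun i _ => ?_
    rw [Fin.sum_univ_succAbove _ k]
    simp only [face]
  simp only [hsplit]
  -- From here on only finite sums are rearranged, so the integrals are made opaque.
  clear_value B V P W E
  simp only [Finset.sum_sub_distrib, Finset.mul_sum, mul_add, mul_sub, Finset.sum_add_distrib]
  have c1 : ∑ i, ∑ j, ∑ b, sgn b * P i j b = ∑ k, ∑ b, ∑ i, sgn b * P i k b := by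
    rw [Finset.sum_comm]
    refine Finset.sum_congr rfl fun k _ => Finset.sum_comm
  have c2 : ∑ k, ∑ b, ∑ i, ∑ m, ∑ b', sgn b * (sgn b' * E i k (k.succAbove m) (edgeOf k b m b'))
      = ∑ k, ∑ b, ∑ m, ∑ b', ∑ i, sgn b * sgn b' * E i k (k.succAbove m) (edgeOf k b m b') := by
    refine Finset.sum_congr rfl fun k _ => Finset.sum_congr rfl fun b _ => ?_
    rw [Finset.sum_comm]
    refine Finset.sum_congr rfl fun m _ => ?_
    rw [Finset.sum_comm]
    simp only [mul_assoc]
  rw [c1, c2]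
  ring

end Solid

/-! ### Velocities -/

lemma hasDerivAt_velocity {w : ℝ → Vec → Vec} (hw : ContDiff ℝ 1 (fun z : ℝ × Vec => w z.1 z.2))
    (t : ℝ) (x : Vec) : HasDerivAt (fun s => w s x) (velocity w t x) t := by
  have h : Differentiable ℝ (fun s => w s x) :=
    (hw.differentiable one_ne_zero).comp (f := fun s => (s, x)) (by fun_prop)
  exact (h t).hasDerivAt

lemma continuous_velocity {w : ℝ → Vec → Vec} (hw : ContDiff ℝ 1 (fun z : ℝ × Vec => w z.1 z.2)) :
    Continuous (fun z : ℝ × Vec => velocity w z.1 z.2) := by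
  have h : (fun z : ℝ × Vec => velocity w z.1 z.2)
      = fun z => fderiv ℝ (fun z : ℝ × Vec => w z.1 z.2) z (1, 0) := by
    funext z
    have h1 := (hw.differentiable one_ne_zero (z.1, z.2)).hasFDerivAt
    have h2 : HasDerivAt (fun s : ℝ => (s, z.2)) ((1 : ℝ), (0 : Vec)) z.1 :=
      (hasDerivAt_id z.1).prodMk (hasDerivAt_const z.1 z.2)
    exact (h1.comp_hasDerivAt z.1 h2).deriv
  rw [h]
  exact (hw.continuous_fderiv one_ne_zero).clm_apply continuous_const

namespace Solid

variable {S : Solid}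

/-- The kinetic energy is the quadratic energy of the diagonal matrix with entries ρ. -/
lemma kinetic_variation {w w' : Vec → Vec} (hw : Continuous w) (hw' : Continuous w') :
    firstVariation S.kinetic w w' = ∫ x in S.Ω, ∑ i, S.ρ * w x i * w' x i := by
  have hc : ∀ {w : Vec → Vec}, Continuous w → ∀ i, MemLp (fun x => w x i) 2 (volume.restrict S.Ω) :=
    fun hw i => (bddMeas_of_continuous (continuous_pi_iff.1 hw i)).memLp 2
  have h := (hasDerivAt_quadratic (A := fun p q : Fin 3 => if p = q then S.ρ else 0)
    (fun p q => by simp only [eq_comm]) (hc hw) (hc hw')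
    (e := fun s p x => (w + s • w') x p) (fun s p => Filter.Eventually.of_forall fun x => rfl)).2
  simp only [ite_mul, zero_mul, mul_ite, mul_zero, Finset.sum_ite_eq, Finset.mem_univ, if_true] at h
  unfold firstVariation kinetic
  rw [← h.deriv]
  congr 1
  funext s
  congr 2
  funext x
  rw [Finset.mul_sum]
  exact Finset.sum_congr rfl fun i _ => by ring

/-! ### Work of the loads at a fixed time -/

lemma BddMeas.integrable_mul {f g : Vec → ℝ} (hf : S.BddMeas f) (hg : IntegrableOn g S.Ω) :
    IntegrableOn (fun x => g x * f x) S.Ω := by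
  simpa only [mul_comm] using hf.mul_integrable hg

lemma BddMeas.integrable_mul_face {f : Vec → ℝ} (hf : S.BddMeas f) {F : Face}
    {g : (Fin 2 → ℝ) → ℝ} (hg : IntegrableOn g (S.faceBox F)) :
    IntegrableOn (fun y => g y * f (S.facePoint F y)) (S.faceBox F) := by
  simpa only [mul_comm] using hf.mul_integrable_face hg

/-- The loads are integrable at time `s`. -/
structure LoadsAt (S : Solid) (P : Loads) (s : ℝ) : Prop where
  b : ∀ i, IntegrableOn (fun x => P.b s x i) S.Ω
  t : ∀ f i, IntegrableOn (fun y => P.t s f (S.facePoint f y) i) (S.faceBox f)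
  q : ∀ f i, IntegrableOn (fun y => P.q s f (S.facePoint f y) i) (S.faceBox f)
  r : ∀ e i, IntegrableOn (fun z => P.r s e (S.edgePoint e z) i) (S.edgeBox e)

lemma edgePoint_mem (e : Edge) {z : ℝ} (hz : z ∈ S.edgeBox e) : S.edgePoint e z ∈ S.Ω := by
  refine (insertNth_mem_Icc _ _ _ _).2 ⟨hz, fun m => ?_, fun m => ?_⟩ <;>
  · have := (S.len_pos (e.1.succAbove m)).le
    by_cases h : e.2 m = true <;> simp [h, this]

lemma continuous_edgePoint (e : Edge) : Continuous (S.edgePoint e) := by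
  unfold edgePoint
  fun_prop

lemma mul_integrable_edge {f : Vec → ℝ} (hf : Continuous f) {e : Edge} {g : ℝ → ℝ}
    (hg : IntegrableOn g (S.edgeBox e)) :
    IntegrableOn (fun z => g z * f (S.edgePoint e z)) (S.edgeBox e) := by
  obtain ⟨M, hM⟩ := (isCompact_Icc (a := (0 : Vec)) (b := S.len)).exists_bound_of_continuousOn
      hf.continuousOn
  refine Integrable.mul_bdd (c := M) hg
    (hf.comp (S.continuous_edgePoint e)).aestronglyMeasurable ?_
  filter_upwards [ae_restrict_mem measurableSet_Icc] with z hz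
  exact hM _ (edgePoint_mem e hz)

lemma bddMeas_normalGrad {v : Vec → Vec} (hv : ∀ i, ContDiff ℝ 1 (fun y => v y i)) (n : Vec)
    (i : Fin 3) : S.BddMeas (S.normalGrad n v i) :=
  BddMeas.sum _ fun j => (bddMeas_D S.α₁_mem.2 (hv i) j).const_mul _

lemma work_eq {P : Loads} {t : ℝ} (hP : S.LoadsAt P t) {v : Vec → Vec}
    (hv : ∀ i, ContDiff ℝ 1 (fun y => v y i)) :
    S.work P t v = (∑ i, ∫ x in S.Ω, P.b t x i * v x i)
      + (∑ f : Face, ∑ i, ∫ y in S.faceBox f, P.t t f (S.facePoint f y) i * v (S.facePoint f y) i)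
      + (∑ f : Face, ∑ i, ∫ y in S.faceBox f, P.q t f (S.facePoint f y) i
          * S.normalGrad (normal f) v i (S.facePoint f y))
      + ∑ e : Edge, ∑ i, ∫ z in S.edgeBox e,
          P.r t e (S.edgePoint e z) i * v (S.edgePoint e z) i := by
  have hbv := fun i => bddMeas_of_continuous (S := S) (hv i).continuous
  have i1 : ∀ i, IntegrableOn (fun x => P.b t x i * v x i) S.Ω := fun i => 
    (hbv i).integrable_mul (hP.b i)
  have i2 : ∀ f i, IntegrableOn (fun y => P.t t f (S.facePoint f y) i * v (S.facePoint f y) i)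
      (S.faceBox f) := fun f i => 
    (hbv i).integrable_mul_face (hP.t f i)
  have i3 : ∀ f i, IntegrableOn (fun y => P.q t f (S.facePoint f y) i
      * S.normalGrad (normal f) v i (S.facePoint f y)) (S.faceBox f) := fun f i => 
    (bddMeas_normalGrad hv (normal f) i).integrable_mul_face (hP.q f i)
  have i4 : ∀ e i, IntegrableOn (fun z => P.r t e (S.edgePoint e z) i * v (S.edgePoint e z) i)
      (S.edgeBox e) := fun e i => mul_integrable_edge (hv i).continuous (hP.r e i)
  unfold work surfaceIntegral edgeIntegral
  rw [integral_finsetSum _ fun i _ => i1 i]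
  simp_rw [integral_finsetSum _ fun i _ => i4 _ i]
  have : ∀ f, ∫ y in S.faceBox f, ∑ i, (P.t t f (S.facePoint f y) i * v (S.facePoint f y) i
      + P.q t f (S.facePoint f y) i * S.normalGrad (normal f) v i (S.facePoint f y))
      = (∑ i, ∫ y in S.faceBox f, P.t t f (S.facePoint f y) i * v (S.facePoint f y) i)
      + ∑ i, ∫ y in S.faceBox f, P.q t f (S.facePoint f y) i
          * S.normalGrad (normal f) v i (S.facePoint f y) := by
    intro f
    rw [integral_finsetSum _ fun i _ => (i2 f i).fun_add (i3 f i), ← Finset.sum_add_distrib]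
    exact Finset.sum_congr rfl fun i _ => integral_add (i2 f i) (i3 f i)
  simp_rw [this]
  rw [Finset.sum_add_distrib]
  ring

lemma normalGrad_add_smul {u v : Vec → Vec} (hu : ∀ i, ContDiff ℝ 1 (fun y => u y i))
    (hv : ∀ i, ContDiff ℝ 1 (fun y => v y i)) (n : Vec) (s : ℝ) (i : Fin 3) {x : Vec}
    (hx : x ∈ S.Ω) :
    S.normalGrad n (u + s • v) i x = S.normalGrad n u i x + s * S.normalGrad n v i x := by
  unfold normalGrad
  rw [Finset.mul_sum, ← Finset.sum_add_distrib]
  refine Finset.sum_congr rfl fun j _ => ?_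
  have := D_linear S.α₁_mem.2 (hu i) (hv i) s j hx
  simp only [Pi.add_apply, Pi.smul_apply, smul_eq_mul]
  rw [this]
  ring

/-- The work is linear in the displacement, hence equal to its own variation. Linearity of the
integrals needs every load term to be integrable, which is what `LoadsAt` provides. -/
lemma work_variation {P : Loads} {t : ℝ} (hP : S.LoadsAt P t) {u v : Vec → Vec}
    (hu : ∀ i, ContDiff ℝ 1 (fun y => u y i)) (hv : ∀ i, ContDiff ℝ 1 (fun y => v y i)) :
    firstVariation (S.work P t) u v = S.work P t v := by
  have hlin : ∀ s : ℝ, S.work P t (u + s • v) = S.work P t u + s * S.work P t v := by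
    intro s
    have hbu := fun i => bddMeas_of_continuous (S := S) (hu i).continuous
    have hbv := fun i => bddMeas_of_continuous (S := S) (hv i).continuous
    have hs : ∀ i, ContDiff ℝ 1 (fun y => (u + s • v) y i) := fun i =>
      (hu i).add (contDiff_const.mul (hv i))
    rw [work_eq hP hu, work_eq hP hv, work_eq hP hs]
    simp only [mul_add, Finset.mul_sum]
    have key : ∀ {X : Type} [MeasurableSpace X] (μ : Measure X) {p a b c : X → ℝ},
        Integrable (fun x => p x * a x) μ → Integrable (fun x => p x * b x) μ →
        (∀ᵐ x ∂μ, c x = a x + s * b x) →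
        ∫ x, p x * c x ∂μ = (∫ x, p x * a x ∂μ) + s * ∫ x, p x * b x ∂μ := by
      intro X _ μ p a b c ha hb hc
      rw [← integral_const_mul, ← integral_add ha (hb.const_mul s)]
      refine integral_congr_ae ?_
      filter_upwards [hc] with x hx
      rw [hx]
      ring
    have e1 : ∀ i, ∫ x in S.Ω, P.b t x i * (u + s • v) x i
        = (∫ x in S.Ω, P.b t x i * u x i) + s * ∫ x in S.Ω, P.b t x i * v x i := fun i =>
      key _ ((hbu i).integrable_mul (hP.b i))
        ((hbv i).integrable_mul (hP.b i))
        (Filter.Eventually.of_forall fun x => rfl)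
    have e2 : ∀ (f : Face) i, ∫ y in S.faceBox f,
        P.t t f (S.facePoint f y) i * (u + s • v) (S.facePoint f y) i
        = (∫ y in S.faceBox f, P.t t f (S.facePoint f y) i * u (S.facePoint f y) i)
          + s * ∫ y in S.faceBox f, P.t t f (S.facePoint f y) i * v (S.facePoint f y) i :=
      fun f i => key _ ((hbu i).integrable_mul_face (hP.t f i))
        ((hbv i).integrable_mul_face (hP.t f i))
        (Filter.Eventually.of_forall fun x => rfl)
    have e3 : ∀ (f : Face) i, ∫ y in S.faceBox f,
        P.q t f (S.facePoint f y) i * S.normalGrad (normal f) (u + s • v) i (S.facePoint f y)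
        = (∫ y in S.faceBox f, P.q t f (S.facePoint f y) i
            * S.normalGrad (normal f) u i (S.facePoint f y))
          + s * ∫ y in S.faceBox f, P.q t f (S.facePoint f y) i
            * S.normalGrad (normal f) v i (S.facePoint f y) := fun f i =>
      key _ ((bddMeas_normalGrad hu (normal f) i).integrable_mul_face (hP.q f i))
        ((bddMeas_normalGrad hv (normal f) i).integrable_mul_face (hP.q f i)) (by
          filter_upwards [ae_restrict_mem measurableSet_Icc] with y hy
          exact normalGrad_add_smul hu hv _ s i (S.facePoint_mem f hy))
    have e4 : ∀ (e : Edge) i, ∫ z in S.edgeBox e,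
        P.r t e (S.edgePoint e z) i * (u + s • v) (S.edgePoint e z) i
        = (∫ z in S.edgeBox e, P.r t e (S.edgePoint e z) i * u (S.edgePoint e z) i)
          + s * ∫ z in S.edgeBox e, P.r t e (S.edgePoint e z) i * v (S.edgePoint e z) i :=
      fun e i => key _ (mul_integrable_edge (hu i).continuous (hP.r e i))
        (mul_integrable_edge (hv i).continuous (hP.r e i))
        (Filter.Eventually.of_forall fun x => rfl)
    simp only [e1, e2, e3, e4, Finset.sum_add_distrib]
    ring
  unfold firstVariation
  simp only [hlin]
  simp

end Solid

/-! ### Reduction of the action to the work of the residuals. -/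

section Slices

variable {X : Type*} [MeasurableSpace X] {ν : Measure X} {t₁ t₂ : ℝ}

lemma integrable_mul_of_bdd_on {K : Set X} (hK : ∀ᵐ x ∂ν, x ∈ K) {R φ : ℝ × X → ℝ}
    (hR : Integrable R ((volume.restrict (Icc t₁ t₂)).prod ν))
    (hφ : AEStronglyMeasurable φ ((volume.restrict (Icc t₁ t₂)).prod ν))
    (hb : ∃ M, ∀ t ∈ Icc t₁ t₂, ∀ x ∈ K, |φ (t, x)| ≤ M) :
    Integrable (fun z => R z * φ z) ((volume.restrict (Icc t₁ t₂)).prod ν) := by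
  obtain ⟨M, hM⟩ := hb
  refine hR.mul_bdd (c := M) hφ ?_
  have h1 : ∀ᵐ z ∂((volume.restrict (Icc t₁ t₂)).prod ν), z.1 ∈ Icc t₁ t₂ :=
    Measure.quasiMeasurePreserving_fst.ae (ae_restrict_mem measurableSet_Icc)
  have h2 : ∀ᵐ z ∂((volume.restrict (Icc t₁ t₂)).prod ν), z.2 ∈ K :=
    Measure.quasiMeasurePreserving_snd.ae hK
  filter_upwards [h1, h2] with z hz1 hz2 using hM z.1 hz1 z.2 hz2

end Slices

namespace Solid

variable {S : Solid} {t₁ t₂ : ℝ}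

lemma bound_on_cylinder {φ : ℝ × Vec → ℝ} (hφ : Continuous φ) (t₁ t₂ : ℝ) :
    ∃ M, ∀ t ∈ Icc t₁ t₂, ∀ x ∈ S.Ω, |φ (t, x)| ≤ M := by
  obtain ⟨M, hM⟩ := ((isCompact_Icc (a := t₁) (b := t₂)).prod
    (isCompact_Icc (a := (0 : Vec)) (b := S.len))).exists_bound_of_continuousOn hφ.continuousOn
  exact ⟨M, fun t ht x hx => hM (t, x) ⟨ht, hx⟩⟩

lemma integrable_of_continuous_timeVol {φ : ℝ × Vec → ℝ} (hφ : Continuous φ) :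
    Integrable φ (S.timeVol t₁ t₂) := by
  rw [timeVol, Measure.prod_restrict]
  exact hφ.continuousOn.integrableOn_compact (isCompact_Icc.prod isCompact_Icc)

lemma integrable_mul_vol {R : ℝ × Vec → ℝ} (hR : Integrable R (S.timeVol t₁ t₂))
    {φ : ℝ × Vec → ℝ} (hφ : Continuous φ) :
    Integrable (fun z => R z * φ z) (S.timeVol t₁ t₂) :=
  integrable_mul_of_bdd_on (ae_restrict_mem measurableSet_Icc) hR hφ.aestronglyMeasurable
    (bound_on_cylinder hφ t₁ t₂)

lemma integrable_mul_face {f : Face} {R : ℝ × (Fin 2 → ℝ) → ℝ}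
    (hR : Integrable R (S.timeFace t₁ t₂ f)) {φ : ℝ × Vec → ℝ} (hφ : Continuous φ) :
    Integrable (fun z => R z * φ (z.1, S.facePoint f z.2)) (S.timeFace t₁ t₂ f) := by
  obtain ⟨M, hM⟩ := bound_on_cylinder (S := S) hφ t₁ t₂
  refine integrable_mul_of_bdd_on (K := S.faceBox f) (ae_restrict_mem measurableSet_Icc) hR
    (φ := fun z => φ (z.1, S.facePoint f z.2)) ?_
    ⟨M, fun t ht y hy => hM t ht _ (S.facePoint_mem f hy)⟩
  exact (hφ.comp (continuous_fst.prodMk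
    ((S.continuous_facePoint f).comp continuous_snd))).aestronglyMeasurable

lemma integrable_mul_edge {e : Edge} {R : ℝ × ℝ → ℝ}
    (hR : Integrable R (S.timeEdge t₁ t₂ e)) {φ : ℝ × Vec → ℝ} (hφ : Continuous φ) :
    Integrable (fun z => R z * φ (z.1, S.edgePoint e z.2)) (S.timeEdge t₁ t₂ e) := by
  obtain ⟨M, hM⟩ := bound_on_cylinder (S := S) hφ t₁ t₂
  refine integrable_mul_of_bdd_on (K := S.edgeBox e) (ae_restrict_mem measurableSet_Icc) hR
    (φ := fun z => φ (z.1, S.edgePoint e z.2)) ?_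
    ⟨M, fun t ht y hy => hM t ht _ (edgePoint_mem e hy)⟩
  exact (hφ.comp (continuous_fst.prodMk
    ((S.continuous_edgePoint e).comp continuous_snd))).aestronglyMeasurable

lemma contDiff_component {v : ℝ → Vec → Vec} (hv : ContDiff ℝ 1 (fun z : ℝ × Vec => v z.1 z.2))
    (i : Fin 3) : ContDiff ℝ 1 (fun z : ℝ × Vec => v z.1 z.2 i) := contDiff_pi.1 hv i

/-- The Riesz–Caputo derivative is replaced on the face by its jointly measurable representative,
which is bounded for times in the compact interval. -/
lemma integrable_mul_normalGrad {f : Face} {R : ℝ × (Fin 2 → ℝ) → ℝ}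
    (hR : Integrable R (S.timeFace t₁ t₂ f)) {v : ℝ → Vec → Vec}
    (hv : ContDiff ℝ 1 (fun z : ℝ × Vec => v z.1 z.2)) (i : Fin 3) :
    Integrable (fun z => R z * S.normalGrad (normal f) (v z.1) i (S.facePoint f z.2))
      (S.timeFace t₁ t₂ f) := by
  obtain ⟨h, hm, he, hb⟩ := S.exists_measurable_D S.α₁_mem.2 (F := fun t x => v t x i)
    (contDiff_component hv i) f.1
  obtain ⟨M, hM⟩ := hb t₁ t₂
  have e : ∀ t, ∀ y ∈ S.faceBox f, S.normalGrad (normal f) (v t) i (S.facePoint f y)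
      = sgn f.2 * h (t, S.facePoint f y) := by
    intro t y hy
    rw [normalGrad_normal, he t _ (S.facePoint_mem f hy)]
  refine integrable_mul_of_bdd_on (K := S.faceBox f) (ae_restrict_mem measurableSet_Icc) hR
    (φ := fun z => S.normalGrad (normal f) (v z.1) i (S.facePoint f z.2)) ?_
    ⟨M, fun t ht y hy => ?_⟩
  · have hmm : Measurable (fun z : ℝ × (Fin 2 → ℝ) => sgn f.2 * h (z.1, S.facePoint f z.2)) :=
      (hm.comp (measurable_fst.prodMk
        ((S.continuous_facePoint f).measurable.comp measurable_snd))).const_mul _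
    refine ⟨_, hmm.stronglyMeasurable, ?_⟩
    have : ∀ᵐ z ∂(S.timeFace t₁ t₂ f), z.2 ∈ S.faceBox f :=
      Measure.quasiMeasurePreserving_snd.ae (ae_restrict_mem measurableSet_Icc)
    filter_upwards [this] with z hz using e z.1 z.2 hz
  · rw [e t y hy, abs_mul]
    have : |sgn f.2| = 1 := by cases f.2 <;> simp [sgn]
    rw [this, one_mul]
    exact hM t ht _ (S.facePoint_mem f hy)

/-- The work done by the residuals of the strong form on a variation. -/
def residualWork (S : Solid) (t₁ t₂ : ℝ) (P : Loads) (u v : ℝ → Vec → Vec) : ℝ :=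
  -(∑ i, ∫ z, (S.internalForce (u z.1) i z.2 + P.b z.1 z.2 i
      - S.ρ * velocity (velocity u) z.1 z.2 i) * v z.1 z.2 i ∂(S.timeVol t₁ t₂))
    + (∑ f : Face, ∑ i, ∫ z, (S.traction (normal f) (u z.1) i (S.facePoint f z.2)
        - P.t z.1 f (S.facePoint f z.2) i) * v z.1 (S.facePoint f z.2) i ∂(S.timeFace t₁ t₂ f))
    + (∑ f : Face, ∑ i, ∫ z, (S.doubleTraction (normal f) (u z.1) i (S.facePoint f z.2)
        - P.q z.1 f (S.facePoint f z.2) i)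
          * S.normalGrad (normal f) (v z.1) i (S.facePoint f z.2) ∂(S.timeFace t₁ t₂ f))
    + ∑ e : Edge, ∑ i, ∫ z, (S.jump e (u z.1) i (S.edgePoint e z.2)
        - P.r z.1 e (S.edgePoint e z.2) i) * v z.1 (S.edgePoint e z.2) i ∂(S.timeEdge t₁ t₂ e)

lemma RegularMotion.hasDerivAt_velocity {u : ℝ → Vec → Vec} (hu : S.RegularMotion t₁ t₂ u)
    (t : ℝ) (x : Vec) :
    HasDerivAt (fun s => velocity u s x) (velocity (velocity u) t x) t := by
  have h2 : ContDiff ℝ (1 + 1) (fun t => u t x) := by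
    simpa [one_add_one_eq_two] using hu.contDiff_time x
  have h := (contDiff_succ_iff_deriv.1 h2).2.2
  exact (h.differentiable one_ne_zero t).hasDerivAt

/-- Integration by parts in time. -/
lemma integral_kinetic (ht : t₁ ≤ t₂) {u v : ℝ → Vec → Vec} (hu : S.RegularMotion t₁ t₂ u)
    (hv : ContDiff ℝ 1 (fun z : ℝ × Vec => v z.1 z.2)) (h1 : ∀ x ∈ S.Ω, v t₁ x = 0)
    (h2 : ∀ x ∈ S.Ω, v t₂ x = 0) (i : Fin 3) :
    ∫ z, S.ρ * velocity u z.1 z.2 i * velocity v z.1 z.2 i ∂(S.timeVol t₁ t₂)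
      = -∫ z, S.ρ * velocity (velocity u) z.1 z.2 i * v z.1 z.2 i ∂(S.timeVol t₁ t₂) := by
  have cu := continuous_pi_iff.1 (continuous_velocity hu.contDiff) i
  have ca := continuous_pi_iff.1 hu.accel_cont i
  have cv := continuous_pi_iff.1 (continuous_velocity hv) i
  have cv0 := (contDiff_component hv i).continuous
  have j1 : Integrable (fun z : ℝ × Vec => S.ρ * velocity u z.1 z.2 i * velocity v z.1 z.2 i)
      (S.timeVol t₁ t₂) := integrable_of_continuous_timeVol ((continuous_const.mul cu).mul cv)
  have j2 : Integrable (fun z : ℝ × Vec => S.ρ * velocity (velocity u) z.1 z.2 i * v z.1 z.2 i)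
      (S.timeVol t₁ t₂) := integrable_of_continuous_timeVol ((continuous_const.mul ca).mul cv0)
  -- Time is integrated first, at fixed x; the end terms vanish with the variation.
  rw [timeVol, integral_prod_symm _ j1, integral_prod_symm _ j2, ← integral_neg]
  refine setIntegral_congr_fun measurableSet_Icc fun x hx => ?_
  have sl : ∀ {g : ℝ × Vec → ℝ}, Continuous g → Continuous (fun t => g (t, x)) := fun hg =>
    hg.comp (by fun_prop)
  have d1 : ∀ t, HasDerivAt (fun s => S.ρ * velocity u s x i)
      (S.ρ * velocity (velocity u) t x i) t := fun t =>
    ((hasDerivAt_pi.1 (hu.hasDerivAt_velocity t x)) i).const_mul S.ρ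
  have d2 : ∀ t, HasDerivAt (fun s => v s x i) (velocity v t x i) t := fun t =>
    (hasDerivAt_pi.1 (FracElast.hasDerivAt_velocity hv t x)) i
  have := intervalIntegral.integral_mul_deriv_eq_deriv_mul (a := t₁) (b := t₂)
    (fun t _ => d1 t) (fun t _ => d2 t)
    ((continuous_const.mul (sl ca)).intervalIntegrable _ _) ((sl cv).intervalIntegrable _ _)
  simp only [h1 x hx, h2 x hx, Pi.zero_apply, mul_zero, sub_zero, zero_sub] at this
  rw [intervalIntegral.integral_of_le ht, intervalIntegral.integral_of_le ht,
    ← integral_Icc_eq_integral_Ioc, ← integral_Icc_eq_integral_Ioc] at this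
  exact this

/-- The action principle evaluated on a variation. -/
theorem integral_action_variation (ht : t₁ ≤ t₂) {P : Loads} (hP : S.IntegrableLoads t₁ t₂ P)
    {u v : ℝ → Vec → Vec} (hu : S.RegularMotion t₁ t₂ u)
    (hv : ContDiff ℝ 1 (fun z : ℝ × Vec => v z.1 z.2))
    (hvE : ∀ t ∈ Icc t₁ t₂, S.FiniteEnergy (v t)) (h1 : ∀ x ∈ S.Ω, v t₁ x = 0)
    (h2 : ∀ x ∈ S.Ω, v t₂ x = 0) :
    ∫ t in t₁..t₂, (firstVariation S.energy (u t) (v t)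
      - firstVariation (S.work P t) (u t) (v t)
      - firstVariation S.kinetic (velocity u t) (velocity v t))
    = S.residualWork t₁ t₂ P u v := by
  have cv := fun i => (contDiff_component hv i).continuous
  have iV1 := fun i => integrable_mul_vol (hu.force_int i) (cv i)
  have iV2 := fun i => integrable_mul_vol (hP.b i) (cv i)
  have iT1 := fun f i => integrable_mul_face (hu.traction_int f i) (cv i)
  have iT2 := fun f i => integrable_mul_face (hP.t f i) (cv i)
  have iQ1 := fun f i => integrable_mul_normalGrad (hu.doubleTraction_int f i) hv i
  have iQ2 := fun f i => integrable_mul_normalGrad (hP.q f i) hv i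
  have iE1 := fun e i => integrable_mul_edge (hu.jump_int e i) (cv i)
  have iE2 := fun e i => integrable_mul_edge (hP.r e i) (cv i)
  have iK : ∀ i, Integrable (fun z : ℝ × Vec => S.ρ * velocity u z.1 z.2 i * velocity v z.1 z.2 i)
      (S.timeVol t₁ t₂) := fun i => integrable_of_continuous_timeVol
    ((continuous_const.mul (continuous_pi_iff.1 (continuous_velocity hu.contDiff) i)).mul
      (continuous_pi_iff.1 (continuous_velocity hv) i))
  have iA : ∀ i, Integrable (fun z : ℝ × Vec => S.ρ * velocity (velocity u) z.1 z.2 i * v z.1 z.2 i)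
      (S.timeVol t₁ t₂) := fun i => integrable_of_continuous_timeVol
    ((continuous_const.mul (continuous_pi_iff.1 hu.accel_cont i)).mul (cv i))
  simp only [timeVol, timeFace, timeEdge] at iV1 iV2 iT1 iT2 iQ1 iQ2 iE1 iE2 iK iA
  -- By Fubini the loads are integrable in space at almost every time, which suffices under the time
  -- integral.
  have hload : ∀ᵐ t ∂(volume.restrict (Icc t₁ t₂)), S.LoadsAt P t := by
    have l1 := ae_all_iff.2 fun i => (hP.b i).prod_right_ae
    have l2 := ae_all_iff.2 fun f => ae_all_iff.2 fun i => (hP.t f i).prod_right_ae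
    have l3 := ae_all_iff.2 fun f => ae_all_iff.2 fun i => (hP.q f i).prod_right_ae
    have l4 := ae_all_iff.2 fun e => ae_all_iff.2 fun i => (hP.r e i).prod_right_ae
    filter_upwards [l1, l2, l3, l4] with t a b c d using ⟨a, b, c, d⟩
  -- At almost every time the first variation formula, the linearity of the work and the kinetic
  -- variation apply; every term becomes a sum of separate integrals over the volume, faces and
  -- edges.
  have slice : ∀ᵐ t ∂(volume.restrict (Icc t₁ t₂)),
      firstVariation S.energy (u t) (v t) - firstVariation (S.work P t) (u t) (v t)
        - firstVariation S.kinetic (velocity u t) (velocity v t)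
      = -(∑ i, ((∫ x in S.Ω, S.internalForce (u t) i x * v t x i)
            + ∫ x in S.Ω, P.b t x i * v t x i))
        + (∑ f : Face, ∑ i, ((∫ y in S.faceBox f,
              S.traction (normal f) (u t) i (S.facePoint f y) * v t (S.facePoint f y) i)
            - ∫ y in S.faceBox f, P.t t f (S.facePoint f y) i * v t (S.facePoint f y) i))
        + (∑ f : Face, ∑ i, ((∫ y in S.faceBox f,
              S.doubleTraction (normal f) (u t) i (S.facePoint f y)
                * S.normalGrad (normal f) (v t) i (S.facePoint f y))
            - ∫ y in S.faceBox f, P.q t f (S.facePoint f y) i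
                * S.normalGrad (normal f) (v t) i (S.facePoint f y)))
        + (∑ e : Edge, ∑ i, ((∫ z in S.edgeBox e,
              S.jump e (u t) i (S.edgePoint e z) * v t (S.edgePoint e z) i)
            - ∫ z in S.edgeBox e, P.r t e (S.edgePoint e z) i * v t (S.edgePoint e z) i))
        - ∑ i, ∫ x in S.Ω, S.ρ * velocity u t x i * velocity v t x i := by
    filter_upwards [hload, ae_restrict_mem measurableSet_Icc,
      ae_all_iff.2 fun i => (iV1 i).prod_right_ae,
      ae_all_iff.2 fun f => ae_all_iff.2 fun i => (iT1 f i).prod_right_ae,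
      ae_all_iff.2 fun f => ae_all_iff.2 fun i => (iQ1 f i).prod_right_ae,
      ae_all_iff.2 fun e => ae_all_iff.2 fun i => (iE1 e i).prod_right_ae,
      ae_all_iff.2 fun i => (iK i).prod_right_ae] with t hl ht' s1 s2 s3 s4 s5
    have hE := (hasDerivAt_energy (hu.finiteEnergy t ht') (hvE t ht')).deriv
    rw [first_variation_by_parts (hu.regularStress t ht') (hu.finiteEnergy t ht') (hvE t ht')] at hE
    have cu' : Continuous (velocity u t) :=
      (continuous_velocity hu.contDiff).comp (f := fun x => (t, x)) (by fun_prop)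
    have cv' : Continuous (velocity v t) :=
      (continuous_velocity hv).comp (f := fun x => (t, x)) (by fun_prop)
    rw [work_variation hl (hu.finiteEnergy t ht').contDiff_apply (hvE t ht').contDiff_apply,
      work_eq hl (hvE t ht').contDiff_apply, kinetic_variation cu' cv', firstVariation, hE,
      integral_finsetSum _ fun i _ => s1 i, integral_finsetSum _ fun i _ => s5 i]
    simp only [surfaceIntegral, edgeIntegral]
    simp_rw [integral_finsetSum _ fun i _ => s2 _ i, integral_finsetSum _ fun i _ => s3 _ i,
      integral_finsetSum _ fun i _ => s4 _ i]
    simp only [Finset.sum_sub_distrib, Finset.sum_add_distrib]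
    ring
  rw [intervalIntegral.integral_of_le ht, ← integral_Icc_eq_integral_Ioc, integral_congr_ae slice]
  have IV := integrable_finsetSum Finset.univ fun i _ =>
    (iV1 i).integral_prod_left.fun_add (iV2 i).integral_prod_left
  have IT := integrable_finsetSum Finset.univ fun f _ => integrable_finsetSum Finset.univ fun i _ =>
    (iT1 f i).integral_prod_left.sub' (iT2 f i).integral_prod_left
  have IQ := integrable_finsetSum Finset.univ fun f _ => integrable_finsetSum Finset.univ fun i _ =>
    (iQ1 f i).integral_prod_left.sub' (iQ2 f i).integral_prod_left
  have IE := integrable_finsetSum Finset.univ fun e _ => integrable_finsetSum Finset.univ fun i _ =>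
    (iE1 e i).integral_prod_left.sub' (iE2 e i).integral_prod_left
  have IK := integrable_finsetSum Finset.univ fun i _ => (iK i).integral_prod_left
  rw [integral_sub (((IV.fun_neg.fun_add IT).fun_add IQ).fun_add IE) IK,
    integral_add ((IV.fun_neg.fun_add IT).fun_add IQ) IE, integral_add (IV.fun_neg.fun_add IT) IQ,
    integral_add IV.fun_neg IT, integral_neg]
  rw [integral_finsetSum _ fun i _ => (iV1 i).integral_prod_left.fun_add (iV2 i).integral_prod_left,
    integral_finsetSum _ fun f _ => integrable_finsetSum Finset.univ fun i _ =>
      (iT1 f i).integral_prod_left.sub' (iT2 f i).integral_prod_left,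
    integral_finsetSum _ fun f _ => integrable_finsetSum Finset.univ fun i _ =>
      (iQ1 f i).integral_prod_left.sub' (iQ2 f i).integral_prod_left,
    integral_finsetSum _ fun e _ => integrable_finsetSum Finset.univ fun i _ =>
      (iE1 e i).integral_prod_left.sub' (iE2 e i).integral_prod_left,
    integral_finsetSum _ fun i _ => (iK i).integral_prod_left]
  simp_rw [integral_finsetSum _ fun i _ =>
      (iT1 _ i).integral_prod_left.sub' (iT2 _ i).integral_prod_left,
    integral_finsetSum _ fun i _ =>
      (iQ1 _ i).integral_prod_left.sub' (iQ2 _ i).integral_prod_left,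
    integral_finsetSum _ fun i _ =>
      (iE1 _ i).integral_prod_left.sub' (iE2 _ i).integral_prod_left]
  have eK := fun i => integral_kinetic ht hu hv h1 h2 i
  -- Integration by parts in time turns the kinetic term into the inertial part of the volume
  -- residual.
  have eV : ∀ i, ∫ z, (S.internalForce (u z.1) i z.2 + P.b z.1 z.2 i
        - S.ρ * velocity (velocity u) z.1 z.2 i) * v z.1 z.2 i ∂(S.timeVol t₁ t₂)
      = (∫ t in Icc t₁ t₂, ((∫ x in S.Ω, S.internalForce (u t) i x * v t x i)
            + ∫ x in S.Ω, P.b t x i * v t x i))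
        + ∫ t in Icc t₁ t₂, ∫ x in S.Ω, S.ρ * velocity u t x i * velocity v t x i := by
    intro i
    rw [integral_add (iV1 i).integral_prod_left (iV2 i).integral_prod_left,
      ← integral_prod _ (iV1 i), ← integral_prod _ (iV2 i), ← integral_prod _ (iK i)]
    have := eK i
    rw [timeVol] at this
    rw [this, ← sub_eq_add_neg, timeVol, ← integral_add (iV1 i) (iV2 i),
      ← integral_sub ((iV1 i).fun_add (iV2 i)) (iA i)]
    congr 1
    funext z
    ring
  have eT : ∀ (f : Face) i, ∫ z, (S.traction (normal f) (u z.1) i (S.facePoint f z.2)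
        - P.t z.1 f (S.facePoint f z.2) i) * v z.1 (S.facePoint f z.2) i ∂(S.timeFace t₁ t₂ f)
      = ∫ t in Icc t₁ t₂, ((∫ y in S.faceBox f,
              S.traction (normal f) (u t) i (S.facePoint f y) * v t (S.facePoint f y) i)
            - ∫ y in S.faceBox f, P.t t f (S.facePoint f y) i * v t (S.facePoint f y) i) := by
    intro f i
    rw [integral_sub (iT1 f i).integral_prod_left (iT2 f i).integral_prod_left,
      ← integral_prod _ (iT1 f i), ← integral_prod _ (iT2 f i), timeFace,
      ← integral_sub (iT1 f i) (iT2 f i)]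
    simp only [sub_mul]
  have eQ : ∀ (f : Face) i, ∫ z, (S.doubleTraction (normal f) (u z.1) i (S.facePoint f z.2)
        - P.q z.1 f (S.facePoint f z.2) i)
          * S.normalGrad (normal f) (v z.1) i (S.facePoint f z.2) ∂(S.timeFace t₁ t₂ f)
      = ∫ t in Icc t₁ t₂, ((∫ y in S.faceBox f,
              S.doubleTraction (normal f) (u t) i (S.facePoint f y)
                * S.normalGrad (normal f) (v t) i (S.facePoint f y))
            - ∫ y in S.faceBox f, P.q t f (S.facePoint f y) i
                * S.normalGrad (normal f) (v t) i (S.facePoint f y)) := by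
    intro f i
    rw [integral_sub (iQ1 f i).integral_prod_left (iQ2 f i).integral_prod_left,
      ← integral_prod _ (iQ1 f i), ← integral_prod _ (iQ2 f i), timeFace,
      ← integral_sub (iQ1 f i) (iQ2 f i)]
    simp only [sub_mul]
  have eE : ∀ (e : Edge) i, ∫ z, (S.jump e (u z.1) i (S.edgePoint e z.2)
        - P.r z.1 e (S.edgePoint e z.2) i) * v z.1 (S.edgePoint e z.2) i ∂(S.timeEdge t₁ t₂ e)
      = ∫ t in Icc t₁ t₂, ((∫ z in S.edgeBox e,
              S.jump e (u t) i (S.edgePoint e z) * v t (S.edgePoint e z) i)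
            - ∫ z in S.edgeBox e, P.r t e (S.edgePoint e z) i * v t (S.edgePoint e z) i) := by
    intro e i
    rw [integral_sub (iE1 e i).integral_prod_left (iE2 e i).integral_prod_left,
      ← integral_prod _ (iE1 e i), ← integral_prod _ (iE2 e i), timeEdge,
      ← integral_sub (iE1 e i) (iE2 e i)]
    simp only [sub_mul]
  unfold residualWork
  simp only [eV, eT, eQ, eE, Finset.sum_add_distrib]
  ring

/-- The strong form implies Hamilton's principle. -/
theorem StrongForm.hamilton (ht : t₁ ≤ t₂) {P : Loads} {B : Essential}
    (hP : S.IntegrableLoads t₁ t₂ P) {u : ℝ → Vec → Vec} (hu : S.RegularMotion t₁ t₂ u)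
    (h : S.StrongForm t₁ t₂ P B u) : S.Hamilton t₁ t₂ P B u := by
  refine ⟨h.essential, fun v hv => ?_⟩
  rw [integral_action_variation ht hP hu hv.contDiff hv.finiteEnergy hv.start hv.finish,
    residualWork]
  have hmem : ∀ {X : Type} [MeasurableSpace X] {ν : Measure X} {K : Set X},
      (∀ᵐ x ∂ν, x ∈ K) → ∀ᵐ z ∂((volume.restrict (Icc t₁ t₂)).prod ν),
        z.1 ∈ Icc t₁ t₂ ∧ z.2 ∈ K := fun hK =>
    (Measure.quasiMeasurePreserving_fst.ae (ae_restrict_mem measurableSet_Icc)).and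
      (Measure.quasiMeasurePreserving_snd.ae hK)
  -- Every integrand is a residual times a factor from the variation. The factor vanishes where an
  -- essential condition is imposed, the residual vanishes almost everywhere elsewhere.
  rw [Finset.sum_eq_zero, Finset.sum_eq_zero, Finset.sum_eq_zero, Finset.sum_eq_zero]
  · simp
  · intro e _
    refine Finset.sum_eq_zero fun i _ => integral_eq_zero_of_ae ?_
    by_cases hB : B.onEdge e i
    · filter_upwards [hmem (ae_restrict_mem (measurableSet_Icc (a := (0:ℝ)) (b := S.len e.1)))]
        with z hz
      rw [hv.onEdge e i hB z.1 hz.1 z.2 hz.2, mul_zero, Pi.zero_apply]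
    · filter_upwards [h.jump e i hB] with z hz
      rw [hz, sub_self, zero_mul, Pi.zero_apply]
  · intro f _
    refine Finset.sum_eq_zero fun i _ => integral_eq_zero_of_ae ?_
    by_cases hB : B.gradOnFace f i
    · filter_upwards [hmem (ae_restrict_mem (measurableSet_Icc (a := (0 : Fin 2 → ℝ))
        (b := fun m => S.len (f.1.succAbove m))))] with z hz
      rw [hv.gradOnFace f i hB z.1 hz.1 z.2 hz.2, mul_zero, Pi.zero_apply]
    · filter_upwards [h.doubleTraction f i hB] with z hz
      rw [hz, sub_self, zero_mul, Pi.zero_apply]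
  · intro f _
    refine Finset.sum_eq_zero fun i _ => integral_eq_zero_of_ae ?_
    by_cases hB : B.onFace f i
    · filter_upwards [hmem (ae_restrict_mem (measurableSet_Icc (a := (0 : Fin 2 → ℝ))
        (b := fun m => S.len (f.1.succAbove m))))] with z hz
      rw [hv.onFace f i hB z.1 hz.1 z.2 hz.2, mul_zero, Pi.zero_apply]
    · filter_upwards [h.traction f i hB] with z hz
      rw [hz, sub_self, zero_mul, Pi.zero_apply]
  · intro i _
    refine integral_eq_zero_of_ae ?_
    filter_upwards [h.governing i] with z hz
    rw [hz, sub_self, zero_mul, Pi.zero_apply]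

end Solid

/-! ### Smooth functions supported inside a segment -/

/-- Smooth functions with support inside the open segment `(0, L)`. -/
def bumps (L : ℝ) : Submodule ℝ (ℝ → ℝ) where
  carrier := {g | ContDiff ℝ (⊤ : ℕ∞) g ∧ tsupport g ⊆ Ioo 0 L}
  add_mem' := fun hf hg => ⟨hf.1.add hg.1, (tsupport_add _ _).trans (union_subset hf.2 hg.2)⟩
  zero_mem' := ⟨contDiff_const, by simp [tsupport]⟩
  smul_mem' := fun c g hg =>
    ⟨contDiff_const.smul hg.1, (tsupport_smul_subset_right (fun _ => c) g).trans hg.2⟩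

lemma hasCompactSupport_of_mem_bumps {L : ℝ} {g : ℝ → ℝ} (hg : g ∈ bumps L) :
    HasCompactSupport g :=
  isCompact_Icc.of_isClosed_subset (isClosed_tsupport g) (hg.2.trans Ioo_subset_Icc_self)

lemma bound_of_mem_bumps {L : ℝ} {g : ℝ → ℝ} (hg : g ∈ bumps L) : ∃ M, ∀ s, |g s| ≤ M := by
  obtain ⟨M, hM⟩ := (hasCompactSupport_of_mem_bumps hg).exists_bound_of_continuous hg.1.continuous
  exact ⟨M, hM⟩

lemma integrableOn_mul_bump {L : ℝ} {h g : ℝ → ℝ} (hh : IntegrableOn h (Icc 0 L))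
    (hg : g ∈ bumps L) : IntegrableOn (fun s => h s * g s) (Icc 0 L) := by
  obtain ⟨M, hM⟩ := bound_of_mem_bumps hg
  exact hh.mul_bdd (c := M) hg.1.continuous.aestronglyMeasurable (Filter.Eventually.of_forall hM)

/-- The functional on `bumps L` represented by an integrable function. -/
def bumpPairing {L : ℝ} {h : ℝ → ℝ} (hh : IntegrableOn h (Icc 0 L)) : bumps L →ₗ[ℝ] ℝ where
  toFun g := ∫ s in Icc 0 L, h s * g.1 s
  map_add' f g := by
    rw [← integral_add (integrableOn_mul_bump hh f.2) (integrableOn_mul_bump hh g.2)]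
    exact integral_congr_ae (Filter.Eventually.of_forall fun s => mul_add _ _ _)
  map_smul' c g := by
    rw [RingHom.id_apply, smul_eq_mul, ← integral_const_mul]
    exact integral_congr_ae (Filter.Eventually.of_forall fun s => mul_left_comm _ _ _)

/-- The fundamental lemma of the calculus of variations on the open segment; the end points are
null. -/
lemma ae_eq_zero_of_bumpPairing {L : ℝ} {h : ℝ → ℝ} (hh : IntegrableOn h (Icc 0 L))
    (h0 : ∀ g ∈ bumps L, ∫ s in Icc 0 L, h s * g s = 0) :
    ∀ᵐ s ∂(volume.restrict (Icc 0 L)), h s = 0 := by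
  rw [← restrict_Ioo_eq_restrict_Icc, ae_restrict_iff' measurableSet_Ioo]
  refine isOpen_Ioo.ae_eq_zero_of_integral_contDiff_smul_eq_zero
    (hh.mono_set Ioo_subset_Icc_self).locallyIntegrableOn fun g hg _ hs => ?_
  rw [← h0 g ⟨hg, hs⟩, ← setIntegral_eq_integral_of_forall_compl_eq_zero (s := Icc 0 L)]
  · simp only [smul_eq_mul, mul_comm]
  · intro x hx
    rw [image_eq_zero_of_notMem_tsupport fun h' => hx (Ioo_subset_Icc_self (hs h')), zero_smul]

section Family

variable {ι : Type*} [Fintype ι] {L : ℝ} {k : ι → ℝ → ℝ}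

lemma integral_sum_mul_bump (hk : ∀ i, IntegrableOn (k i) (Icc 0 L)) (c : ι → ℝ) {g : ℝ → ℝ}
    (hg : g ∈ bumps L) :
    ∫ s in Icc 0 L, (∑ i, c i * k i s) * g s = ∑ i, c i * ∫ s in Icc 0 L, k i s * g s := by
  simp_rw [Finset.sum_mul, mul_assoc]
  rw [integral_finsetSum _ fun i _ => (integrableOn_mul_bump (hk i) hg).const_mul _]
  simp_rw [integral_const_mul]

/-- A function that annihilates the bumps annihilated by finitely many functions is a linear
combination of them. -/
lemma exists_combination_of_annihilates (hk : ∀ i, IntegrableOn (k i) (Icc 0 L)) {h : ℝ → ℝ}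
    (hh : IntegrableOn h (Icc 0 L))
    (H : ∀ g ∈ bumps L, (∀ i, ∫ s in Icc 0 L, k i s * g s = 0) → ∫ s in Icc 0 L, h s * g s = 0) :
    ∃ c : ι → ℝ, ∀ᵐ s ∂(volume.restrict (Icc 0 L)), h s = ∑ i, c i * k i s := by
  -- Pure linear algebra: a functional that vanishes on the common kernel of finitely many others is
  -- in their span.
  have hmem := mem_span_of_iInf_ker_le_ker (L := fun i => bumpPairing (hk i))
    (K := bumpPairing hh) (fun g hg => by
      rw [LinearMap.mem_ker]
      refine H g.1 g.2 fun i => ?_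
      exact LinearMap.mem_ker.1 ((Submodule.mem_iInf _).1 hg i))
  obtain ⟨c, hc⟩ := (Submodule.mem_span_range_iff_exists_fun ℝ).1 hmem
  have hi : IntegrableOn (fun s => ∑ i, c i * k i s) (Icc 0 L) :=
    integrable_finsetSum _ fun i _ => (hk i).const_mul _
  refine ⟨c, ?_⟩
  have := ae_eq_zero_of_bumpPairing (hh.sub hi) fun g hg => ?_
  · filter_upwards [this] with s hs using sub_eq_zero.1 hs
  · have e := LinearMap.congr_fun hc ⟨g, hg⟩
    simp only [LinearMap.sum_apply, LinearMap.smul_apply, smul_eq_mul] at e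
    have e' : ∑ i, c i * ∫ s in Icc 0 L, k i s * g s = ∫ s in Icc 0 L, h s * g s := e
    simp only [Pi.sub_apply, sub_mul]
    rw [integral_sub (integrableOn_mul_bump hh hg) (integrableOn_mul_bump hi hg),
      integral_sum_mul_bump hk c hg, e', sub_self]

/-- Bumps with prescribed integrals against linearly independent functions. -/
lemma exists_bump_of_independent (hk : ∀ i, IntegrableOn (k i) (Icc 0 L))
    (H : ∀ c : ι → ℝ, (∀ᵐ s ∂(volume.restrict (Icc 0 L)), ∑ i, c i * k i s = 0) → c = 0)
    (p : ι → ℝ) : ∃ g ∈ bumps L, ∀ i, ∫ s in Icc 0 L, k i s * g s = p i := by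
  classical
  -- If the moment map were not onto, a nonzero functional would vanish on its range, and its
  -- coefficients would give a nontrivial relation between the `k i`.
  have htop : LinearMap.range (LinearMap.pi fun i => bumpPairing (hk i)) = ⊤ := by
    by_contra hne
    obtain ⟨f, hf, hle⟩ := Submodule.exists_le_ker_of_lt_top _ (lt_top_iff_ne_top.2 hne)
    refine hf ?_
    have hfx : ∀ x : ι → ℝ, f x = ∑ i, f (Pi.single i 1) * x i := by
      intro x
      rw [LinearMap.pi_apply_eq_sum_univ f x]
      refine Finset.sum_congr rfl fun i _ => ?_
      rw [smul_eq_mul, mul_comm]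
      congr 2
      funext j
      simp [Pi.single_apply, eq_comm]
    have hc := H (fun i => f (Pi.single i 1)) (ae_eq_zero_of_bumpPairing
      (integrable_finsetSum _ fun i _ => (hk i).const_mul _) fun g hg => ?_)
    · ext x
      exact congrFun hc x
    · rw [integral_sum_mul_bump hk _ hg]
      have := LinearMap.mem_ker.1 (hle (LinearMap.mem_range_self _ (⟨g, hg⟩ : bumps L)))
      rw [hfx] at this
      exact this
  obtain ⟨g, hg⟩ := LinearMap.range_eq_top.1 htop p
  exact ⟨g.1, g.2, fun i => congrFun hg i⟩

end Family

/-! ### Singular behaviour of the kernel -/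

/-- Just to the right of 0 the kernel is a positive multiple of s^(-α), which is unbounded as α > 0.
-/
lemma eq_zero_of_mul_rieszKer_le {α a b δ c M : ℝ} (hα : α ∈ Ioo (0:ℝ) 1) (ha : 0 < a) (hδ : 0 < δ)
    (h : ∀ᵐ s ∂(volume.restrict (Ioo 0 δ)), |c * rieszKer α a b s| ≤ M) : c = 0 := by
  by_contra hc
  set κ := 1 / 2 * Real.Gamma (2 - α) * (1 / Real.Gamma (1 - α)) * a ^ (α - 1) with hκ
  have hκ0 : 0 < κ := by
    have := Real.Gamma_pos_of_pos (show 0 < 2 - α by linarith [hα.2])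
    have := Real.Gamma_pos_of_pos (show 0 < 1 - α by linarith [hα.2])
    positivity
  have ht : Filter.Tendsto (fun s : ℝ => |c| * κ * s ^ (-α)) (nhdsWithin 0 (Ioi 0)) Filter.atTop :=
    (tendsto_rpow_neg_nhdsGT_zero (by linarith [hα.1])).const_mul_atTop
      (mul_pos (abs_pos.2 hc) hκ0)
  obtain ⟨ε, hε, hsub⟩ := (mem_nhdsGT_iff_exists_Ioo_subset).1 (ht.eventually_gt_atTop M)
  have hε0 : (0:ℝ) < ε := hε
  -- Below `m` the power exceeds the bound, the hypothesis applies, and the point lies in the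
  -- positive horizon.
  set m := min ε (min δ a) with hm
  have hm0 : 0 < m := lt_min hε0 (lt_min hδ ha)
  have hmδ : m ≤ δ := (min_le_right _ _).trans (min_le_left _ _)
  have hma : m ≤ a := (min_le_right _ _).trans (min_le_right _ _)
  have h' : ∀ᵐ s ∂(volume.restrict (Ioo 0 m)), False := by
    filter_upwards [ae_mono (Measure.restrict_mono (Ioo_subset_Ioo_right hmδ) le_rfl) h,
      ae_restrict_mem measurableSet_Ioo] with s hs hs'
    have h1 : s ∈ Ioo 0 a := ⟨hs'.1, hs'.2.trans_le hma⟩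
    have h2 : s ∉ Ioo (-b) 0 := fun h => by linarith [h.2, hs'.1]
    have h3 : M < |c| * κ * s ^ (-α) := hsub ⟨hs'.1, hs'.2.trans_le (min_le_left _ _)⟩
    have h4 : |c * rieszKer α a b s| = |c| * κ * s ^ (-α) := by
      simp only [rieszKer, indicator_of_mem h1, indicator_of_notMem h2, add_zero]
      rw [abs_mul, abs_of_nonneg (a := _ * (_ * _)), hκ]
      · ring
      · have := Real.rpow_nonneg hs'.1.le (-α)
        have := Real.Gamma_pos_of_pos (show 0 < 2 - α by linarith [hα.2])
        have := Real.Gamma_pos_of_pos (show 0 < 1 - α by linarith [hα.2])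
        positivity
    linarith
  rw [Filter.eventually_false_iff_eq_bot, ae_eq_bot, Measure.restrict_eq_zero, Real.volume_Ioo,
    sub_zero, ENNReal.ofReal_eq_zero] at h'
  linarith

lemma abs_rieszKer_le {α a b r δ : ℝ} (hα : α ∈ Ioo (0:ℝ) 1) (ha : 0 < a) (hb : 0 < b)
    (hδ : 0 < δ) (hr : δ ≤ |r|) :
    |rieszKer α a b r| ≤ |1 / 2 * Real.Gamma (2 - α) * (1 / Real.Gamma (1 - α))|
      * (a ^ (α - 1) * δ ^ (-α) + b ^ (α - 1) * δ ^ (-α)) := by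
  rw [rieszKer, abs_mul]
  gcongr
  refine (abs_add_le _ _).trans ?_
  have hpow : ∀ x : ℝ, δ ≤ x → x ^ (-α) ≤ δ ^ (-α) := fun x hx =>
    Real.rpow_le_rpow_of_nonpos hδ hx (by linarith [hα.1])
  have hd : 0 ≤ δ ^ (-α) := Real.rpow_nonneg hδ.le _
  have ha' := Real.rpow_nonneg ha.le (α - 1)
  have hb' := Real.rpow_nonneg hb.le (α - 1)
  gcongr
  · by_cases h : r ∈ Ioo 0 a
    · rw [indicator_of_mem h, abs_of_nonneg (mul_nonneg ha' (Real.rpow_nonneg h.1.le _))]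
      refine mul_le_mul_of_nonneg_left ?_ ha'
      exact hpow r (by rwa [abs_of_pos h.1] at hr)
    · rw [indicator_of_notMem h, abs_zero]
      positivity
  · by_cases h : r ∈ Ioo (-b) 0
    · rw [indicator_of_mem h,
        abs_of_nonneg (mul_nonneg hb' (Real.rpow_nonneg (by linarith [h.2]) _))]
      refine mul_le_mul_of_nonneg_left ?_ hb'
      exact hpow (-r) (by rwa [abs_of_neg h.2] at hr)
    · rw [indicator_of_notMem h, abs_zero]
      positivity

/-- A bounded combination of a constant and of the kernels centred at the ends of a segment does
not involve the kernels. -/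
lemma coeff_eq_zero_of_bounded {α L lA lB : ℝ} (hα : α ∈ Ioo (0:ℝ) 1) (hL : 0 < L) (hA : 0 < lA)
    (hB : 0 < lB) {c₀ c₁ c₂ M : ℝ}
    (h : ∀ᵐ s ∂(volume.restrict (Icc 0 L)),
      |c₀ + c₁ * rieszKer α lA lB (0 - s) + c₂ * rieszKer α lA lB (L - s)| ≤ M) :
    c₁ = 0 ∧ c₂ = 0 := by
  -- Within L/2 of one end the kernel centred at the other end is bounded, so the singular one
  -- cannot be compensated.
  have key : ∀ {a b c₁ c₂ : ℝ}, 0 < a → 0 < b → (∀ᵐ s ∂(volume.restrict (Icc 0 L)),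
      |c₀ + c₁ * rieszKer α a b s + c₂ * rieszKer α a b (s - L)| ≤ M) → c₁ = 0 := by
    intro a b c₁ c₂ ha hb h
    set K := |1 / 2 * Real.Gamma (2 - α) * (1 / Real.Gamma (1 - α))|
      * (a ^ (α - 1) * (L / 2) ^ (-α) + b ^ (α - 1) * (L / 2) ^ (-α)) with hK
    refine eq_zero_of_mul_rieszKer_le (a := a) (b := b) (δ := L / 2) (M := M + |c₀| + |c₂| * K)
      hα ha (by positivity) ?_
    filter_upwards [ae_mono (Measure.restrict_mono (show Ioo 0 (L / 2) ⊆ Icc 0 L from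
      fun s hs => ⟨hs.1.le, by linarith [hs.2]⟩) le_rfl) h, ae_restrict_mem measurableSet_Ioo]
      with s hs hs'
    have h1 : |rieszKer α a b (s - L)| ≤ K := abs_rieszKer_le hα ha hb (by positivity)
      (by rw [abs_of_neg (by linarith [hs'.2])]; linarith [hs'.2])
    have h2 : |c₂ * rieszKer α a b (s - L)| ≤ |c₂| * K := by
      rw [abs_mul]
      gcongr
    have h3 := abs_sub (c₀ + c₁ * rieszKer α a b s + c₂ * rieszKer α a b (s - L))
      (c₀ + c₂ * rieszKer α a b (s - L))
    have h4 := abs_add_le c₀ (c₂ * rieszKer α a b (s - L))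
    rw [show c₀ + c₁ * rieszKer α a b s + c₂ * rieszKer α a b (s - L)
      - (c₀ + c₂ * rieszKer α a b (s - L)) = c₁ * rieszKer α a b s by ring] at h3
    linarith
  constructor
  · refine key (a := lB) (b := lA) (c₂ := c₂) hB hA ?_
    filter_upwards [h] with s hs
    rwa [← rieszKer_neg α lA lB s, ← rieszKer_neg α lA lB (s - L), neg_sub, ← zero_sub]
  -- The substitution s ↦ L - s exchanges the two ends.
  · refine key (a := lA) (b := lB) (c₂ := c₁) hA hB ?_
    have hmp : MeasurePreserving (fun s : ℝ => L - s) (volume.restrict (Icc 0 L))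
        (volume.restrict (Icc 0 L)) := by
      have := (Measure.measurePreserving_sub_left volume L).restrict_preimage
        (measurableSet_Icc (a := (0:ℝ)) (b := L))
      rwa [show (fun s : ℝ => L - s) ⁻¹' Icc 0 L = Icc 0 L by
        ext s; simp only [mem_preimage, mem_Icc]; constructor <;> intro h <;> constructor <;>
          linarith [h.1, h.2]] at this
    filter_upwards [hmp.quasiMeasurePreserving.ae h] with s hs
    rw [show 0 - (L - s) = s - L by ring, sub_sub_cancel] at hs
    rwa [add_right_comm]

/-! ### One-dimensional test functions -/

/-- Smooth functions, constant near the ends of the segment `[0, L]`, with prescribed values `a`,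
`b` and Riesz--Caputo derivatives `c`, `d` at the ends. -/
structure IsProfile (α L lA lB a b c d : ℝ) (w : ℝ → ℝ) : Prop where
  contDiff : ContDiff ℝ (⊤ : ℕ∞) w
  deriv_mem : deriv w ∈ bumps L
  left : w 0 = a
  right : w L = b
  caputo_left : rieszCaputo α L lA lB w 0 = c
  caputo_right : rieszCaputo α L lA lB w L = d

/-- The derivative of a profile with given end data pairs with the constant and with the kernels
centred at the ends. -/
def endKer (α L lA lB : ℝ) : Fin 3 → ℝ → ℝ :=
  ![fun _ => 1, fun s => rieszKer α lA lB (0 - s), fun s => rieszKer α lA lB (L - s)]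

lemma integrableOn_endKer {α L lA lB : ℝ} (hα : α < 1) (hA : 0 < lA) (hB : 0 < lB) (i : Fin 3) :
    IntegrableOn (endKer α L lA lB i) (Icc 0 L) := by
  fin_cases i
  · exact integrableOn_const (by simp)
  · exact ((integrable_rieszKer hα hA hB).comp_sub_left 0).integrableOn
  · exact ((integrable_rieszKer hα hA hB).comp_sub_left L).integrableOn

lemma rieszCaputo_eq_of_deriv_mem {α L lA lB : ℝ} (hα : α < 1) (hA : 0 < lA) (hB : 0 < lB)
    {w : ℝ → ℝ} (hw : deriv w ∈ bumps L) {x : ℝ} (hx : x ∈ Icc 0 L) :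
    rieszCaputo α L lA lB w x = ∫ s in Icc 0 L, rieszKer α lA lB (x - s) * deriv w s := by
  obtain ⟨M, hM⟩ := bound_of_mem_bumps hw
  exact rieszCaputo_eq_integral hA hB hx (integrableOn_rieszKer_mul hα hA hB
    hw.1.continuous.aestronglyMeasurable (Filter.Eventually.of_forall hM) x)

/-- All end data are linear in w' = g: the increment is its integral, and the Riesz–Caputo
derivatives at the ends are its integrals against the kernels centred there. Finding a profile is
thus a moment problem for `g`. -/
lemma isProfile_primitive {α L lA lB a b c d : ℝ} (hα : α < 1) (hL : 0 < L) (hA : 0 < lA)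
    (hB : 0 < lB) {g : ℝ → ℝ} (hg : g ∈ bumps L)
    (hp : ∀ i, ∫ s in Icc 0 L, endKer α L lA lB i s * g s = ![b - a, c, d] i) :
    IsProfile α L lA lB a b c d (fun t => a + ∫ s in (0:ℝ)..t, g s) := by
  have hd : ∀ t, HasDerivAt (fun t => a + ∫ s in (0:ℝ)..t, g s) (g t) t := fun t =>
    (intervalIntegral.integral_hasDerivAt_right (hg.1.continuous.intervalIntegrable _ _)
      (hg.1.continuous.stronglyMeasurableAtFilter _ _) hg.1.continuous.continuousAt).const_add a
  have hd' : deriv (fun t => a + ∫ s in (0:ℝ)..t, g s) = g := funext fun t => (hd t).deriv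
  have hm : deriv (fun t => a + ∫ s in (0:ℝ)..t, g s) ∈ bumps L := by rwa [hd']
  have p0 := hp 0
  have p1 := hp 1
  have p2 := hp 2
  simp only [endKer, Matrix.cons_val_zero, Matrix.cons_val_one, Matrix.cons_val, one_mul] at p0 p1 p2
  refine ⟨contDiff_infty_iff_deriv.2 ⟨fun t => (hd t).differentiableAt, hm.1⟩, hm, by simp, ?_, ?_, ?_⟩
  · rw [intervalIntegral.integral_of_le hL.le, ← integral_Icc_eq_integral_Ioc, p0]
    ring
  · rw [rieszCaputo_eq_of_deriv_mem hα hA hB hm ⟨le_rfl, hL.le⟩, hd', p1]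
  · rw [rieszCaputo_eq_of_deriv_mem hα hA hB hm ⟨hL.le, le_rfl⟩, hd', p2]

/-- The end data of a profile can be prescribed arbitrarily. -/
theorem exists_isProfile {α L lA lB : ℝ} (hα : α ∈ Ioo (0:ℝ) 1) (hL : 0 < L) (hA : 0 < lA)
    (hB : 0 < lB) (a b c d : ℝ) : ∃ w, IsProfile α L lA lB a b c d w := by
  -- In a vanishing combination the kernels drop out first, since a combination containing them is
  -- unbounded; then the constant is zero.
  have hind : ∀ c : Fin 3 → ℝ, (∀ᵐ s ∂(volume.restrict (Icc 0 L)),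
      ∑ i, c i * endKer α L lA lB i s = 0) → c = 0 := by
    intro c h
    simp only [endKer, Fin.sum_univ_three, Matrix.cons_val_zero, Matrix.cons_val_one,
      Matrix.cons_val, mul_one] at h
    obtain ⟨h1, h2⟩ := coeff_eq_zero_of_bounded (c₀ := c 0) (c₁ := c 1) (c₂ := c 2)
      (M := 0) hα hL hA hB (h.mono fun s hs => by rw [hs, abs_zero])
    have h0 : c 0 = 0 := by
      by_contra h0
      have h' : ∀ᵐ s ∂(volume.restrict (Icc 0 L)), False := by
        filter_upwards [h] with s hs
        rw [h1, h2, zero_mul, zero_mul, add_zero, add_zero] at hs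
        exact h0 hs
      rw [Filter.eventually_false_iff_eq_bot, ae_eq_bot, Measure.restrict_eq_zero, Real.volume_Icc,
        sub_zero, ENNReal.ofReal_eq_zero] at h'
      linarith
    funext i
    fin_cases i
    exacts [h0, h1, h2]
  obtain ⟨g, hg, hp⟩ := exists_bump_of_independent (integrableOn_endKer hα.2 hA hB) hind
    ![b - a, c, d]
  exact ⟨_, isProfile_primitive hα.2 hL hA hB hg hp⟩

/-! ### Profiles detect integrable functions -/

/-- Every right neighbourhood of `s` has positive measure and so contains points with the value `c`.
-/
lemma eq_of_tendsto_of_ae_eq {f : ℝ → ℝ} {s L c l : ℝ} (hs : s < L)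
    (h : ∀ᵐ t ∂(volume.restrict (Ioo s L)), f t = c)
    (hl : Filter.Tendsto f (nhdsWithin s (Ioi s)) (nhds l)) : l = c := by
  by_contra hne
  obtain ⟨ε, hε, hsub⟩ := mem_nhdsGT_iff_exists_Ioo_subset.1 (hl.eventually_ne hne)
  have hε' : s < ε := hε
  have h' : ∀ᵐ t ∂(volume.restrict (Ioo s (min ε L))), False := by
    filter_upwards [ae_mono (Measure.restrict_mono (Ioo_subset_Ioo_right (min_le_right ε L)) le_rfl) h,
      ae_restrict_mem measurableSet_Ioo] with t ht ht'
    exact hsub ⟨ht'.1, ht'.2.trans_le (min_le_left _ _)⟩ ht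
  rw [Filter.eventually_false_iff_eq_bot, ae_eq_bot, Measure.restrict_eq_zero, Real.volume_Ioo,
    ENNReal.ofReal_eq_zero] at h'
  have := lt_min hε' hs
  linarith

section Superlevel

variable {X : Type*} [MeasurableSpace X] {μ : Measure X} {R g : X → ℝ}

/-- This uniform bound is what later excludes the singular kernels. -/
lemma abs_superlevel_le (hR : Integrable R μ) (s : ℝ) :
    |∫ x, (Ioi s).indicator 1 (g x) * R x ∂μ| ≤ ∫ x, |R x| ∂μ := by
  refine norm_integral_le_of_norm_le (f := fun x => (Ioi s).indicator 1 (g x) * R x) hR.abs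
    (Filter.Eventually.of_forall fun x => ?_)
  rw [norm_mul, Real.norm_eq_abs (R x)]
  refine mul_le_of_le_one_left (abs_nonneg _) ?_
  by_cases h : g x ∈ Ioi s
  · simp [indicator_of_mem h]
  · simp [indicator_of_notMem h]

/-- Dominated convergence with majorant |R|: for fixed x the indicator takes only two values and is
eventually constant. -/
lemma tendsto_superlevel (hR : Integrable R μ) (hg : Measurable g) {l : Filter ℝ}
    [l.IsCountablyGenerated] {F : X → ℝ}
    (h : ∀ᵐ x ∂μ, ∀ᶠ s in l, (Ioi s).indicator 1 (g x) * R x = F x) :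
    Filter.Tendsto (fun s => ∫ x, (Ioi s).indicator 1 (g x) * R x ∂μ) l (nhds (∫ x, F x ∂μ)) := by
  refine tendsto_integral_filter_of_dominated_convergence (fun x => |R x|)
    (Filter.Eventually.of_forall fun s => ?_) (Filter.Eventually.of_forall fun s =>
      Filter.Eventually.of_forall fun x => ?_) hR.abs ?_
  · exact (((measurable_one.indicator measurableSet_Ioi).comp hg).aestronglyMeasurable).mul hR.1
  · rw [norm_mul, Real.norm_eq_abs (R x)]
    refine mul_le_of_le_one_left (abs_nonneg _) ?_
    by_cases h : g x ∈ Ioi s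
    · simp [indicator_of_mem h]
    · simp [indicator_of_notMem h]
  · filter_upwards [h] with x hx
    exact tendsto_const_nhds.congr' (hx.mono fun s hs => hs.symm)

/-- An integrable function orthogonal to all profiles with vanishing end data of a function `g`
has vanishing integrals over the superlevel sets of `g`. -/
theorem integral_superlevel_eq_zero [SFinite μ] {α L lA lB : ℝ} (hα : α ∈ Ioo (0:ℝ) 1) (hL : 0 < L)
    (hA : 0 < lA) (hB : 0 < lB) (hR : Integrable R μ) (hg : Measurable g)
    (hgL : ∀ᵐ x ∂μ, g x ∈ Ioo 0 L)
    (H : ∀ w, IsProfile α L lA lB 0 0 0 0 w → ∫ x, R x * w (g x) ∂μ = 0) (s : ℝ) :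
    ∫ x, (Ioi s).indicator 1 (g x) * R x ∂μ = 0 := by
  set N : ℝ → ℝ := fun s => ∫ x, (Ioi s).indicator 1 (g x) * R x ∂μ with hN
  have hmeas : Measurable (fun p : X × ℝ => (Ioi p.2).indicator (1 : ℝ → ℝ) (g p.1)) := by
    have : (fun p : X × ℝ => (Ioi p.2).indicator (1 : ℝ → ℝ) (g p.1))
        = {p : X × ℝ | p.2 < g p.1}.indicator 1 := by
      funext p
      simp [indicator_apply]
    rw [this]
    exact measurable_one.indicator (measurableSet_lt measurable_snd (hg.comp measurable_fst))
  have hprod : ∀ {b : ℝ → ℝ}, IntegrableOn b (Icc 0 L) →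
      Integrable (fun p : X × ℝ => (Ioi p.2).indicator 1 (g p.1) * (R p.1 * b p.2))
        (μ.prod (volume.restrict (Icc 0 L))) := by
    intro b hb
    refine (hR.mul_prod hb).bdd_mul (c := 1) hmeas.aestronglyMeasurable
      (Filter.Eventually.of_forall fun p => ?_)
    by_cases h : g p.1 ∈ Ioi p.2
    · simp [indicator_of_mem h]
    · simp [indicator_of_notMem h]
  have hNint : IntegrableOn N (Icc 0 L) := by
    have := (hprod (b := fun _ => 1) (integrableOn_const (by simp))).integral_prod_right
    simp only [mul_one] at this
    exact this
  -- Layer-cake formula: a profile with w(0) = 0 satisfies w(g x) = ∫ 1_{s < g x} w'(s) ds, so by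
  -- Fubini pairing `R` with w ∘ g is pairing `N` with w'.
  have hpair : ∀ b ∈ bumps L, (∀ i, ∫ s in Icc 0 L, endKer α L lA lB i s * b s = 0) →
      ∫ s in Icc 0 L, N s * b s = 0 := by
    intro b hb h0
    have hw := isProfile_primitive (a := 0) (b := 0) (c := 0) (d := 0) hα.2 hL hA hB hb fun i => by
      rw [h0 i]; fin_cases i <;> simp
    refine Eq.trans ?_ (H _ hw)
    have hbi : IntegrableOn b (Icc 0 L) := hb.1.continuous.continuousOn.integrableOn_Icc
    have e1 : ∫ s in Icc 0 L, N s * b s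
        = ∫ s in Icc 0 L, ∫ x, (Ioi s).indicator 1 (g x) * (R x * b s) ∂μ := by
      refine integral_congr_ae (Filter.Eventually.of_forall fun s => ?_)
      simp only [hN, ← integral_mul_const, mul_assoc]
    have hsw := integral_integral_swap (f := fun x s => (Ioi s).indicator 1 (g x) * (R x * b s))
      (hprod hbi)
    rw [e1, ← hsw]
    refine integral_congr_ae ?_
    filter_upwards [hgL] with x hx
    rw [zero_add, intervalIntegral.integral_of_le hx.1.le, ← integral_const_mul,
      integral_Icc_eq_integral_Ioc]
    rw [integral_Ioc_eq_integral_Ioo (x := (0:ℝ)) (y := g x), integral_Ioc_eq_integral_Ioo]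
    rw [← integral_indicator measurableSet_Ioo, ← integral_indicator measurableSet_Ioo]
    congr 1
    funext s
    by_cases h1 : s ∈ Ioo 0 (g x)
    · have h2 : s ∈ Ioo 0 L := ⟨h1.1, h1.2.trans hx.2⟩
      have h3 : g x ∈ Ioi s := h1.2
      simp [indicator_of_mem h1, indicator_of_mem h2, indicator_of_mem h3]
    · rw [indicator_of_notMem h1]
      by_cases h2 : s ∈ Ioo 0 L
      · have h3 : g x ∉ Ioi s := fun h3 => h1 ⟨h2.1, h3⟩
        simp [indicator_of_mem h2, indicator_of_notMem h3]
      · rw [indicator_of_notMem h2]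
  obtain ⟨c, hc⟩ := exists_combination_of_annihilates (integrableOn_endKer hα.2 hA hB) hNint hpair
  simp only [endKer, Fin.sum_univ_three, Matrix.cons_val_zero, Matrix.cons_val_one,
    Matrix.cons_val, mul_one] at hc
  obtain ⟨c1, c2⟩ := coeff_eq_zero_of_bounded (c₀ := c 0) (c₁ := c 1) (c₂ := c 2)
    (M := ∫ x, |R x| ∂μ) hα hL hA hB (hc.mono fun s hs => by
      rw [← hs]; exact abs_superlevel_le hR s)
  have hc0 : ∀ᵐ s ∂(volume.restrict (Icc 0 L)), N s = c 0 := by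
    filter_upwards [hc] with s hs
    rw [hs, c1, c2, zero_mul, zero_mul, add_zero, add_zero]
  -- Superlevel sets are open conditions in s, so `N` is continuous from the right and its
  -- almost-everywhere value c 0 is taken at every point of [0, L).
  have hright : ∀ s, Filter.Tendsto N (nhdsWithin s (Ioi s)) (nhds (N s)) := by
    intro s
    refine tendsto_superlevel hR hg (Filter.Eventually.of_forall fun x => ?_)
    by_cases h : s < g x
    · filter_upwards [nhdsWithin_le_nhds (gt_mem_nhds h)] with t ht
      rw [indicator_of_mem (show g x ∈ Ioi t from ht), indicator_of_mem (show g x ∈ Ioi s from h)]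
    · filter_upwards [self_mem_nhdsWithin] with t ht
      rw [indicator_of_notMem (show g x ∉ Ioi t from fun h' => h (lt_trans ht h')),
        indicator_of_notMem (show g x ∉ Ioi s from h)]
  have hNc : ∀ s ∈ Ico 0 L, N s = c 0 := fun s hs =>
    eq_of_tendsto_of_ae_eq hs.2 (ae_mono (Measure.restrict_mono
      (show Ioo s L ⊆ Icc 0 L from fun t ht => ⟨hs.1.trans ht.1.le, ht.2.le⟩) le_rfl) hc0) (hright s)
  -- As g < L almost everywhere, the superlevel sets shrink to a null set when s tends to L.
  have hc00 : c 0 = 0 := by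
    have hleft : Filter.Tendsto N (nhdsWithin L (Iio L)) (nhds (∫ _, (0:ℝ) ∂μ)) := by
      refine tendsto_superlevel hR hg ?_
      filter_upwards [hgL] with x hx
      filter_upwards [nhdsWithin_le_nhds (lt_mem_nhds hx.2)] with t ht
      rw [indicator_of_notMem (show g x ∉ Ioi t from not_lt.2 ht.le), zero_mul]
    rw [integral_zero] at hleft
    have hev : ∀ᶠ t in nhdsWithin L (Iio L), c 0 = N t := by
      filter_upwards [Ioo_mem_nhdsLT hL] with t ht
      exact (hNc t (Ioo_subset_Ico_self ht)).symm
    exact tendsto_nhds_unique (tendsto_const_nhds.congr' hev) hleft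
  change N s = 0
  rcases lt_or_ge s 0 with h | h
  · refine Eq.trans ?_ ((hNc 0 (left_mem_Ico.2 hL)).trans hc00)
    refine integral_congr_ae ?_
    filter_upwards [hgL] with x hx
    rw [indicator_of_mem (show g x ∈ Ioi s from h.trans hx.1),
      indicator_of_mem (show g x ∈ Ioi 0 from hx.1)]
  · rcases lt_or_ge s L with h' | h'
    · exact (hNc s ⟨h, h'⟩).trans hc00
    · refine integral_eq_zero_of_ae ?_
      filter_upwards [hgL] with x hx
      rw [indicator_of_notMem (show g x ∉ Ioi s from not_lt.2 (hx.2.le.trans h')), zero_mul,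
        Pi.zero_apply]

variable {ι : Type*} {G : ι → X → ℝ} {α L lA lB : ι → ℝ}

/-- Outside the segment the derivative vanishes, so the profile is constant on either side. -/
lemma IsProfile.bounded {α L lA lB a b c d : ℝ} (hL : 0 < L) {w : ℝ → ℝ}
    (hw : IsProfile α L lA lB a b c d w) : ∃ M, ∀ s, |w s| ≤ M := by
  have hw1 : Differentiable ℝ w := hw.contDiff.differentiable (by simp)
  have hz : ∀ s, s ∉ Ioo 0 L → deriv w s = 0 := fun s hs =>
    image_eq_zero_of_notMem_tsupport fun h => hs (hw.deriv_mem.2 h)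
  obtain ⟨M, hM⟩ := (isCompact_Icc (a := (0:ℝ)) (b := L)).exists_bound_of_continuousOn
    hw1.continuous.continuousOn
  have hconst : ∀ {s t : ℝ}, (∀ r ∈ uIcc s t, r ∉ Ioo 0 L) → w s = w t := by
    intro s t h
    have := intervalIntegral.integral_deriv_eq_sub (f := w) (a := s) (b := t) (fun r _ => hw1 r)
      (hw.deriv_mem.1.continuous.intervalIntegrable _ _)
    rw [intervalIntegral.integral_congr (g := fun _ => 0) (fun r hr => hz r (h r hr)),
      intervalIntegral.integral_zero] at this
    linarith
  refine ⟨M, fun s => ?_⟩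
  rcases lt_or_ge s 0 with h | h
  · rw [hconst (s := s) (t := 0) fun r hr hr' => by
      rw [uIcc_of_le h.le] at hr; linarith [hr.2, hr'.1]]
    exact hM 0 ⟨le_rfl, hL.le⟩
  · rcases le_or_gt s L with h' | h'
    · exact hM s ⟨h, h'⟩
    · rw [hconst (s := s) (t := L) fun r hr hr' => by
        rw [uIcc_of_ge h'.le] at hr; linarith [hr.1, hr'.2]]
      exact hM L ⟨hL.le, le_rfl⟩

/-- Version of `integral_superlevel_eq_zero` for products of profiles of several functions. -/
theorem integral_prod_superlevel_eq_zero [SFinite μ] (hα : ∀ i, α i ∈ Ioo (0:ℝ) 1)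
    (hL : ∀ i, 0 < L i) (hA : ∀ i, 0 < lA i) (hB : ∀ i, 0 < lB i)
    (hG : ∀ i, Measurable (G i)) (hGL : ∀ i, ∀ᵐ x ∂μ, G i x ∈ Ioo 0 (L i)) (J : Finset ι)
    (R : X → ℝ) (hR : Integrable R μ)
    (H : ∀ w : ι → ℝ → ℝ, (∀ i, IsProfile (α i) (L i) (lA i) (lB i) 0 0 0 0 (w i)) →
      ∫ x, R x * ∏ i ∈ J, w i (G i x) ∂μ = 0) (s : ι → ℝ) :
    ∫ x, (∏ i ∈ J, (Ioi (s i)).indicator 1 (G i x)) * R x ∂μ = 0 := by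
  classical
  induction J using Finset.induction_on generalizing R with
  | empty =>
    have hz : ∀ i, IsProfile (α i) (L i) (lA i) (lB i) 0 0 0 0 (fun _ => 0) := by
      intro i
      have := isProfile_primitive (α := α i) (L := L i) (lA := lA i) (lB := lB i) (a := 0) (b := 0)
        (c := 0) (d := 0) (hα i).2 (hL i) (hA i) (hB i) (Submodule.zero_mem _) fun j => by
          fin_cases j <;> simp
      simpa using this
    simpa using H (fun _ _ => 0) hz
  | insert i J hi IH =>
    have hind : Measurable fun x => (Ioi (s i)).indicator (1 : ℝ → ℝ) (G i x) :=
      (measurable_one.indicator measurableSet_Ioi).comp (hG i)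
    have hR' : Integrable (fun x => (Ioi (s i)).indicator 1 (G i x) * R x) μ := by
      refine hR.bdd_mul (c := 1) hind.aestronglyMeasurable (Filter.Eventually.of_forall fun x => ?_)
      by_cases h : G i x ∈ Ioi (s i)
      · simp [indicator_of_mem h]
      · simp [indicator_of_notMem h]
    -- The indicator of the new coordinate is absorbed into `R`. What the induction then asks for is
    -- the one-variable statement applied to `R` times the product of the remaining profiles.
    have := IH (fun x => (Ioi (s i)).indicator 1 (G i x) * R x) hR' fun w hw => ?_
    · rw [← this]
      congr 1
      funext x
      rw [Finset.prod_insert hi]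
      ring
    · have hP : Integrable (fun x => R x * ∏ j ∈ J, w j (G j x)) μ := by
        choose M hM using fun j => (hw j).bounded (hL j)
        refine hR.mul_bdd (c := ∏ j ∈ J, M j) (Measurable.aestronglyMeasurable ?_)
          (Filter.Eventually.of_forall fun x => ?_)
        · exact Finset.measurable_fun_prod _ fun j _ =>
            (hw j).contDiff.continuous.measurable.comp (hG j)
        · rw [norm_prod]
          exact Finset.prod_le_prod (fun j _ => norm_nonneg _) fun j _ => hM j _
      have := integral_superlevel_eq_zero (hα i) (hL i) (hA i) (hB i) hP (hG i) (hGL i)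
        (fun v hv => ?_) (s i)
      · rw [← this]
        congr 1
        funext x
        ring
      · rw [← H (Function.update w i v) fun j => ?_]
        · congr 1
          funext x
          have e : ∏ j ∈ J, Function.update w i v j (G j x) = ∏ j ∈ J, w j (G j x) :=
            Finset.prod_congr rfl fun j hj => by
              rw [Function.update_of_ne (ne_of_mem_of_not_mem hj hi)]
          rw [Finset.prod_insert hi, Function.update_self, e]
          ring
        · by_cases hj : j = i
          · subst hj
            rwa [Function.update_self]
          · rw [Function.update_of_ne hj]
            exact hw j

/-- Products of profiles in suitable coordinates detect integrable functions. -/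
theorem ae_eq_zero_of_integral_profiles [SFinite μ] [Fintype ι] (hα : ∀ i, α i ∈ Ioo (0:ℝ) 1)
    (hL : ∀ i, 0 < L i) (hA : ∀ i, 0 < lA i) (hB : ∀ i, 0 < lB i) (Φ : X ≃ᵐ (ι → ℝ)) (o : ι → ℝ)
    (hΦ : ∀ i, ∀ᵐ x ∂μ, Φ x i - o i ∈ Ioo 0 (L i)) (hR : Integrable R μ)
    (H : ∀ w : ι → ℝ → ℝ, (∀ i, IsProfile (α i) (L i) (lA i) (lB i) 0 0 0 0 (w i)) →
      ∫ x, R x * ∏ i, w i (Φ x i - o i) ∂μ = 0) : ∀ᵐ x ∂μ, R x = 0 := by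
  have hG : ∀ i, Measurable fun x => Φ x i - o i := fun i =>
    ((measurable_pi_apply i).comp Φ.measurable).sub_const _
  have key : ∀ s : ι → ℝ, ∫ x in Φ ⁻¹' (Set.univ.pi fun i => Ioi (s i)), R x ∂μ = 0 := by
    intro s
    rw [← integral_indicator (Φ.measurable (MeasurableSet.univ_pi fun i => measurableSet_Ioi)),
      ← integral_prod_superlevel_eq_zero hα hL hA hB hG hΦ Finset.univ R hR H fun i => s i - o i]
    congr 1
    funext x
    by_cases h : x ∈ Φ ⁻¹' (Set.univ.pi fun i => Ioi (s i))
    · rw [indicator_of_mem h, Finset.prod_eq_one, one_mul]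
      intro i _
      have : s i < Φ x i := h i (mem_univ i)
      rw [indicator_of_mem (by simpa using this), Pi.one_apply]
    · rw [indicator_of_notMem h]
      have : ∃ i, ¬ s i < Φ x i := by
        by_contra hc
        push Not at hc
        exact h fun i _ => hc i
      obtain ⟨i, hi⟩ := this
      rw [Finset.prod_eq_zero (Finset.mem_univ i), zero_mul]
      rw [indicator_of_notMem (by simpa using hi)]
  -- Open orthants form a π-system generating the Borel sets, so vanishing integrals spread from
  -- them to all measurable sets.
  have hgen : (MeasurableSpace.pi : MeasurableSpace (ι → ℝ)) = MeasurableSpace.generateFrom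
      (Set.univ.pi '' Set.univ.pi fun _ => range Ioi) := by
    refine (generateFrom_eq_pi (fun _ => ?_) fun _ => ?_).symm
    · rw [← borel_eq_generateFrom_Ioi, (inferInstance : BorelSpace ℝ).measurable_eq]
    · exact ⟨fun n => Ioi (-(n : ℝ)), fun n => mem_range_self _, eq_univ_of_forall fun x =>
        mem_iUnion.2 ((exists_nat_gt (-x)).imp fun n hn => by
          simp only [mem_Ioi]; linarith)⟩
  -- The total integral, needed for complements, is the integral over a superlevel set at level 0,
  -- where all shifted coordinates are positive almost everywhere.
  have htot : ∫ x, R x ∂μ = 0 := by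
    have := integral_prod_superlevel_eq_zero hα hL hA hB hG hΦ Finset.univ R hR H fun _ => 0
    rw [← this]
    refine integral_congr_ae ?_
    filter_upwards [ae_all_iff.2 hΦ] with x hx
    rw [Finset.prod_eq_one fun i _ => by
      rw [indicator_of_mem (show Φ x i - o i ∈ Ioi 0 from (hx i).1), Pi.one_apply], one_mul]
  have hall : ∀ A : Set (ι → ℝ), MeasurableSet A → ∫ x in Φ ⁻¹' A, R x ∂μ = 0 := by
    intro A hA
    induction A, hA using MeasurableSpace.induction_on_inter hgen
      (IsPiSystem.pi fun _ => isPiSystem_Ioi) with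
    | empty => simp
    | basic A hA =>
      obtain ⟨C, hC, rfl⟩ := hA
      choose s hs using fun i => hC i (mem_univ i)
      have := key s
      simpa only [hs] using this
    | compl A hA ih =>
      rw [preimage_compl, setIntegral_compl (Φ.measurable hA) hR, htot, ih, sub_zero]
    | iUnion A hd hA ih =>
      rw [preimage_iUnion, integral_iUnion (fun n => Φ.measurable (hA n))
        (fun m n h => (hd h).preimage Φ) hR.integrableOn]
      simp [ih]
  refine hR.ae_eq_zero_of_forall_setIntegral_eq_zero fun B hB _ => ?_
  have := hall (Φ.symm ⁻¹' B) (Φ.symm.measurable hB)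
  rwa [← preimage_comp, MeasurableEquiv.symm_comp_self, preimage_id] at this

end Superlevel

/-! ### Smoothness of Riesz–Caputo derivatives of profiles, and fields of finite energy. -/

lemma rieszCaputo_const_mul (α L lA lB c : ℝ) (f : ℝ → ℝ) (x : ℝ) :
    rieszCaputo α L lA lB (fun s => c * f s) x = c * rieszCaputo α L lA lB f x := by
  have h : deriv (fun s => c * f s) = fun s => c * deriv f s := by
    funext s
    exact deriv_const_mul_field c
  simp only [rieszCaputo, leftCaputo, rightCaputo, h, mul_left_comm _ c,
    intervalIntegral.integral_const_mul]
  ring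

lemma deriv_eq_of_eqOn_Icc {L : ℝ} {f g : ℝ → ℝ} (h : EqOn f g (Icc 0 L)) {s : ℝ}
    (hs : s ∈ Ioo 0 L) : deriv f s = deriv g s := by
  refine Filter.EventuallyEq.deriv_eq ?_
  filter_upwards [Icc_mem_nhds hs.1 hs.2] with t ht using h ht

/-- The terminals are cut off at the segment, so only derivatives at its interior points enter, and
these depend only on the values in the segment. -/
lemma rieszCaputo_congr {α L lA lB : ℝ} (hA : 0 < lA) (hB : 0 < lB) {f g : ℝ → ℝ}
    (h : EqOn f g (Icc 0 L)) {x : ℝ} (hx : x ∈ Icc 0 L) :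
    rieszCaputo α L lA lB f x = rieszCaputo α L lA lB g x := by
  have hl : lowerEnd lA x ≤ x := max_le hx.1 (by linarith)
  have hu : x ≤ upperEnd L lB x := le_min hx.2 (by linarith)
  have hl0 : 0 ≤ lowerEnd lA x := le_max_left _ _
  have huL : upperEnd L lB x ≤ L := min_le_left _ _
  unfold rieszCaputo leftCaputo rightCaputo
  simp only [intervalIntegral.integral_of_le hl, intervalIntegral.integral_of_le hu,
    integral_Ioc_eq_integral_Ioo]
  rw [setIntegral_congr_fun (f := fun s => (x - s) ^ (-α) * deriv f s)
      (g := fun s => (x - s) ^ (-α) * deriv g s) measurableSet_Ioo fun s hs => ?_,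
    setIntegral_congr_fun (f := fun s => (s - x) ^ (-α) * deriv f s)
      (g := fun s => (s - x) ^ (-α) * deriv g s) measurableSet_Ioo fun s hs => ?_]
  · simp only
    rw [deriv_eq_of_eqOn_Icc h ⟨hx.1.trans_lt hs.1, hs.2.trans_le huL⟩]
  · simp only
    rw [deriv_eq_of_eqOn_Icc h ⟨hl0.trans_lt hs.1, hs.2.trans_le hx.2⟩]

/-- The Riesz--Caputo derivative of a profile is smooth on the segment. -/
lemma IsProfile.exists_contDiff_caputo {α L lA lB a b c d : ℝ} (hα : α < 1) (hA : 0 < lA)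
    (hB : 0 < lB) {w : ℝ → ℝ} (hw : IsProfile α L lA lB a b c d w) :
    ∃ W : ℝ → ℝ, ContDiff ℝ (⊤ : ℕ∞) W ∧ ∀ x ∈ Icc 0 L, rieszCaputo α L lA lB w x = W x := by
  -- The convolution of an integrable kernel with the compactly supported smooth w' is smooth on the
  -- whole line; on the segment it coincides with the truncated integral because w' is supported
  -- inside.
  refine ⟨_, (hasCompactSupport_of_mem_bumps hw.deriv_mem).contDiff_convolution_right
    (ContinuousLinearMap.mul ℝ ℝ) (integrable_rieszKer hα hA hB).locallyIntegrable
    hw.deriv_mem.1, fun x hx => ?_⟩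
  rw [rieszCaputo_eq_of_deriv_mem hα hA hB hw.deriv_mem hx,
    setIntegral_eq_integral_of_forall_compl_eq_zero, convolution_def,
    ← integral_sub_left_eq_self _ volume x]
  · simp
  · intro s hs
    rw [image_eq_zero_of_notMem_tsupport
      fun h => hs (Ioo_subset_Icc_self (hw.deriv_mem.2 h)), mul_zero]

lemma ae_box_mem_Ioo {n : ℕ} (len : Fin n → ℝ) :
    ∀ᵐ x ∂(volume.restrict (Icc 0 len)), ∀ j, x j ∈ Ioo 0 (len j) := by
  have h : (univ.pi fun j => Ioo ((0 : Fin n → ℝ) j) (len j)) =ᵐ[volume] Icc 0 len :=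
    Measure.univ_pi_Ioo_ae_eq_Icc
  rw [← Measure.restrict_congr_set h]
  filter_upwards [ae_restrict_mem (MeasurableSet.univ_pi fun j => measurableSet_Ioo)] with x hx j
  exact hx j (mem_univ j)

namespace Solid

variable {S : Solid}

lemma line_eqOn {f g : Vec → ℝ} (h : EqOn f g S.Ω) {x : Vec} (hx : x ∈ S.Ω) (k : Fin 3) :
    EqOn (line f x k) (line g x k) (Icc 0 (S.len k)) := fun _ hs => h (S.update_mem hx hs)

/-- A continuously differentiable field whose strain is continuously differentiable has finite
energy. -/
lemma finiteEnergy_of_strain {v : Vec → Vec} (hv : ContDiff ℝ 1 v)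
    (h : ∀ i j, ∃ E : Vec → ℝ, ContDiff ℝ 1 E ∧ EqOn (S.strain v i j) E S.Ω) :
    S.FiniteEnergy v where
  contDiff := hv
  strain_ac i j k := by
    obtain ⟨E, hE, he⟩ := h i j
    filter_upwards [ae_restrict_mem measurableSet_Icc] with x hx
    refine ContDiffOn.absolutelyContinuousOnInterval ?_
    rw [uIcc_of_le (S.len_pos k).le]
    exact (contDiff_line hE x k).contDiffOn.congr (line_eqOn he hx k)
  strain_deriv i j k := by
    obtain ⟨E, hE, he⟩ := h i j
    refine (bddMeas_of_continuous (S := S) (continuous_pderiv hE k)).integrableOn.congr ?_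
    filter_upwards [ae_restrict_mem measurableSet_Icc, ae_box_mem_Ioo S.len] with x hx hx'
    exact (deriv_eq_of_eqOn_Icc (line_eqOn he hx k) (hx' k)).symm
  strainGrad_memLp i j k := by
    obtain ⟨E, hE, he⟩ := h i j
    refine ((bddMeas_D S.α₂_mem.2 hE k).memLp 2).ae_eq ?_
    filter_upwards [ae_restrict_mem measurableSet_Icc] with x hx
    exact (rieszCaputo_congr (S.lA_pos k) (S.lB_pos k) (line_eqOn he hx k)
      ⟨hx.1 k, hx.2 k⟩).symm

/-! ### Test fields -/

/-- Position of a face on the axis orthogonal to it. -/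
def faceEnd (S : Solid) (f : Face) : ℝ := if f.2 then S.len f.1 else 0

/-- Profiles on the three axes, with values `a` and Riesz--Caputo derivatives `g` at the faces. -/
def Profiles (S : Solid) (a g : Face → ℝ) (w : Fin 3 → ℝ → ℝ) : Prop :=
  ∀ j, IsProfile S.α₁ (S.len j) (S.lA j) (S.lB j) (a (j, false)) (a (j, true)) (g (j, false))
    (g (j, true)) (w j)

lemma α₁_mem_Ioo (S : Solid) : S.α₁ ∈ Ioo (0 : ℝ) 1 :=
  ⟨by linarith [S.α₁_mem.1], S.α₁_mem.2⟩

lemma exists_profiles (S : Solid) (a g : Face → ℝ) : ∃ w, S.Profiles a g w := by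
  choose w hw using fun j => exists_isProfile S.α₁_mem_Ioo (S.len_pos j) (S.lA_pos j) (S.lB_pos j)
    (a (j, false)) (a (j, true)) (g (j, false)) (g (j, true))
  exact ⟨w, hw⟩

lemma Profiles.value {a g : Face → ℝ} {w : Fin 3 → ℝ → ℝ} (hw : S.Profiles a g w) (f : Face) :
    w f.1 (S.faceEnd f) = a f := by
  obtain ⟨k, b⟩ := f
  cases b
  · simpa [faceEnd] using (hw k).left
  · simpa [faceEnd] using (hw k).right

lemma Profiles.caputo {a g : Face → ℝ} {w : Fin 3 → ℝ → ℝ} (hw : S.Profiles a g w) (f : Face) :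
    rieszCaputo S.α₁ (S.len f.1) (S.lA f.1) (S.lB f.1) (w f.1) (S.faceEnd f) = g f := by
  obtain ⟨k, b⟩ := f
  cases b
  · simpa [faceEnd] using (hw k).caputo_left
  · simpa [faceEnd] using (hw k).caputo_right

lemma D_prod (S : Solid) (w : Fin 3 → ℝ → ℝ) (c α : ℝ) (j : Fin 3) (x : Vec) :
    S.D α j (fun y => c * ∏ m, w m (y m)) x
      = c * (∏ m : Fin 2, w (j.succAbove m) (x (j.succAbove m)))
        * rieszCaputo α (S.len j) (S.lA j) (S.lB j) (w j) (x j) := by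
  rw [D, ← rieszCaputo_const_mul]
  congr 1
  funext s
  rw [line, Fin.prod_univ_succAbove _ j, Function.update_self]
  simp only [Function.update_of_ne (Fin.succAbove_ne j _)]
  ring

/-- Product test field in the `i`-th component. -/
def testField (t₁ : ℝ) (φ : ℝ → ℝ) (w : Fin 3 → ℝ → ℝ) (i : Fin 3) (t : ℝ) (x : Vec) : Vec :=
  Pi.single i (φ (t - t₁) * ∏ j, w j (x j))

lemma testField_same (t₁ : ℝ) (φ : ℝ → ℝ) (w : Fin 3 → ℝ → ℝ) (i : Fin 3) (t : ℝ) (x : Vec) :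
    testField t₁ φ w i t x i = φ (t - t₁) * ∏ j, w j (x j) := Pi.single_eq_same _ _

lemma testField_of_ne (t₁ : ℝ) (φ : ℝ → ℝ) (w : Fin 3 → ℝ → ℝ) {i i' : Fin 3} (h : i' ≠ i)
    (t : ℝ) (x : Vec) : testField t₁ φ w i t x i' = 0 := Pi.single_eq_of_ne h _

lemma D_zero_field (S : Solid) (α : ℝ) (j : Fin 3) (x : Vec) : S.D α j (fun _ => 0) x = 0 := by
  have := rieszCaputo_const_mul α (S.len j) (S.lA j) (S.lB j) 0 (fun _ => 0) (x j)
  simp only [zero_mul] at this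
  exact this

lemma contDiff_testField {a g : Face → ℝ} {w : Fin 3 → ℝ → ℝ} (hw : S.Profiles a g w)
    {φ : ℝ → ℝ} (hφ : ContDiff ℝ (⊤ : ℕ∞) φ) (t₁ : ℝ) (i : Fin 3) :
    ContDiff ℝ 1 (fun z : ℝ × Vec => testField t₁ φ w i z.1 z.2) := by
  have hφ1 : ContDiff ℝ 1 φ := hφ.of_le (by exact_mod_cast le_top)
  have hw1 : ∀ j, ContDiff ℝ 1 (w j) := fun j => (hw j).contDiff.of_le (by exact_mod_cast le_top)
  rw [contDiff_pi]
  intro i'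
  by_cases h : i' = i
  · subst h
    simp only [testField_same]
    exact (hφ1.comp (contDiff_fst.sub contDiff_const)).mul (contDiff_prod fun j _ =>
      (hw1 j).comp ((contDiff_apply ℝ ℝ j).comp contDiff_snd))
  · simp only [testField_of_ne _ _ _ h]
    exact contDiff_const

lemma exists_contDiff_D_testField {a g : Face → ℝ} {w : Fin 3 → ℝ → ℝ} (hw : S.Profiles a g w)
    (φ : ℝ → ℝ) (t₁ t : ℝ) (i i' j : Fin 3) :
    ∃ E : Vec → ℝ, ContDiff ℝ 1 E ∧
      EqOn (S.D S.α₁ j (fun y => testField t₁ φ w i t y i')) E S.Ω := by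
  by_cases h : i' = i
  · subst h
    obtain ⟨W, hW, he⟩ := (hw j).exists_contDiff_caputo S.α₁_mem.2 (S.lA_pos j) (S.lB_pos j)
    have hw1 : ∀ j, ContDiff ℝ 1 (w j) := fun j => (hw j).contDiff.of_le (by exact_mod_cast le_top)
    have hW1 : ContDiff ℝ 1 W := hW.of_le (by exact_mod_cast le_top)
    refine ⟨fun x => φ (t - t₁) * (∏ m : Fin 2, w (j.succAbove m) (x (j.succAbove m))) * W (x j),
      (contDiff_const.mul (contDiff_prod fun m _ => (hw1 _).comp (contDiff_apply ℝ ℝ _))).mul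
        (hW1.comp (contDiff_apply ℝ ℝ j)), fun x hx => ?_⟩
    simp only [testField_same]
    rw [D_prod, he _ ⟨hx.1 j, hx.2 j⟩]
  · refine ⟨fun _ => 0, contDiff_const, fun x _ => ?_⟩
    simp only [testField_of_ne _ _ _ h]
    exact S.D_zero_field _ _ _

lemma finiteEnergy_testField {a g : Face → ℝ} {w : Fin 3 → ℝ → ℝ} (hw : S.Profiles a g w)
    {φ : ℝ → ℝ} (hφ : ContDiff ℝ (⊤ : ℕ∞) φ) (t₁ t : ℝ) (i : Fin 3) :
    S.FiniteEnergy (testField t₁ φ w i t) := by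
  refine finiteEnergy_of_strain ?_ fun p q => ?_
  · exact (contDiff_testField hw hφ t₁ i).comp (contDiff_const.prodMk contDiff_id)
  · obtain ⟨E, hE, he⟩ := exists_contDiff_D_testField hw φ t₁ t i p q
    obtain ⟨E', hE', he'⟩ := exists_contDiff_D_testField hw φ t₁ t i q p
    refine ⟨fun x => 1 / 2 * (E x + E' x), contDiff_const.mul (hE.add hE'), fun x hx => ?_⟩
    rw [strain, he hx, he' hx]

/-- The end value splits off as a factor, so the data `a` and `g` work as switches: `a f` turns on
the displacement on a face, `g f` its normal gradient. -/
lemma testField_facePoint {a g : Face → ℝ} {w : Fin 3 → ℝ → ℝ} (hw : S.Profiles a g w)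
    (t₁ : ℝ) (φ : ℝ → ℝ) (i : Fin 3) (t : ℝ) (f : Face) (y : Fin 2 → ℝ) :
    testField t₁ φ w i t (S.facePoint f y) i
      = a f * (φ (t - t₁) * ∏ m, w (f.1.succAbove m) (y m)) := by
  rw [testField_same, Fin.prod_univ_succAbove _ f.1, ← hw.value f]
  simp only [facePoint, Fin.insertNth_apply_same, Fin.insertNth_apply_succAbove, faceEnd]
  ring

lemma normalGrad_testField {a g : Face → ℝ} {w : Fin 3 → ℝ → ℝ} (hw : S.Profiles a g w)
    (t₁ : ℝ) (φ : ℝ → ℝ) (i : Fin 3) (t : ℝ) (f : Face) (y : Fin 2 → ℝ) :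
    S.normalGrad (normal f) (testField t₁ φ w i t) i (S.facePoint f y)
      = sgn f.2 * g f * (φ (t - t₁) * ∏ m, w (f.1.succAbove m) (y m)) := by
  rw [normalGrad_normal, ← hw.caputo f]
  simp only [testField_same]
  rw [D_prod]
  simp only [facePoint, Fin.insertNth_apply_same, Fin.insertNth_apply_succAbove, faceEnd]
  ring

lemma normalGrad_testField_of_ne (S : Solid) (t₁ : ℝ) (φ : ℝ → ℝ) (w : Fin 3 → ℝ → ℝ)
    {i i' : Fin 3} (h : i' ≠ i) (t : ℝ) (f : Face) (x : Vec) :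
    S.normalGrad (normal f) (testField t₁ φ w i t) i' x = 0 := by
  rw [normalGrad_normal]
  simp only [testField_of_ne _ _ _ h]
  rw [D_zero_field, mul_zero]

/-- An edge is switched on only if both of its faces are. -/
lemma testField_edgePoint {a g : Face → ℝ} {w : Fin 3 → ℝ → ℝ} (hw : S.Profiles a g w)
    (t₁ : ℝ) (φ : ℝ → ℝ) (i : Fin 3) (t : ℝ) (e : Edge) (z : ℝ) :
    testField t₁ φ w i t (S.edgePoint e z) i
      = a (e.face 0) * a (e.face 1) * (φ (t - t₁) * w e.1 z) := by
  rw [testField_same, Fin.prod_univ_succAbove _ e.1, ← hw.value (e.face 0), ← hw.value (e.face 1),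
    Fin.prod_univ_two]
  simp only [edgePoint, Fin.insertNth_apply_same, Fin.insertNth_apply_succAbove]
  change φ (t - t₁) * (w e.1 z * (w (e.1.succAbove 0) (S.faceEnd (e.face 0))
      * w (e.1.succAbove 1) (S.faceEnd (e.face 1))))
    = w (e.1.succAbove 0) (S.faceEnd (e.face 0)) * w (e.1.succAbove 1) (S.faceEnd (e.face 1))
      * (φ (t - t₁) * w e.1 z)
  ring

/-- Test fields with suitable end data are admissible. -/
lemma admissible_testField {t₁ t₂ : ℝ} {B : Essential} {a g : Face → ℝ} {w : Fin 3 → ℝ → ℝ}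
    (hw : S.Profiles a g w) {φ : ℝ → ℝ} (hφ : IsProfile (1 / 2) (t₂ - t₁) 1 1 0 0 0 0 φ)
    (i : Fin 3) (hF : ∀ f, B.onFace f i → a f = 0) (hG : ∀ f, B.gradOnFace f i → g f = 0)
    (hE : ∀ e, B.onEdge e i → ∃ m, a (Edge.face e m) = 0) :
    S.Admissible t₁ t₂ B (testField t₁ φ w i) where
  contDiff := contDiff_testField hw hφ.contDiff t₁ i
  finiteEnergy t _ := finiteEnergy_testField hw hφ.contDiff t₁ t i
  start x _ := by rw [testField, sub_self, hφ.left, zero_mul, Pi.single_zero]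
  finish x _ := by rw [testField, hφ.right, zero_mul, Pi.single_zero]
  onFace f i' h t _ y _ := by
    by_cases hi : i' = i
    · subst hi
      rw [testField_facePoint hw, hF f h, zero_mul]
    · exact testField_of_ne _ _ _ hi _ _
  gradOnFace f i' h t _ y _ := by
    by_cases hi : i' = i
    · subst hi
      rw [normalGrad_testField hw, hG f h, mul_zero, zero_mul]
    · exact normalGrad_testField_of_ne _ _ _ _ hi _ _ _
  onEdge e i' h t _ z _ := by
    by_cases hi : i' = i
    · subst hi
      obtain ⟨m, hm⟩ := hE e h
      rw [testField_edgePoint hw]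
      have : a (e.face 0) * a (e.face 1) = 0 := by
        fin_cases m
        · exact mul_eq_zero_of_left hm _
        · exact mul_eq_zero_of_right _ hm
      rw [this, zero_mul]
    · exact testField_of_ne _ _ _ hi _ _

end Solid

lemma ae_Icc_mem_Ioo (a b : ℝ) : ∀ᵐ t ∂(volume.restrict (Icc a b)), t ∈ Ioo a b := by
  rw [← restrict_Ioo_eq_restrict_Icc]
  exact ae_restrict_mem measurableSet_Ioo

section TimeSpace

variable {t₁ t₂ α : ℝ}

/-- Products of a profile in time and of profiles in space detect integrable functions on a box. -/
lemma ae_eq_zero_of_integral_time_box (ht : t₁ < t₂) (hα : α ∈ Ioo (0:ℝ) 1) {n : ℕ}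
    {len lA lB : Fin n → ℝ} (hL : ∀ j, 0 < len j) (hA : ∀ j, 0 < lA j) (hB : ∀ j, 0 < lB j)
    {R : ℝ × (Fin n → ℝ) → ℝ}
    (hR : Integrable R ((volume.restrict (Icc t₁ t₂)).prod (volume.restrict (Icc 0 len))))
    (H : ∀ φ, IsProfile (1 / 2) (t₂ - t₁) 1 1 0 0 0 0 φ → ∀ w : Fin n → ℝ → ℝ,
      (∀ j, IsProfile α (len j) (lA j) (lB j) 0 0 0 0 (w j)) →
      ∫ z, R z * (φ (z.1 - t₁) * ∏ j, w j (z.2 j))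
        ∂((volume.restrict (Icc t₁ t₂)).prod (volume.restrict (Icc 0 len))) = 0) :
    ∀ᵐ z ∂((volume.restrict (Icc t₁ t₂)).prod (volume.restrict (Icc 0 len))), R z = 0 := by
  -- Time is treated as one more coordinate, shifted by t₁. Its order 1/2 and lengths 1 have no
  -- mechanical meaning; they only make the time factor a profile as well.
  refine ae_eq_zero_of_integral_profiles (ι := Fin (n + 1))
    (α := Fin.cons (1 / 2) fun _ => α) (L := Fin.cons (t₂ - t₁) len) (lA := Fin.cons 1 lA)
    (lB := Fin.cons 1 lB) ?_ ?_ ?_ ?_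
    (MeasurableEquiv.piFinSuccAbove (fun _ => ℝ) 0).symm (Fin.cons t₁ 0) ?_ hR fun w hw => ?_
  · exact Fin.cases ⟨by norm_num, by norm_num⟩ fun _ => hα
  · exact Fin.cases (sub_pos.2 ht) hL
  · exact Fin.cases one_pos hA
  · exact Fin.cases one_pos hB
  · have h1 := (Measure.quasiMeasurePreserving_fst
      (μ := volume.restrict (Icc t₁ t₂)) (ν := volume.restrict (Icc 0 len))).ae (ae_Icc_mem_Ioo t₁ t₂)
    have h2 := (Measure.quasiMeasurePreserving_snd
      (μ := volume.restrict (Icc t₁ t₂)) (ν := volume.restrict (Icc 0 len))).ae (ae_box_mem_Ioo len)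
    refine Fin.cases ?_ fun j => ?_
    · filter_upwards [h1] with z hz
      exact ⟨sub_pos.2 hz.1, sub_lt_sub_right hz.2 _⟩
    · filter_upwards [h2] with z hz
      have : (MeasurableEquiv.piFinSuccAbove (fun _ => ℝ) 0).symm z j.succ
          - (Fin.cons t₁ 0 : Fin (n + 1) → ℝ) j.succ = z.2 j := sub_zero _
      rw [this]
      exact hz j
  · refine Eq.trans ?_ (H (w 0) (hw 0) (fun j => w j.succ) fun j => hw j.succ)
    congr 1
    funext z
    rw [Fin.prod_univ_succ]
    congr 2
    refine Finset.prod_congr rfl fun j _ => ?_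
    congr 1
    exact sub_zero _

lemma ae_eq_zero_of_integral_time_segment (ht : t₁ < t₂) (hα : α ∈ Ioo (0:ℝ) 1) {L lA lB : ℝ}
    (hL : 0 < L) (hA : 0 < lA) (hB : 0 < lB) {R : ℝ × ℝ → ℝ}
    (hR : Integrable R ((volume.restrict (Icc t₁ t₂)).prod (volume.restrict (Icc 0 L))))
    (H : ∀ φ, IsProfile (1 / 2) (t₂ - t₁) 1 1 0 0 0 0 φ → ∀ w, IsProfile α L lA lB 0 0 0 0 w →
      ∫ z, R z * (φ (z.1 - t₁) * w z.2)
        ∂((volume.restrict (Icc t₁ t₂)).prod (volume.restrict (Icc 0 L))) = 0) :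
    ∀ᵐ z ∂((volume.restrict (Icc t₁ t₂)).prod (volume.restrict (Icc 0 L))), R z = 0 := by
  refine ae_eq_zero_of_integral_profiles (ι := Fin 2) (α := ![1 / 2, α]) (L := ![t₂ - t₁, L])
    (lA := ![1, lA]) (lB := ![1, lB]) ?_ ?_ ?_ ?_
    MeasurableEquiv.finTwoArrow.symm ![t₁, 0] ?_ hR fun w hw => ?_
  · exact Fin.forall_fin_two.2 ⟨⟨by norm_num, by norm_num⟩, hα⟩
  · exact Fin.forall_fin_two.2 ⟨sub_pos.2 ht, hL⟩
  · exact Fin.forall_fin_two.2 ⟨one_pos, hA⟩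
  · exact Fin.forall_fin_two.2 ⟨one_pos, hB⟩
  · have h1 := (Measure.quasiMeasurePreserving_fst
      (μ := volume.restrict (Icc t₁ t₂)) (ν := volume.restrict (Icc 0 L))).ae (ae_Icc_mem_Ioo t₁ t₂)
    have h2 := (Measure.quasiMeasurePreserving_snd
      (μ := volume.restrict (Icc t₁ t₂)) (ν := volume.restrict (Icc 0 L))).ae (ae_Icc_mem_Ioo 0 L)
    refine Fin.forall_fin_two.2 ⟨?_, ?_⟩
    · filter_upwards [h1] with z hz
      exact ⟨sub_pos.2 hz.1, sub_lt_sub_right hz.2 _⟩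
    · filter_upwards [h2] with z hz
      have : (MeasurableEquiv.finTwoArrow.symm z : Fin 2 → ℝ) 1 - (![t₁, 0] : Fin 2 → ℝ) 1 = z.2 :=
        sub_zero _
      rw [this]
      exact hz
  · refine Eq.trans ?_ (H (w 0) (hw 0) (w 1) (hw 1))
    congr 1
    funext z
    rw [Fin.prod_univ_two]
    congr 3
    exact sub_zero _

end TimeSpace

namespace Solid

variable {S : Solid} {t₁ t₂ : ℝ}

/-! ### Residuals of the natural conditions -/

/-- Residual of the governing equation. -/
def forceResidual (S : Solid) (P : Loads) (u : ℝ → Vec → Vec) (i : Fin 3) (z : ℝ × Vec) : ℝ :=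
  S.internalForce (u z.1) i z.2 + P.b z.1 z.2 i - S.ρ * velocity (velocity u) z.1 z.2 i

/-- Residual of the traction condition on a face. -/
def tractionResidual (S : Solid) (P : Loads) (u : ℝ → Vec → Vec) (f : Face) (i : Fin 3)
    (z : ℝ × (Fin 2 → ℝ)) : ℝ :=
  S.traction (normal f) (u z.1) i (S.facePoint f z.2) - P.t z.1 f (S.facePoint f z.2) i

/-- Residual of the double-stress traction condition on a face. -/
def doubleTractionResidual (S : Solid) (P : Loads) (u : ℝ → Vec → Vec) (f : Face) (i : Fin 3)
    (z : ℝ × (Fin 2 → ℝ)) : ℝ :=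
  S.doubleTraction (normal f) (u z.1) i (S.facePoint f z.2) - P.q z.1 f (S.facePoint f z.2) i

/-- Residual of the jump condition on an edge. -/
def jumpResidual (S : Solid) (P : Loads) (u : ℝ → Vec → Vec) (e : Edge) (i : Fin 3)
    (z : ℝ × ℝ) : ℝ :=
  S.jump e (u z.1) i (S.edgePoint e z.2) - P.r z.1 e (S.edgePoint e z.2) i

/-- The end data come out as explicit coefficients, linear on faces and bilinear on edges, so a
suitable choice leaves a single residual. -/
lemma residualWork_testField (P : Loads) (u : ℝ → Vec → Vec) {a g : Face → ℝ}
    {w : Fin 3 → ℝ → ℝ} (hw : S.Profiles a g w) (φ : ℝ → ℝ) (i : Fin 3) :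
    S.residualWork t₁ t₂ P u (testField t₁ φ w i)
      = -(∫ z, S.forceResidual P u i z * (φ (z.1 - t₁) * ∏ j, w j (z.2 j)) ∂(S.timeVol t₁ t₂))
        + (∑ f : Face, a f * ∫ z, S.tractionResidual P u f i z
            * (φ (z.1 - t₁) * ∏ m, w (f.1.succAbove m) (z.2 m)) ∂(S.timeFace t₁ t₂ f))
        + (∑ f : Face, sgn f.2 * g f * ∫ z, S.doubleTractionResidual P u f i z
            * (φ (z.1 - t₁) * ∏ m, w (f.1.succAbove m) (z.2 m)) ∂(S.timeFace t₁ t₂ f))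
        + ∑ e : Edge, a (e.face 0) * a (e.face 1) * ∫ z, S.jumpResidual P u e i z
            * (φ (z.1 - t₁) * w e.1 z.2) ∂(S.timeEdge t₁ t₂ e) := by
  unfold residualWork
  congr 1
  · congr 1
    · congr 1
      · congr 1
        rw [Finset.sum_eq_single i]
        · simp only [testField_same, forceResidual]
        · intro i' _ h
          simp only [testField_of_ne _ _ _ h, mul_zero, integral_zero]
        · simp
      · refine Finset.sum_congr rfl fun f _ => ?_
        rw [Finset.sum_eq_single i]
        · simp only [testField_facePoint hw, tractionResidual, mul_left_comm _ (a f),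
            integral_const_mul]
        · intro i' _ h
          simp only [testField_of_ne _ _ _ h, mul_zero, integral_zero]
        · simp
    · refine Finset.sum_congr rfl fun f _ => ?_
      rw [Finset.sum_eq_single i]
      · simp only [normalGrad_testField hw, doubleTractionResidual,
          mul_left_comm _ (sgn f.2 * g f), integral_const_mul]
      · intro i' _ h
        simp only [normalGrad_testField_of_ne _ _ _ _ h, mul_zero, integral_zero]
      · simp
  · refine Finset.sum_congr rfl fun e _ => ?_
    rw [Finset.sum_eq_single i]
    · simp only [testField_edgePoint hw, jumpResidual,
        mul_left_comm _ (a (e.face 0) * a (e.face 1)), integral_const_mul]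
    · intro i' _ h
      simp only [testField_of_ne _ _ _ h, mul_zero, integral_zero]
    · simp

lemma edge_face_ne (e : Edge) : e.face 0 ≠ e.face 1 := fun h => by
  have := Fin.succAbove_right_injective (congrArg Prod.fst h)
  exact absurd this (by decide)

/-- Two different edges do not lie on the same two faces. -/
lemma exists_face_notMem {e e' : Edge} (h : e' ≠ e) :
    ∃ m, e'.face m ≠ e.face 0 ∧ e'.face m ≠ e.face 1 := by
  by_contra hc
  push Not at hc
  have hsub : ∀ m, ∃ m', e'.face m = e.face m' := fun m => by
    by_cases h0 : e'.face m = e.face 0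
    · exact ⟨0, h0⟩
    · exact ⟨1, hc m h0⟩
  choose p hp using hsub
  have hpi : Function.Injective p := fun m m' hm => by
    have : e'.face m = e'.face m' := by rw [hp, hp, hm]
    exact Fin.succAbove_right_injective (congrArg Prod.fst this)
  have hsurj := Finite.surjective_of_injective hpi
  have h1 : e'.1 = e.1 := by
    by_contra hne
    obtain ⟨m', hm'⟩ := Fin.exists_succAbove_eq hne
    obtain ⟨m, rfl⟩ := hsurj m'
    exact Fin.succAbove_ne e'.1 m ((congrArg Prod.fst (hp m)).trans hm')
  refine h (Prod.ext h1 (funext fun m => ?_))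
  have hm := hp m
  have h2 : e'.1.succAbove m = e.1.succAbove (p m) := congrArg Prod.fst hm
  rw [h1] at h2
  have h3 := Fin.succAbove_right_injective h2
  have h4 : e'.2 m = e.2 (p m) := congrArg Prod.snd hm
  rw [h4, ← h3]

/-- Only the profile along the normal axis needs nonzero end data; those along the face are free,
which tests a face residual against all products. -/
lemma IsProfile.insertNth {k : Fin 3} {a g : Face → ℝ} {w₀ : Fin 3 → ℝ → ℝ}
    (hw₀ : S.Profiles a g w₀) (ha : ∀ f : Face, f.1 ≠ k → a f = 0)
    (hg : ∀ f : Face, f.1 ≠ k → g f = 0) {w : Fin 2 → ℝ → ℝ}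
    (hw : ∀ m, IsProfile S.α₁ (S.len (k.succAbove m)) (S.lA (k.succAbove m))
      (S.lB (k.succAbove m)) 0 0 0 0 (w m)) :
    S.Profiles a g (Fin.insertNth (α := fun _ => ℝ → ℝ) k (w₀ k) w) := by
  intro j
  rcases eq_or_ne j k with rfl | hj
  · rw [Fin.insertNth_apply_same]
    exact hw₀ j
  · obtain ⟨m, rfl⟩ := Fin.exists_succAbove_eq hj
    rw [Fin.insertNth_apply_succAbove, ha _ hj, ha _ hj, hg _ hj, hg _ hj]
    exact hw m

/-! ### From Hamilton's principle to the strong form. -/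

section Natural

variable {P : Loads} {B : Essential} {u : ℝ → Vec → Vec}

lemma Hamilton.residualWork_eq_zero (ht : t₁ ≤ t₂) (hP : S.IntegrableLoads t₁ t₂ P)
    (hu : S.RegularMotion t₁ t₂ u) (h : S.Hamilton t₁ t₂ P B u) {v : ℝ → Vec → Vec}
    (hv : S.Admissible t₁ t₂ B v) : S.residualWork t₁ t₂ P u v = 0 := by
  rw [← integral_action_variation ht hP hu hv.contDiff hv.finiteEnergy hv.start hv.finish]
  exact h.stationary v hv

lemma integrable_forceResidual (hP : S.IntegrableLoads t₁ t₂ P) (hu : S.RegularMotion t₁ t₂ u)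
    (i : Fin 3) : Integrable (S.forceResidual P u i) (S.timeVol t₁ t₂) :=
  ((hu.force_int i).add (hP.b i)).sub (integrable_of_continuous_timeVol
    (continuous_const.mul (continuous_pi_iff.1 hu.accel_cont i)))

lemma integral_mul_eq_zero_of_ae {X : Type*} [MeasurableSpace X] {μ : Measure X} {R φ : X → ℝ}
    (h : ∀ᵐ x ∂μ, R x = 0) : ∫ x, R x * φ x ∂μ = 0 :=
  integral_eq_zero_of_ae (h.mono fun _ hx => mul_eq_zero_of_left hx _)

/-- With all end data zero the variation is admissible for any essential conditions, and only the
volume term survives. -/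
lemma Hamilton.force_eq_zero (ht : t₁ < t₂) (hP : S.IntegrableLoads t₁ t₂ P)
    (hu : S.RegularMotion t₁ t₂ u) (h : S.Hamilton t₁ t₂ P B u) (i : Fin 3) :
    ∀ᵐ z ∂(S.timeVol t₁ t₂), S.forceResidual P u i z = 0 := by
  refine ae_eq_zero_of_integral_time_box ht S.α₁_mem_Ioo S.len_pos S.lA_pos S.lB_pos
    (integrable_forceResidual hP hu i) fun φ hφ w hw => ?_
  have hw' : S.Profiles (fun _ => 0) (fun _ => 0) w := hw
  have h0 := h.residualWork_eq_zero ht.le hP hu (admissible_testField (B := B) hw' hφ i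
    (fun _ _ => rfl) (fun _ _ => rfl) fun _ _ => ⟨0, rfl⟩)
  rw [residualWork_testField P u hw'] at h0
  change integral (S.timeVol t₁ t₂) _ = 0
  simpa using h0

/-- The displacement is switched on at the face `f` alone, with no normal gradients. The volume term
is already known to vanish, and all edge terms do because the two faces of an edge are distinct. -/
lemma Hamilton.traction_eq_zero (ht : t₁ < t₂) (hP : S.IntegrableLoads t₁ t₂ P)
    (hu : S.RegularMotion t₁ t₂ u) (h : S.Hamilton t₁ t₂ P B u) {f : Face} {i : Fin 3}
    (hf : ¬ B.onFace f i) : ∀ᵐ z ∂(S.timeFace t₁ t₂ f), S.tractionResidual P u f i z = 0 := by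
  classical
  obtain ⟨w₀, hw₀⟩ := S.exists_profiles (Pi.single f 1) 0
  refine ae_eq_zero_of_integral_time_box ht S.α₁_mem_Ioo (fun _ => S.len_pos _)
    (fun m => S.lA_pos (f.1.succAbove m)) (fun m => S.lB_pos (f.1.succAbove m))
    ((hu.traction_int f i).sub (hP.t f i)) fun φ hφ w hw => ?_
  have hw' := IsProfile.insertNth hw₀ (k := f.1)
    (fun f' hf' => Pi.single_eq_of_ne (fun he => hf' (by rw [he])) _) (fun _ _ => rfl) hw
  have hs : ∀ f', B.onFace f' i → (Pi.single f 1 : Face → ℝ) f' = 0 := fun f' hf' =>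
    Pi.single_eq_of_ne (fun he : f' = f => hf (he ▸ hf')) _
  have h0 := h.residualWork_eq_zero ht.le hP hu (admissible_testField (B := B) hw' hφ i
    hs (fun _ _ => rfl) fun e _ => ?_)
  · rw [residualWork_testField P u hw',
      integral_mul_eq_zero_of_ae (h.force_eq_zero ht hP hu i), Finset.sum_eq_single f] at h0
    · simp only [Pi.single_eq_same, one_mul, Pi.zero_apply, mul_zero, zero_mul,
        Finset.sum_const_zero, Fin.insertNth_apply_succAbove] at h0
      rw [Finset.sum_eq_zero] at h0
      · change integral (S.timeFace t₁ t₂ f) _ = 0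
        simpa using h0
      · intro e _
        by_cases he : e.face 0 = f
        · rw [Pi.single_eq_of_ne (i' := e.face 1) (i := f) (he ▸ (edge_face_ne e).symm), mul_zero,
            zero_mul]
        · rw [Pi.single_eq_of_ne he, zero_mul, zero_mul]
    · intro f' _ hne
      rw [Pi.single_eq_of_ne hne, zero_mul]
    · simp
  · by_cases he : e.face 0 = f
    · exact ⟨1, Pi.single_eq_of_ne (he ▸ (edge_face_ne e).symm) _⟩
    · exact ⟨0, Pi.single_eq_of_ne he _⟩

lemma Hamilton.doubleTraction_eq_zero (ht : t₁ < t₂) (hP : S.IntegrableLoads t₁ t₂ P)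
    (hu : S.RegularMotion t₁ t₂ u) (h : S.Hamilton t₁ t₂ P B u) {f : Face} {i : Fin 3}
    (hf : ¬ B.gradOnFace f i) :
    ∀ᵐ z ∂(S.timeFace t₁ t₂ f), S.doubleTractionResidual P u f i z = 0 := by
  classical
  -- The value is the sign of the normal, so that the coefficient of the residual is its square,
  -- one. All displacements on faces and edges are zero.
  obtain ⟨w₀, hw₀⟩ := S.exists_profiles 0 (Pi.single f (sgn f.2))
  refine ae_eq_zero_of_integral_time_box ht S.α₁_mem_Ioo (fun _ => S.len_pos _)
    (fun m => S.lA_pos (f.1.succAbove m)) (fun m => S.lB_pos (f.1.succAbove m))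
    ((hu.doubleTraction_int f i).sub (hP.q f i)) fun φ hφ w hw => ?_
  have hw' := IsProfile.insertNth hw₀ (k := f.1) (fun _ _ => rfl)
    (fun f' hf' => Pi.single_eq_of_ne (fun he => hf' (by rw [he])) _) hw
  have hs : ∀ f', B.gradOnFace f' i → (Pi.single f (sgn f.2) : Face → ℝ) f' = 0 := fun f' hf' =>
    Pi.single_eq_of_ne (fun he : f' = f => hf (he ▸ hf')) _
  have h0 := h.residualWork_eq_zero ht.le hP hu (admissible_testField (B := B) hw' hφ i
    (fun _ _ => rfl) hs
    fun e _ => ⟨0, rfl⟩)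
  rw [residualWork_testField P u hw',
    integral_mul_eq_zero_of_ae (h.force_eq_zero ht hP hu i)] at h0
  simp only [Pi.zero_apply, mul_zero, zero_mul, Finset.sum_const_zero] at h0
  rw [Finset.sum_eq_single f] at h0
  · simp only [Pi.single_eq_same, sgn_mul_self, one_mul, Fin.insertNth_apply_succAbove] at h0
    change integral (S.timeFace t₁ t₂ f) _ = 0
    simpa using h0
  · intro f' _ hne
    rw [Pi.single_eq_of_ne hne, mul_zero, zero_mul]
  · simp

/-- Both faces of the edge have to be switched on, so their traction terms appear too. They vanish
by the traction conditions: an edge without a prescribed displacement has two faces without one. No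
other edge lies on both faces. -/
lemma Hamilton.jump_eq_zero (ht : t₁ < t₂) (hP : S.IntegrableLoads t₁ t₂ P)
    (hu : S.RegularMotion t₁ t₂ u) (h : S.Hamilton t₁ t₂ P B u) {e : Edge} {i : Fin 3}
    (he : ¬ B.onEdge e i) : ∀ᵐ z ∂(S.timeEdge t₁ t₂ e), S.jumpResidual P u e i z = 0 := by
  classical
  set a : Face → ℝ := fun f => if f = e.face 0 ∨ f = e.face 1 then 1 else 0 with ha
  have haz : ∀ {f}, f ≠ e.face 0 → f ≠ e.face 1 → a f = 0 := fun h0 h1 =>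
    if_neg (not_or.2 ⟨h0, h1⟩)
  have ha0 : a (e.face 0) = 1 := if_pos (Or.inl rfl)
  have ha1 : a (e.face 1) = 1 := if_pos (Or.inr rfl)
  -- The faces at the ends of the edge stay switched off, so the profile along the edge can be any
  -- one with zero end data.
  have hax : ∀ b, a (e.1, b) = 0 := fun b => haz
    (fun h => Fin.succAbove_ne e.1 0 (congrArg Prod.fst h).symm)
    (fun h => Fin.succAbove_ne e.1 1 (congrArg Prod.fst h).symm)
  obtain ⟨w₀, hw₀⟩ := S.exists_profiles a 0
  refine ae_eq_zero_of_integral_time_segment ht S.α₁_mem_Ioo (S.len_pos e.1)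
    (S.lA_pos e.1) (S.lB_pos e.1) ((hu.jump_int e i).sub (hP.r e i)) fun φ hφ w hw => ?_
  have hw' : S.Profiles a 0 (Function.update w₀ e.1 w) := by
    intro j
    rcases eq_or_ne j e.1 with rfl | hj
    · rw [Function.update_self, hax, hax]
      exact hw
    · rw [Function.update_of_ne hj]
      exact hw₀ j
  have hface : ∀ f, a f ≠ 0 → ¬ B.onFace f i := by
    intro f hf hB
    by_cases h0 : f = e.face 0
    · exact he (Or.inr ⟨0, h0 ▸ hB⟩)
    · by_cases h1 : f = e.face 1
      · exact he (Or.inr ⟨1, h1 ▸ hB⟩)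
      · exact hf (haz h0 h1)
  have h0 := h.residualWork_eq_zero ht.le hP hu (admissible_testField (B := B) hw' hφ i
    (fun f hf => by_contra fun hne => hface f hne hf) (fun _ _ => rfl) fun e' he' => ?_)
  · rw [residualWork_testField P u hw',
      integral_mul_eq_zero_of_ae (h.force_eq_zero ht hP hu i), Finset.sum_eq_zero,
      Finset.sum_eq_zero, Finset.sum_eq_single e] at h0
    · change integral (S.timeEdge t₁ t₂ e) _ = 0
      simpa [ha0, ha1] using h0
    · intro e' _ hne
      obtain ⟨m, hm0, hm1⟩ := exists_face_notMem hne
      have hm := haz hm0 hm1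
      fin_cases m
      · rw [show a (e'.face 0) = 0 from hm, zero_mul, zero_mul]
      · rw [show a (e'.face 1) = 0 from hm, mul_zero, zero_mul]
    · simp
    · intro f _
      rw [Pi.zero_apply, mul_zero, zero_mul]
    · intro f _
      by_cases hf : a f = 0
      · rw [hf, zero_mul]
      · rw [integral_mul_eq_zero_of_ae (h.traction_eq_zero ht hP hu (hface f hf)), mul_zero]
  · obtain ⟨m, hm0, hm1⟩ := exists_face_notMem (e := e) (e' := e') fun hee => he (hee ▸ he')
    exact ⟨m, haz hm0 hm1⟩

/-- Hamilton's principle implies the strong form. -/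
theorem Hamilton.strongForm (ht : t₁ < t₂) (hP : S.IntegrableLoads t₁ t₂ P)
    (hu : S.RegularMotion t₁ t₂ u) (h : S.Hamilton t₁ t₂ P B u) : S.StrongForm t₁ t₂ P B u where
  essential := h.essential
  governing i := (h.force_eq_zero ht hP hu i).mono fun _ hz => sub_eq_zero.1 hz
  traction _ _ hf := (h.traction_eq_zero ht hP hu hf).mono fun _ hz => sub_eq_zero.1 hz
  doubleTraction _ _ hf := (h.doubleTraction_eq_zero ht hP hu hf).mono fun _ hz => sub_eq_zero.1 hz
  jump _ _ he := (h.jump_eq_zero ht hP hu he).mono fun _ hz => sub_eq_zero.1 hz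

end Natural

end Solid

end FracElast

end

theorem mainTheorem1 (S : FracElast.Solid) :
    (∀ u v : FracElast.Vec → FracElast.Vec,
      S.FiniteEnergy u → S.RegularStress u → S.FiniteEnergy v →
      HasDerivAt (fun s : ℝ => S.energy (u + s • v))
        (-(∫ x in S.Ω, ∑ i, S.internalForce u i x * v x i)
          + S.surfaceIntegral (fun f x =>
              ∑ i, S.traction (FracElast.normal f) u i x * v x i)
          + S.surfaceIntegral (fun f x =>
              ∑ i, S.doubleTraction (FracElast.normal f) u i x
                * S.normalGrad (FracElast.normal f) v i x)
          + S.edgeIntegral (fun e x => ∑ i, S.jump e u i x * v x i)) 0) ∧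
    (∀ (t₁ t₂ : ℝ), t₁ < t₂ →
      ∀ (P : FracElast.Loads) (B : FracElast.Essential)
        (u : ℝ → FracElast.Vec → FracElast.Vec),
      S.IntegrableLoads t₁ t₂ P → S.RegularMotion t₁ t₂ u →
      (S.Hamilton t₁ t₂ P B u ↔ S.StrongForm t₁ t₂ P B u)) := by
  refine ⟨fun u v hu hr hv => ?_, fun t₁ t₂ ht P B u hP hu =>
    ⟨fun h => h.strongForm ht hP hu, fun h => h.hamilton ht.le hP hu⟩⟩
  rw [← FracElast.Solid.first_variation_by_parts hr hu hv]
  exact FracElast.Solid.hasDerivAt_energy hu hv
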